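/- For $n,k\in\mathbb N$, let $k$-Linear be the class of all functions $g:\{0,1\}^n\to\{0,1\}$ of the form $g(x)=\sum_{i\in S}x_i$ (sum over $\mathbb F_2$) with $S\subseteq\{1,\dots,n\}$ and $|S|=k$. For a probability distribution $D$ on $\{0,1\}^n$, a function $f$ is $\epsilon$-far from $g$ with respect to $D$ if $\Pr_{x\sim D}[f(x)\neq g(x)]\ge\epsilon$. A tester is a randomized algorithm (with independent fair coin tosses) that may query a black box for $f:\{0,1\}^n\to\{0,1\}$ on strings of its choice and may draw independent samples from $D$, which is unknown to it. It is non-adaptive if the strings on which it queries $f$ are determined by its coin tosses and samples and do not depend on the answers to its queries. Running time is the number of steps of a uniform-cost random access machine with addition and subtraction, an oracle call being charged for the $n$ bits of its string. **Theorem.** There are one tester $P$ and constants $A$ and $c$ such that the following holds for all $n,k$ with $k<\sqrt n$ and all real $\epsilon>0$, where $P$ receives as input $n$, $k$ and any rational $q$ with $\epsilon/2\le q\le\epsilon$ (for instance $q=\epsilon$ if $\epsilon$ is rational): 1. (polynomial time) for every $f$, all coin tosses and all samples, $P$ halts within $c\,(n+1/\epsilon)^c$ steps; 2. (query complexity) for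 every $f$, all coin tosses and all samples, $P$ makes at most $A\,(k\log k+1/\epsilon)$ oracle calls, queries to $f$ and draws from $D$ together (where $0\log 0=0$); 3. $P$ is non-adaptive; 4. (distribution-free two-sided $\epsilon$-tester) for every distribution $D$ on $\{0,1\}^n$ and every $f:\{0,1\}^n\to\{0,1\}$: if $f$ is in $k$-Linear, then $P$ accepts with probability at least $2/3$; if $f$ is $\epsilon$-far with respect to $D$ from every $g$ in $k$-Linear, then $P$ rejects with probability at least $2/3$. -/

import Mathlib

open MeasureTheory ProbabilityTheory

noncomputable section

namespace KLinearTesting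

/-! ### Boolean functions, the class of `k`-linear functions, distance -/

/-- The cube `{0,1}^n`, with coordinates in the field `F_2`. -/
abbrev Cube (n : ℕ) : Type := Fin n → ZMod 2

/-- `k`-Linear: the functions that return the sum over `F_2` of exactly `k` coordinates. -/
def kLinear (n k : ℕ) : Set (Cube n → ZMod 2) :=
  {g | ∃ S : Finset (Fin n), S.card = k ∧ ∀ x, g x = ∑ i ∈ S, x i}

/-- `f` is `ε`-far from `g` with respect to `D`: `Pr_{x ∼ D}[f x ≠ g x] ≥ ε`. -/
def IsFar {n : ℕ} (D : Measure (Cube n)) (ε : ℝ) (f g : Cube n → ZMod 2) : Prop :=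
  ε ≤ D.real {x | f x ≠ g x}

/-! ### Randomized oracle machines with a step count

The model is the uniform-cost random access machine with addition and subtraction as its
arithmetic, programmed by structured programs. The memory consists of cells indexed by the natural
numbers, each holding a natural number. There is no multiplication, so in `t` steps numbers grow
by at most `t` bits: the step count is polynomially related to the running time of a Turing
machine. A program is a finite object that does not depend on `n`, `k`, `ε`, on the tested
function or on the distribution. -/

/-- Arithmetic expressions; `cell e` is the content of the cell with address `e`
(indirect addressing), `sub` is truncated subtraction. -/
inductive RExpr : Type
  | lit (c : ℕ)
  | cell (a : RExpr)
  | add (a b : RExpr)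
  | sub (a b : RExpr)

/-- The value of an expression in a memory. -/
def RExpr.eval (M : ℕ → ℕ) : RExpr → ℕ
  | .lit c => c
  | .cell a => M (a.eval M)
  | .add a b => a.eval M + b.eval M
  | .sub a b => a.eval M - b.eval M

/-- The number of steps for evaluating an expression: one for each node. -/
def RExpr.cost : RExpr → ℕ
  | .lit _ => 1
  | .cell a => a.cost + 1
  | .add a b => a.cost + b.cost + 1
  | .sub a b => a.cost + b.cost + 1

/-- Programs. -/
inductive Prog : Type
  /-- do nothing -/
  | skip
  /-- store the value of `e` in the cell with address `a` -/
  | assign (a e : RExpr)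
  /-- toss a fair coin and store the outcome in the cell with address `a` -/
  | flip (a : RExpr)
  /-- call the sampling oracle and store the sample `x ∈ {0,1}^n` in the `n` cells that start at
  address `a` -/
  | draw (a : RExpr)
  /-- query the black box on the string held by the `n` cells that start at address `b` and store
  the answer in the cell with address `a` -/
  | query (a b : RExpr)
  /-- run `p`, then `r` -/
  | seq (p r : Prog)
  /-- run `p` if the value of `e` is nonzero, and `r` otherwise -/
  | branch (e : RExpr) (p r : Prog)
  /-- run `p` as long as the value of `e` is nonzero -/
  | loop (e : RExpr) (p : Prog)

/-- What a run has access to: the tested function, the outcomes of its coin tosses (the `i`-th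
toss yields `coins i`) and the answers of the sampling oracle (the `i`-th call yields
`samples i`). -/
structure Env (n : ℕ) where
  f : Cube n → ZMod 2
  coins : ℕ → ZMod 2
  samples : ℕ → Cube n

/-- State of a run: the memory, the numbers of coins tossed and of samples drawn so far, and the
list of the strings queried so far (in order, with repetitions). -/
structure State (n : ℕ) where
  mem : ℕ → ℕ
  tossed : ℕ
  drawn : ℕ
  queries : List (Cube n)

/-- The string held by the `n` cells that start at address `a` (low-order bits). -/
def readString (n : ℕ) (M : ℕ → ℕ) (a : ℕ) : Cube n := fun i => (M (a + i) : ZMod 2)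

/-- The memory after the string `x` is stored in the `n` cells that start at address `a`. -/
def writeString {n : ℕ} (M : ℕ → ℕ) (a : ℕ) (x : Cube n) : ℕ → ℕ := fun j =>
  if h : a ≤ j ∧ j - a < n then (x ⟨j - a, h.2⟩).val else M j

/-- `Exec E p σ t σ'`: in the environment `E`, the program `p`, started in the state `σ`, halts
after `t` steps in the state `σ'`. An oracle call is charged for the `n` bits of its string. -/
inductive Exec {n : ℕ} (E : Env n) : Prog → State n → ℕ → State n → Prop
  | skip (σ : State n) : Exec E .skip σ 1 σ
  | assign (a e : RExpr) (σ : State n) :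
      Exec E (.assign a e) σ (a.cost + e.cost + 1)
        { σ with mem := Function.update σ.mem (a.eval σ.mem) (e.eval σ.mem) }
  | flip (a : RExpr) (σ : State n) :
      Exec E (.flip a) σ (a.cost + 1)
        { σ with
          mem := Function.update σ.mem (a.eval σ.mem) (E.coins σ.tossed).val
          tossed := σ.tossed + 1 }
  | draw (a : RExpr) (σ : State n) :
      Exec E (.draw a) σ (a.cost + n + 1)
        { σ with
          mem := writeString σ.mem (a.eval σ.mem) (E.samples σ.drawn)
          drawn := σ.drawn + 1 }
  | query (a b : RExpr) (σ : State n) :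
      Exec E (.query a b) σ (a.cost + b.cost + n + 1)
        { σ with
          mem := Function.update σ.mem (a.eval σ.mem)
            (E.f (readString n σ.mem (b.eval σ.mem))).val
          queries := σ.queries ++ [readString n σ.mem (b.eval σ.mem)] }
  | seq {p r : Prog} {σ₁ σ₂ σ₃ : State n} {t₁ t₂ : ℕ} :
      Exec E p σ₁ t₁ σ₂ → Exec E r σ₂ t₂ σ₃ → Exec E (.seq p r) σ₁ (t₁ + t₂) σ₃
  | branch_true {e : RExpr} {p r : Prog} {σ σ' : State n} {t : ℕ} :
      e.eval σ.mem ≠ 0 → Exec E p σ t σ' → Exec E (.branch e p r) σ (e.cost + 1 + t) σ'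
  | branch_false {e : RExpr} {p r : Prog} {σ σ' : State n} {t : ℕ} :
      e.eval σ.mem = 0 → Exec E r σ t σ' → Exec E (.branch e p r) σ (e.cost + 1 + t) σ'
  | loop_true {e : RExpr} {p : Prog} {σ₁ σ₂ σ₃ : State n} {t₁ t₂ : ℕ} :
      e.eval σ₁.mem ≠ 0 → Exec E p σ₁ t₁ σ₂ → Exec E (.loop e p) σ₂ t₂ σ₃ →
      Exec E (.loop e p) σ₁ (e.cost + 1 + t₁ + t₂) σ₃
  | loop_false {e : RExpr} {p : Prog} {σ : State n} :
      e.eval σ.mem = 0 → Exec E (.loop e p) σ (e.cost + 1) σ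

/-- The initial state on input `n`, `k` and the positive rational number `q`: these are given in
the cells `0`, `1` and `2`, `3` (numerator and denominator); all other cells hold `0`. -/
def start (n k : ℕ) (q : ℚ) : State n where
  mem := fun j => if j = 0 then n else if j = 1 then k else if j = 2 then q.num.toNat else
    if j = 3 then q.den else 0
  tossed := 0
  drawn := 0
  queries := []

/-- The run of `P` on input `(n, k, q)` with access to `f`, with coin tosses `ω` and samples `s`,
halts after `t` steps in the state `σ`. -/
def Runs (P : Prog) (n k : ℕ) (q : ℚ) (f : Cube n → ZMod 2) (ω : ℕ → ZMod 2) (s : ℕ → Cube n)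
    (t : ℕ) (σ : State n) : Prop :=
  Exec ⟨f, ω, s⟩ P (start n k q) t σ

/-- The run halts with the verdict "accept": cell `0` holds `1`. -/
def Accepts (P : Prog) (n k : ℕ) (q : ℚ) (f : Cube n → ZMod 2) (ω : ℕ → ZMod 2)
    (s : ℕ → Cube n) : Prop :=
  ∃ t σ, Runs P n k q f ω s t σ ∧ σ.mem 0 = 1

/-- The run halts with the verdict "reject": cell `0` does not hold `1`. -/
def Rejects (P : Prog) (n k : ℕ) (q : ℚ) (f : Cube n → ZMod 2) (ω : ℕ → ZMod 2)
    (s : ℕ → Cube n) : Prop :=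
  ∃ t σ, Runs P n k q f ω s t σ ∧ σ.mem 0 ≠ 1

/-- The joint law of the coin tosses (independent and fair) and of the samples (independent, with
law `D`, and independent of the coins). -/
def tapeLaw {n : ℕ} (D : Measure (Cube n)) [IsProbabilityMeasure D] :
    Measure ((ℕ → ZMod 2) × (ℕ → Cube n)) :=
  (Measure.infinitePi fun _ : ℕ => (PMF.uniformOfFintype (ZMod 2)).toMeasure).prod
    (Measure.infinitePi fun _ : ℕ => D)

/-! ### Testers -/

/-- On input `(n, k, q)`, the program `P` halts within `T` steps, whatever the tested function, the
coins and the samples are. -/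
def HaltsWithin (P : Prog) (n k : ℕ) (q : ℚ) (T : ℝ) : Prop :=
  ∀ f ω s, ∃ t σ, Runs P n k q f ω s t σ ∧ (t : ℝ) ≤ T

/-- On input `(n, k, q)`, the program `P` makes at most `Q` oracle calls (queries to the tested
function and draws from the sampling oracle together), whatever the tested function, the coins and
the samples are. -/
def QueryBound (P : Prog) (n k : ℕ) (q : ℚ) (Q : ℝ) : Prop :=
  ∀ f ω s t σ, Runs P n k q f ω s t σ → (σ.queries.length : ℝ) + (σ.drawn : ℝ) ≤ Q

/-- On input `(n, k, q)`, the program `P` is non-adaptive: the strings that it queries are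
determined by its coins and samples, and do not depend on the answers to queries. -/
def NonAdaptive (P : Prog) (n k : ℕ) (q : ℚ) : Prop :=
  ∀ ω s, ∃ L : List (Cube n), ∀ f t σ, Runs P n k q f ω s t σ → σ.queries = L

/-- On input `(n, k, q)`, the program `P` is a distribution-free (two-sided) `ε`-tester for the
class `C`. -/
def IsDistributionFreeTester (P : Prog) (n k : ℕ) (q : ℚ) (ε : ℝ)
    (C : Set (Cube n → ZMod 2)) : Prop :=
  ∀ (D : Measure (Cube n)) [IsProbabilityMeasure D] (f : Cube n → ZMod 2),
    (f ∈ C → 2 / 3 ≤ (tapeLaw D).real {τ | Accepts P n k q f τ.1 τ.2}) ∧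
    ((∀ g ∈ C, IsFar D ε f g) → 2 / 3 ≤ (tapeLaw D).real {τ | Rejects P n k q f τ.1 τ.2})

end KLinearTesting

end

/-! The tester first decodes a candidate set from hashed coordinates and then checks it. Let `2 ^ b`
be of order `k`. A random `φ` throws the coordinates into `2 ^ (2 * b)` large buckets. In each of `2
* b` rounds a random function throws the large buckets into `2 ^ b` small ones, and `f` is queried
on the indicator string of every small bucket. The set `T` of selected large buckets consists of
those whose small bucket got the answer 1 in more than half of the rounds; `T` must have `k`
elements. Then come `N`, about `16 / q`, trials with uniform strings `u`, `v`, `y` and a sample `x`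
from `D`: `f u + f v = f (u + v)`, `f u + f x = f (u + x)`, and `f u + lin T y = f (u + y ∘ φ)`.

Completeness: if `f = lin S` with `S.card = k`, then `φ` is injective on `S` except with probability
about `k ^ 2 / 4 ^ b` (`pr_not_injOn_le`). In that case a large bucket shares its small bucket with
another element of `φ(S)` with probability at most `1 / 64` per round, so a Chernoff bound
(`pr_majority_le`) and a union bound over the `4 ^ b` large buckets give `T = φ(S)` except with
probability `(4 / 9) ^ b` (`pr_selected_ne_le`). Then no trial can fail.

Soundness (`real_verdict_le`), by the uniform distance of `f` from linear functions. If it is at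
least `1 / 8` for all of them, the first check fails often (`blr`). If `f` is close to `lin S` with
`S.card = k`, then `f` and `lin S` differ on a set of `D`-measure at least `ε`, and self-correction
makes the second check fail for most `u` when `x` is in that set. If `f` is close to `lin S` with
`S.card ≠ k`, then `y ↦ lin S (y ∘ φ)` is the linear function of the buckets with an odd number of
elements of `S`. There are rarely exactly `k` of them (`pr_card_oddImage_eq_le`), so they differ
from `T`, and the third check fails with probability at least `1 / 4`.

The selected set enters only the value that an answer is compared with, never a queried string;
hence non-adaptivity. The decoding costs `2 * b * 2 ^ b = O(k log k + 1)` queries and the trials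
`O(1 / ε)` oracle calls. The tables have size of order `k ^ 2 + n`, which is where `k < √n` gives
polynomial time. On the machine side, `tester_spec` exhibits the run with its cost, queries and
verdict; on the probabilistic side, `map_tapeLaw` identifies the law of the data read from the tape.
-/

noncomputable section

namespace KLinearTesting

/-! ### Registers and arrays in the memory of the machine -/

/-- It suffices to exhibit one run per tape: by determinism its verdict, queries and draws are those
of every run. -/
theorem Exec.det {n : ℕ} {E : Env n} {p : Prog} {σ σ₁ σ₂ : State n} {t₁ t₂ : ℕ}
    (h₁ : Exec E p σ t₁ σ₁) (h₂ : Exec E p σ t₂ σ₂) : t₁ = t₂ ∧ σ₁ = σ₂ := by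
  induction h₁ generalizing t₂ σ₂ with
  | skip | assign | flip | draw | query => cases h₂; exact ⟨rfl, rfl⟩
  | seq _ _ ih₁ ih₂ =>
    cases h₂ with
    | seq a b =>
      obtain ⟨rfl, rfl⟩ := ih₁ a
      obtain ⟨rfl, rfl⟩ := ih₂ b
      exact ⟨rfl, rfl⟩
  | branch_true h _ ih =>
    cases h₂ with
    | branch_true _ a => obtain ⟨rfl, rfl⟩ := ih a; exact ⟨rfl, rfl⟩
    | branch_false h' _ => exact absurd h' h
  | branch_false h _ ih =>
    cases h₂ with
    | branch_true h' _ => exact absurd h h'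
    | branch_false _ a => obtain ⟨rfl, rfl⟩ := ih a; exact ⟨rfl, rfl⟩
  | loop_true h _ _ ih₁ ih₂ =>
    cases h₂ with
    | loop_true _ a b =>
      obtain ⟨rfl, rfl⟩ := ih₁ a
      obtain ⟨rfl, rfl⟩ := ih₂ b
      exact ⟨rfl, rfl⟩
    | loop_false h' => exact absurd h' h
  | loop_false h =>
    cases h₂ with
    | loop_true h' _ _ => exact absurd h h'
    | loop_false _ => exact ⟨rfl, rfl⟩

/-- A memory made of 64 registers `R` and of arrays `A c` of length `L`. -/
def layout (L : ℕ) (R : ℕ → ℕ) (A : ℕ → ℕ → ℕ) : ℕ → ℕ := fun a =>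
  if a < 64 then R a else A ((a - 64) / L) ((a - 64) % L)

theorem layout_reg {L : ℕ} {R : ℕ → ℕ} {A : ℕ → ℕ → ℕ} {i : ℕ} (hi : i < 64) :
    layout L R A i = R i := if_pos hi

theorem layout_arr {L : ℕ} {R : ℕ → ℕ} {A : ℕ → ℕ → ℕ} {c i : ℕ} (hi : i < L) :
    layout L R A (64 + c * L + i) = A c i := by
  have h1 : ¬ 64 + c * L + i < 64 := by omega
  have h2 : 64 + c * L + i - 64 = i + L * c := by rw [mul_comm L c]; omega
  rw [layout, if_neg h1, h2, Nat.add_mul_div_left _ _ (by omega), Nat.div_eq_of_lt hi, zero_add,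
    Nat.add_mul_mod_self_left, Nat.mod_eq_of_lt hi]

theorem update_layout_reg {L : ℕ} {R : ℕ → ℕ} {A : ℕ → ℕ → ℕ} {i v : ℕ} (hi : i < 64) :
    Function.update (layout L R A) i v = layout L (Function.update R i v) A := by
  funext a
  by_cases h : a = i
  · subst h; simp [layout, hi]
  · by_cases h' : a < 64 <;> simp [layout, h, h']

theorem addr_eq {L c i a : ℕ} (h : 64 ≤ a) (h1 : (a - 64) / L = c) (h2 : (a - 64) % L = i) :
    a = 64 + c * L + i := by
  have := Nat.div_add_mod (a - 64) L
  rw [h1, h2, mul_comm] at this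
  omega

theorem update_layout_arr {L : ℕ} {R : ℕ → ℕ} {A : ℕ → ℕ → ℕ} {c i v : ℕ} (hi : i < L) :
    Function.update (layout L R A) (64 + c * L + i) v =
      layout L R (Function.update A c (Function.update (A c) i v)) := by
  funext a
  by_cases h : a = 64 + c * L + i
  · subst h
    rw [Function.update_self, layout_arr hi]
    simp
  · rw [Function.update_of_ne h]
    by_cases h' : a < 64
    · simp [layout, h']
    · simp only [layout, h', if_false]
      by_cases h1 : (a - 64) / L = c
      · rw [h1, Function.update_self, Function.update_of_ne]
        intro h2
        exact h (addr_eq (by omega) h1 h2)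
      · rw [Function.update_of_ne h1]

/-- The array `g` with its first `X` entries replaced by those of `F`. -/
def fill (F : ℕ → ℕ) (X : ℕ) (g : ℕ → ℕ) : ℕ → ℕ := fun i => if i < X then F i else g i

theorem fill_zero (F g : ℕ → ℕ) : fill F 0 g = g := by funext i; simp [fill]

theorem update_fill (F g : ℕ → ℕ) (X : ℕ) :
    Function.update (fill F X g) X (F X) = fill F (X + 1) g := by
  funext i
  rcases lt_trichotomy i X with h | h | h
  · simp [fill, h, h.ne, Nat.lt_succ_of_lt h]
  · simp [fill, h]
  · have h1 : ¬ i < X := by omega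
    have h2 : ¬ i < X + 1 := by omega
    simp [fill, h.ne', h1, h2]

theorem fill_of_lt {F g : ℕ → ℕ} {X i : ℕ} (h : i < X) : fill F X g i = F i := if_pos h

theorem fill_of_le {F g : ℕ → ℕ} {X i : ℕ} (h : X ≤ i) : fill F X g i = g i :=
  if_neg (by omega)

/-- The entries of a string as numbers. -/
def entries {n : ℕ} (x : Cube n) : ℕ → ℕ := fun i => if h : i < n then (x ⟨i, h⟩).val else 0

/-- The string whose entries are the low-order bits of an array. -/
def toCube (n : ℕ) (g : ℕ → ℕ) : Cube n := fun i => (g i : ZMod 2)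

theorem writeString_layout {n L : ℕ} (R : ℕ → ℕ) (A : ℕ → ℕ → ℕ) (c : ℕ) (x : Cube n)
    (hn : n ≤ L) :
    writeString (layout L R A) (64 + c * L) x =
      layout L R (Function.update A c (fill (entries x) n (A c))) := by
  funext a
  by_cases h : 64 + c * L ≤ a ∧ a - (64 + c * L) < n
  · obtain ⟨i, rfl⟩ := Nat.exists_eq_add_of_le h.1
    have hi : i < n := by omega
    rw [layout_arr (by omega), Function.update_self, fill_of_lt hi, writeString, dif_pos h,
      entries, dif_pos hi]
    congr; omega
  · rw [writeString, dif_neg h]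
    by_cases h' : a < 64
    · simp [layout, h']
    · simp only [layout, h', if_false]
      by_cases h1 : (a - 64) / L = c
      · rw [h1, Function.update_self, fill_of_le]
        have := addr_eq (by omega) h1 rfl
        omega
      · rw [Function.update_of_ne h1]

theorem readString_layout {n L : ℕ} (R : ℕ → ℕ) (A : ℕ → ℕ → ℕ) (c : ℕ) (hn : n ≤ L) :
    readString n (layout L R A) (64 + c * L) = toCube n (A c) := by
  funext i
  rw [readString, layout_arr (by omega), toCube]

/-- Expressions in registers and array entries; register `20` holds the length of the arrays. -/
inductive HExpr : Type
  | lit (c : ℕ)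
  | reg (i : ℕ)
  | idx (c : ℕ) (e : HExpr)
  | add (a b : HExpr)
  | sub (a b : HExpr)

/-- The address of the array `c`. -/
def base : ℕ → RExpr
  | 0 => .lit 64
  | c + 1 => .add (base c) (.cell (.lit 20))

/-- The machine expression for an expression in registers and array entries. -/
def HExpr.toR : HExpr → RExpr
  | .lit c => .lit c
  | .reg i => .cell (.lit i)
  | .idx c e => .cell (.add (base c) e.toR)
  | .add a b => .add a.toR b.toR
  | .sub a b => .sub a.toR b.toR

/-- The value of an expression. -/
def HExpr.val (R : ℕ → ℕ) (A : ℕ → ℕ → ℕ) : HExpr → ℕ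
  | .lit c => c
  | .reg i => R i
  | .idx c e => A c (e.val R A)
  | .add a b => a.val R A + b.val R A
  | .sub a b => a.val R A - b.val R A

/-- The registers and array entries in an expression exist. -/
def HExpr.WF (L : ℕ) (R : ℕ → ℕ) (A : ℕ → ℕ → ℕ) : HExpr → Prop
  | .lit _ => True
  | .reg i => i < 64
  | .idx _ e => e.WF L R A ∧ R 20 = L ∧ e.val R A < L
  | .add a b => a.WF L R A ∧ b.WF L R A
  | .sub a b => a.WF L R A ∧ b.WF L R A

/-- The number of nodes of the machine expression. -/
def HExpr.size : HExpr → ℕ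
  | .lit _ => 1
  | .reg _ => 2
  | .idx c e => 2 * c + 3 * c + e.size + 3
  | .add a b => a.size + b.size + 1
  | .sub a b => a.size + b.size + 1

/-- The machine cannot multiply, so the offset `c * L` is built from `c` additions of register `20`.
The array numbers are constants of the program, hence so is the cost of an access. -/
theorem base_eval (L : ℕ) (R : ℕ → ℕ) (A : ℕ → ℕ → ℕ) (h : R 20 = L) (c : ℕ) :
    (base c).eval (layout L R A) = 64 + c * L := by
  induction c with
  | zero => simp [base, RExpr.eval]
  | succ c ih =>
    rw [base, RExpr.eval, ih, RExpr.eval, RExpr.eval, layout_reg (by norm_num), h]; ring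

theorem base_cost (c : ℕ) : (base c).cost ≤ 5 * c + 1 := by
  induction c with
  | zero => simp [base, RExpr.cost]
  | succ c ih => simp only [base, RExpr.cost]; omega

theorem HExpr.toR_eval {L : ℕ} {R : ℕ → ℕ} {A : ℕ → ℕ → ℕ} {e : HExpr} (h : e.WF L R A) :
    e.toR.eval (layout L R A) = e.val R A := by
  induction e with
  | lit => rfl
  | reg i => exact layout_reg h
  | idx c e ih =>
    obtain ⟨h1, h2, h3⟩ := h
    rw [toR, RExpr.eval, RExpr.eval, base_eval L R A h2, ih h1, layout_arr h3, val]
  | add a b iha ihb => rw [toR, RExpr.eval, iha h.1, ihb h.2, val]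
  | sub a b iha ihb => rw [toR, RExpr.eval, iha h.1, ihb h.2, val]

theorem HExpr.toR_cost (e : HExpr) : e.toR.cost ≤ e.size := by
  induction e with
  | lit => simp [toR, RExpr.cost, size]
  | reg => simp [toR, RExpr.cost, size]
  | idx c e ih => simp only [toR, RExpr.cost, size]; have := base_cost c; omega
  | add a b iha ihb => simp only [toR, RExpr.cost, size]; omega
  | sub a b iha ihb => simp only [toR, RExpr.cost, size]; omega

/-- A state of the machine in terms of registers and arrays. -/
@[ext] structure HState (n : ℕ) where
  R : ℕ → ℕ
  A : ℕ → ℕ → ℕ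
  tossed : ℕ
  drawn : ℕ
  queries : List (Cube n)

/-- The state with arrays of length `L`. -/
def HState.toState {n : ℕ} (L : ℕ) (s : HState n) : State n :=
  ⟨layout L s.R s.A, s.tossed, s.drawn, s.queries⟩

/-- Change a register. -/
def HState.setR {n : ℕ} (s : HState n) (i v : ℕ) : HState n :=
  { s with R := Function.update s.R i v }

/-- `p`, started in the state `s`, halts within `T` steps in a state with the property `Q`. -/
def Reach {n : ℕ} (E : Env n) (L : ℕ) (p : Prog) (s : HState n) (T : ℕ)
    (Q : HState n → Prop) : Prop :=
  ∃ t s', Exec E p (s.toState L) t (s'.toState L) ∧ t ≤ T ∧ Q s'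

/-- Assign to a register. -/
def setReg (i : ℕ) (e : HExpr) : Prog := .assign (.lit i) e.toR

/-- Assign to an entry of an array. -/
def setArr (c : ℕ) (i e : HExpr) : Prog := .assign (.add (base c) i.toR) e.toR

/-- Toss a coin into a register. -/
def flipReg (i : ℕ) : Prog := .flip (.lit i)

/-- Draw a sample into an array. -/
def drawArr (c : ℕ) : Prog := .draw (base c)

/-- Query an array and put the answer into a register. -/
def queryArr (i c : ℕ) : Prog := .query (.lit i) (base c)

/-- Run `body` with the values `0, 1, …` in register `i`, up to the content of register `b`
(exclusive); reset register `i` afterwards. -/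
def forLoop (i b : ℕ) (body : Prog) : Prog :=
  .seq (.loop (HExpr.sub (.reg b) (.reg i)).toR (.seq body (setReg i (.add (.reg i) (.lit 1)))))
    (setReg i (.lit 0))

/-! ### Hoare-style rules with step counts. -/

section rules

variable {n : ℕ} {E : Env n} {L : ℕ} {s : HState n} {T T' : ℕ} {Q Q' : HState n → Prop}

theorem Reach.intro {p : Prog} {t : ℕ} {s' : HState n} (hQ : Q s')
    (h : Exec E p (s.toState L) t (s'.toState L)) (ht : t ≤ T) : Reach E L p s T Q :=
  ⟨t, s', h, ht, hQ⟩

theorem Reach.mono {p : Prog} (h : Reach E L p s T Q) (hT : T ≤ T') : Reach E L p s T' Q := by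
  obtain ⟨t, s', h1, h2, h3⟩ := h
  exact ⟨t, s', h1, h2.trans hT, h3⟩

theorem Reach.imp {p : Prog} (h : Reach E L p s T Q) (hQ : ∀ s', Q s' → Q' s') :
    Reach E L p s T Q' := by
  obtain ⟨t, s', h1, h2, h3⟩ := h
  exact ⟨t, s', h1, h2, hQ _ h3⟩

theorem Reach.seq {p r : Prog} (h : Reach E L p s T fun s' => Reach E L r s' T' Q) :
    Reach E L (.seq p r) s (T + T') Q := by
  obtain ⟨t, s', h1, h2, t', s'', h3, h4, h5⟩ := h
  exact ⟨_, s'', .seq h1 h3, by omega, h5⟩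

theorem Reach.setReg {i : ℕ} {e : HExpr} (hi : i < 64) (he : e.WF L s.R s.A)
    (hQ : Q (s.setR i (e.val s.R s.A))) : Reach E L (setReg i e) s (e.size + 2) Q := by
  have h := Exec.assign (E := E) (.lit i) e.toR (s.toState L)
  simp only [HState.toState] at h
  rw [HExpr.toR_eval he, RExpr.eval, update_layout_reg hi] at h
  refine ⟨_, s.setR i (e.val s.R s.A), h, ?_, hQ⟩
  have := e.toR_cost
  simp only [RExpr.cost]; omega

theorem Reach.setArr {c : ℕ} {i e : HExpr} (h20 : s.R 20 = L) (hi : i.WF L s.R s.A)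
    (he : e.WF L s.R s.A) (hL : i.val s.R s.A < L)
    (hQ : Q ⟨s.R, Function.update s.A c (Function.update (s.A c) (i.val s.R s.A) (e.val s.R s.A)),
      s.tossed, s.drawn, s.queries⟩) :
    Reach E L (setArr c i e) s (5 * c + i.size + e.size + 3) Q := by
  have h := Exec.assign (E := E) (.add (base c) i.toR) e.toR (s.toState L)
  simp only [HState.toState] at h
  rw [HExpr.toR_eval he, RExpr.eval, base_eval _ _ _ h20, HExpr.toR_eval hi,
    update_layout_arr hL] at h
  refine Reach.intro hQ h ?_
  have := e.toR_cost
  have := i.toR_cost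
  have := base_cost c
  simp only [RExpr.cost]; omega

theorem Reach.flipReg {i : ℕ} (hi : i < 64)
    (hQ : Q ⟨Function.update s.R i (E.coins s.tossed).val, s.A, s.tossed + 1, s.drawn,
      s.queries⟩) :
    Reach E L (flipReg i) s 2 Q := by
  have h := Exec.flip (E := E) (.lit i) (s.toState L)
  simp only [HState.toState] at h
  rw [RExpr.eval, update_layout_reg hi] at h
  exact Reach.intro hQ h le_rfl

theorem Reach.drawArr {c : ℕ} (h20 : s.R 20 = L) (hn : n ≤ L)
    (hQ : Q ⟨s.R, Function.update s.A c (fill (entries (E.samples s.drawn)) n (s.A c)),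
      s.tossed, s.drawn + 1, s.queries⟩) :
    Reach E L (drawArr c) s (5 * c + n + 2) Q := by
  have h := Exec.draw (E := E) (base c) (s.toState L)
  simp only [HState.toState] at h
  rw [base_eval _ _ _ h20, writeString_layout _ _ _ _ hn] at h
  refine Reach.intro hQ h ?_
  have := base_cost c
  omega

theorem Reach.queryArr {i c : ℕ} (h20 : s.R 20 = L) (hi : i < 64) (hn : n ≤ L)
    (hQ : Q ⟨Function.update s.R i (E.f (toCube n (s.A c))).val, s.A, s.tossed, s.drawn,
      s.queries ++ [toCube n (s.A c)]⟩) :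
    Reach E L (queryArr i c) s (5 * c + n + 3) Q := by
  have h := Exec.query (E := E) (.lit i) (base c) (s.toState L)
  simp only [HState.toState] at h
  rw [base_eval _ _ _ h20, readString_layout _ _ _ hn, RExpr.eval, update_layout_reg hi] at h
  refine Reach.intro hQ h ?_
  have := base_cost c
  simp only [RExpr.cost]; omega

theorem Reach.branch {e : HExpr} {p r : Prog} (he : e.WF L s.R s.A)
    (h1 : e.val s.R s.A ≠ 0 → Reach E L p s T Q) (h2 : e.val s.R s.A = 0 → Reach E L r s T Q) :
    Reach E L (.branch e.toR p r) s (e.size + 1 + T) Q := by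
  have hc := e.toR_cost
  have hv : e.toR.eval (s.toState L).mem = e.val s.R s.A := HExpr.toR_eval he
  by_cases h : e.val s.R s.A = 0
  · obtain ⟨t, s', h3, h4, h5⟩ := h2 h
    exact ⟨_, s', .branch_false (hv.trans h) h3, by omega, h5⟩
  · obtain ⟨t, s', h3, h4, h5⟩ := h1 h
    exact ⟨_, s', .branch_true (by rwa [hv]) h3, by omega, h5⟩

/-- Loops whose guard takes the value `0` exactly after `X` rounds. -/
theorem Reach.loop {e : HExpr} {p : Prog} (I : ℕ → HState n → Prop) (X : ℕ)
    (he : ∀ j s, I j s → e.WF L s.R s.A) (hX : ∀ s, I X s → e.val s.R s.A = 0)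
    (hj : ∀ j < X, ∀ s, I j s → e.val s.R s.A ≠ 0 ∧ Reach E L p s T (I (j + 1))) (h0 : I 0 s) :
    Reach E L (.loop e.toR p) s (X * (T + e.size + 1) + e.size + 1) (I X) := by
  have hc := e.toR_cost
  have key : ∀ d ≤ X, ∀ s, I (X - d) s →
      Reach E L (.loop e.toR p) s (d * (T + e.size + 1) + e.size + 1) (I X) := by
    -- Induction on the number `d` of rounds that are still to come.
    intro d
    induction d with
    | zero =>
      intro _ s hs
      rw [Nat.sub_zero] at hs
      refine ⟨_, s, .loop_false ?_, by omega, hs⟩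
      exact (HExpr.toR_eval (he _ _ hs)).trans (hX s hs)
    | succ d ih =>
      intro hd s hs
      obtain ⟨h1, t, s', h2, h3, h4⟩ := hj _ (by omega) s hs
      rw [show X - (d + 1) + 1 = X - d by omega] at h4
      obtain ⟨t', s'', h5, h6, h7⟩ := ih (by omega) s' h4
      refine ⟨_, s'', .loop_true ?_ h2 h5, ?_, h7⟩
      · rw [← HExpr.toR_eval (he _ _ hs)] at h1; exact h1
      · rw [Nat.succ_mul]; omega
  exact key X le_rfl s (by simpa using h0)

/-- The invariant describes the state with the loop register zeroed, so that it holds verbatim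
before the first round and after the final reset. The overhead per round is `12 = 6 + 6` (guard and
increment), and `9 = 6 + 3` pays for the last guard and the reset. -/
theorem Reach.forLoop {i b : ℕ} {body : Prog} (I : ℕ → HState n → Prop) (X : ℕ)
    (hi : i < 64) (hb : b < 64) (hib : b ≠ i)
    (hI : ∀ j s, I j s → s.R i = 0 ∧ s.R b = X)
    (hj : ∀ j < X, ∀ s, I j s →
      Reach E L body (s.setR i j) T fun s' => s'.R i = j ∧ I (j + 1) (s'.setR i 0))
    (h0 : I 0 s) :
    Reach E L (forLoop i b body) s (X * (T + 12) + 9) (I X) := by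
  have hset : ∀ (s : HState n) v, s.R i = v → s.setR i v = s := by
    rintro s v rfl; simp [HState.setR]
  refine Reach.mono (Reach.seq (T := X * (T + 12) + 6) (T' := 3) ?_) (by omega)
  refine (Reach.mono (Reach.loop (T := T + 6)
    (fun j s => s.R i = j ∧ I j (s.setR i 0)) X ?_ ?_ ?_ ?_) ?_).imp ?_
  · intro j s _; exact ⟨hb, hi⟩
  · rintro s ⟨h1, h2⟩
    have := (hI _ _ h2).2
    simp only [HState.setR, ne_eq, hib, not_false_eq_true, Function.update_of_ne] at this
    simp [HExpr.val, h1, this]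
  · rintro j hjX s ⟨h1, h2⟩
    have h3 := (hI _ _ h2).2
    simp only [HState.setR, ne_eq, hib, not_false_eq_true, Function.update_of_ne] at h3
    refine ⟨by simp [HExpr.val, h1, h3]; omega, Reach.mono (Reach.seq (T' := 6) ?_) le_rfl⟩
    have h4 := hj j hjX _ h2
    have h5 : (s.setR i 0).setR i j = s := by simp [HState.setR, ← h1]
    rw [h5] at h4
    refine h4.imp ?_
    rintro s' ⟨h6, h7⟩
    refine Reach.mono (Reach.setReg hi ⟨hi, trivial⟩ ?_) le_rfl
    refine ⟨by simp [HExpr.val, HState.setR, h6], ?_⟩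
    simpa [HState.setR] using h7
  · exact ⟨(hI _ _ h0).1, by rwa [hset _ _ (hI _ _ h0).1]⟩
  · simp only [HExpr.size]; rw [show T + 6 + (2 + 2 + 1) + 1 = T + 12 by omega]
  · rintro s' ⟨h1, h2⟩
    exact Reach.setReg hi trivial h2

/-- For loops whose state after `j` rounds is known exactly, so that no existential invariant is
needed. -/
theorem Reach.forFun {i b : ℕ} {body : Prog} (F : ℕ → HState n) (X : ℕ)
    (hi : i < 64) (hb : b < 64) (hib : b ≠ i) (hR : ∀ j, (F j).R i = 0 ∧ (F j).R b = X)
    (hj : ∀ j < X, Reach E L body ((F j).setR i j) T fun s' => s' = (F (j + 1)).setR i j)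
    (h0 : s = F 0) (hQ : Q (F X)) :
    Reach E L (KLinearTesting.forLoop i b body) s (X * (T + 12) + 9) Q := by
  refine (Reach.forLoop (fun j s => s = F j) X hi hb hib ?_ ?_ h0).imp ?_
  · rintro j s rfl; exact hR j
  · rintro j hjX s rfl
    refine (hj j hjX).imp ?_
    rintro s' rfl
    refine ⟨by simp [HState.setR], ?_⟩
    have := (hR (j + 1)).1
    simp only [HState.setR, Function.update_idem]
    rw [← this, Function.update_eq_self]
  · rintro s' rfl; exact hQ

/-- Fill an array with the values of an expression. -/
theorem Reach.fillLoop {i b c : ℕ} {e : HExpr} (F : ℕ → ℕ) (X : ℕ)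
    (hi : i < 64) (hb : b < 64) (hib : b ≠ i) (hi20 : i ≠ 20) (h20 : s.R 20 = L)
    (hR : s.R i = 0) (hbX : s.R b = X) (hXL : X ≤ L)
    (he : ∀ j < X, e.WF L (Function.update s.R i j)
        (Function.update s.A c (fill F j (s.A c))) ∧
      e.val (Function.update s.R i j) (Function.update s.A c (fill F j (s.A c))) = F j)
    (hQ : Q { s with A := Function.update s.A c (fill F X (s.A c)) }) :
    Reach E L (KLinearTesting.forLoop i b (KLinearTesting.setArr c (.reg i) e)) s
      (X * (5 * c + e.size + 17) + 9) Q := by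
  refine Reach.mono (Reach.forFun
    (fun j => { s with A := Function.update s.A c (fill F j (s.A c)) }) X hi hb hib
    (fun j => ⟨hR, hbX⟩) ?_ (by simp [fill_zero]) hQ) (T := X * (5 * c + 2 + e.size + 3 + 12) + 9)
    (by rw [show 5 * c + 2 + e.size + 3 + 12 = 5 * c + e.size + 17 by ring])
  intro j hj
  obtain ⟨h1, h2⟩ := he j hj
  refine Reach.setArr (i := .reg i) ?_ hi h1 ?_ ?_
  · simpa [HState.setR, hi20.symm] using h20
  · simp [HExpr.val, HState.setR]; omega
  · have h2' : e.val (Function.update s.R i j) (Function.update s.A c (fill F j (s.A c))) = F j :=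
      h2
    simp only [HState.setR, HExpr.val, Function.update_self, h2', Function.update_idem,
      update_fill]

end rules

/-! ### Subroutines of the tester -/

/-- The number with the binary digits `ω τ, …, ω (τ + l - 1)`, highest first. -/
def bitsVal (ω : ℕ → ZMod 2) (τ : ℕ) : ℕ → ℕ
  | 0 => 0
  | l + 1 => bitsVal ω τ l + bitsVal ω τ l + (ω (τ + l)).val

/-- The distance of two numbers; for bits, their sum over `F_2`. -/
def natXor (a b : ℕ) : ℕ := (a - b) + (b - a)

/-- The expression for `natXor`. -/
def HExpr.xor (a b : HExpr) : HExpr := .add (.sub a b) (.sub b a)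

theorem toCube_fill (n : ℕ) (F g : ℕ → ℕ) : toCube n (fill F n g) = toCube n F := by
  funext i; simp [toCube, fill]

/-- Toss the bits of a number with as many digits as register `len` says, into register `18`. -/
def randNum (len : ℕ) : Prog :=
  forLoop 16 len (.seq (flipReg 17)
    (.seq (setReg 18 (.add (.add (.reg 18) (.reg 18)) (.reg 17))) (setReg 17 (.lit 0))))

/-- Fill an array with random numbers. -/
def randArr (c bnd len : ℕ) : Prog :=
  forLoop 15 bnd (.seq (randNum len) (.seq (setArr c (.reg 15) (.reg 18)) (setReg 18 (.lit 0))))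

section

variable {n : ℕ} {E : Env n} {L : ℕ} {s : HState n} {Q : HState n → Prop}

theorem Reach.randNum {len X : ℕ} (h16 : s.R 16 = 0) (h17 : s.R 17 = 0) (h18 : s.R 18 = 0)
    (hlen : s.R len = X) (hl : len < 64) (hl16 : len ≠ 16) (hl18 : len ≠ 18)
    (hQ : Q ⟨Function.update s.R 18 (bitsVal E.coins s.tossed X), s.A, s.tossed + X, s.drawn,
      s.queries⟩) :
    Reach E L (randNum len) s (X * 28 + 9) Q := by
  refine Reach.mono (Reach.forFun (fun j => ⟨Function.update s.R 18 (bitsVal E.coins s.tossed j),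
    s.A, s.tossed + j, s.drawn, s.queries⟩) X (by norm_num) hl hl16 ?_ ?_ ?_ hQ (T := 16)) le_rfl
  · intro j; simp [h16, hlen, hl18]
  · intro j _
    refine Reach.mono (Reach.seq (Reach.flipReg (by norm_num) (Reach.seq (Reach.setReg (by norm_num)
      ?_ (Reach.setReg (by norm_num) ?_ ?_))))) ?_
    · simp [HExpr.WF]
    · simp [HExpr.WF]
    · ext i
      · simp only [HState.setR, HExpr.val, Function.update_apply]
        split_ifs <;> simp_all [bitsVal]
      all_goals rfl
    · simp [HExpr.size]
  · ext i
    · by_cases h : i = 18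
      · subst h; simp [bitsVal, h18]
      · simp [h]
    all_goals rfl

theorem Reach.randArr {c bnd len X Y : ℕ} (h15 : s.R 15 = 0) (h16 : s.R 16 = 0) (h17 : s.R 17 = 0)
    (h18 : s.R 18 = 0) (h20 : s.R 20 = L)
    (hbnd : s.R bnd = X) (hlen : s.R len = Y) (hb : bnd < 15) (hl : len < 15 ∨ len = 19)
    (hX : X ≤ L)
    (hQ : Q ⟨s.R, Function.update s.A c (fill (fun i => bitsVal E.coins (s.tossed + i * Y) Y) X
      (s.A c)), s.tossed + X * Y, s.drawn, s.queries⟩) :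
    Reach E L (randArr c bnd len) s (X * (Y * 28 + 5 * c + 31) + 9) Q := by
  refine Reach.mono (Reach.forFun (fun j => ⟨s.R, Function.update s.A c
    (fill (fun i => bitsVal E.coins (s.tossed + i * Y) Y) j (s.A c)), s.tossed + j * Y, s.drawn,
    s.queries⟩) X (by norm_num) (by omega) (by omega) ?_ ?_ ?_ hQ (T := Y * 28 + 5 * c + 19)) ?_
  · intro j; exact ⟨h15, hbnd⟩
  · intro j hj
    have hn : len ≠ 15 := by omega
    refine Reach.mono (Reach.seq (Reach.randNum (X := Y) ?_ ?_ ?_ ?_ (by omega) (by omega)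
      (by omega) (Reach.seq (Reach.setArr (i := .reg 15) ?_ ?_ ?_ ?_
      (Reach.setReg (by norm_num) ?_ ?_))))) ?_
    · simp [HState.setR, h16]
    · simp [HState.setR, h17]
    · simp [HState.setR, h18]
    · simp [HState.setR, hlen, hn]
    · simp [HState.setR, h20]
    · simp [HExpr.WF]
    · simp [HExpr.WF]
    · simp [HExpr.val, HState.setR]; omega
    · simp [HExpr.WF]
    · refine HState.ext ?_ ?_ ?_ rfl rfl
      · funext i
        simp only [HState.setR, HExpr.val, Function.update_apply]
        split_ifs <;> simp_all
      · simp [HState.setR, HExpr.val, ← update_fill]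
      · change s.tossed + j * Y + Y = s.tossed + (j + 1) * Y; ring
    · simp [HExpr.size]; omega
  · simp [fill_zero]
  · exact le_of_eq (by ring)

/-- Accumulate values of an expression in a register. -/
theorem Reach.accLoop {i b w : ℕ} {e : HExpr} (F : ℕ → ℕ) (X : ℕ)
    (hi : i < 64) (hb : b < 64) (hw : w < 64) (hib : b ≠ i) (hiw : i ≠ w) (hbw : b ≠ w)
    (hR : s.R i = 0) (hbX : s.R b = X) (h0 : s.R w = F 0)
    (he : ∀ j < X, e.WF L (Function.update (Function.update s.R w (F j)) i j) s.A ∧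
      e.val (Function.update (Function.update s.R w (F j)) i j) s.A = F (j + 1))
    (hQ : Q (s.setR w (F X))) :
    Reach E L (KLinearTesting.forLoop i b (KLinearTesting.setReg w e)) s (X * (e.size + 14) + 9) Q := by
  refine Reach.mono (Reach.forFun (fun j => s.setR w (F j)) X hi hb hib ?_ ?_ ?_ hQ) le_rfl
  · intro j; simp [HState.setR, hR, hbX, hiw, hbw]
  · intro j hj
    obtain ⟨h1, h2⟩ := he j hj
    refine Reach.setReg hw h1 ?_
    have h2' : e.val ((s.setR w (F j)).setR i j).R s.A = F (j + 1) := h2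
    change ((s.setR w (F j)).setR i j).setR w (e.val ((s.setR w (F j)).setR i j).R s.A) = _
    rw [h2']
    ext a
    · simp only [HState.setR, Function.update_apply]
      split_ifs <;> simp_all
    all_goals rfl
  · rw [← h0]; simp [HState.setR]

end

/-! ### The values computed by the tester

`k` is the weight, `b` the number of bits of the labels of small buckets; there are `2 ^ b` small
and `2 ^ (2 * b)` large buckets. -/

section values

variable {n : ℕ} (k b : ℕ) (E : Env n)

/-- The large bucket of a coordinate. -/
def phiN (i : ℕ) : ℕ := bitsVal E.coins (i * (2 * b)) (2 * b)

/-- The number of tosses before round `t` of the decoding phase. -/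
def tossR (t : ℕ) : ℕ := n * (2 * b) + t * (2 ^ (2 * b) * b)

/-- The small bucket of a large bucket in round `t`. -/
def hashN (t a : ℕ) : ℕ := bitsVal E.coins (tossR (n := n) b t + a * b) b

/-- The indicator string of the small bucket `j` in round `t`. -/
def zN (t j i : ℕ) : ℕ := 1 - natXor (hashN b E t (phiN b E i)) j

/-- The answer for the small bucket `j` in round `t`. -/
def parN (t j : ℕ) : ℕ := (E.f (toCube n (zN b E t j))).val

/-- The number of positive answers for a large bucket in the first `t` rounds. -/
def cntN (t a : ℕ) : ℕ := ∑ t' ∈ Finset.range t, parN b E t' (hashN b E t' a)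

/-- Whether a large bucket is selected. -/
def selN (a : ℕ) : ℕ := 1 - (1 - (cntN b E (2 * b) a + cntN b E (2 * b) a - 2 * b))

/-- The number of selected buckets among the first `a`. -/
def numSel (a : ℕ) : ℕ := ∑ a' ∈ Finset.range a, selN b E a'

/-- The verdict of the decoding phase. -/
def flagInit : ℕ := 1 - natXor (numSel b E (2 ^ (2 * b))) k

/-- The strings queried in the first `t` rounds of the decoding phase. -/
def queriesR (t : ℕ) : List (Cube n) :=
  (List.range t).flatMap fun t' => (List.range (2 ^ b)).map fun j => toCube n (zN b E t' j)

/-- The number of tosses before trial `t`. -/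
def tossT (t : ℕ) : ℕ := tossR (n := n) b (2 * b) + t * (n + n + 2 ^ (2 * b))

/-- One toss per entry, in three consecutive blocks; the factors `1` are the digit count that
`randArr` finds in register `19`. -/
def uN (t i : ℕ) : ℕ := bitsVal E.coins (tossT (n := n) b t + i * 1) 1
def vN (t i : ℕ) : ℕ := bitsVal E.coins (tossT (n := n) b t + n * 1 + i * 1) 1
def yN (t i : ℕ) : ℕ := bitsVal E.coins (tossT (n := n) b t + n * 1 + n * 1 + i * 1) 1
def xN (t : ℕ) : ℕ → ℕ := entries (E.samples t)
-- Entries of these sums may be `2`. The oracle reads cells modulo 2, so no reduction is made.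
def uvN (t i : ℕ) : ℕ := uN b E t i + vN b E t i
def uxN (t i : ℕ) : ℕ := uN b E t i + xN E t i
def uyN (t i : ℕ) : ℕ := uN b E t i + yN b E t (phiN b E i)

/-- The sum over `F_2` of the first `a` bits of `y` at selected buckets. -/
def ySum (t : ℕ) : ℕ → ℕ
  | 0 => 0
  -- For bits `y` and `s`, truncated subtraction turns `y + s - 1` into the product of `y` and `s`.
  | a + 1 => natXor (ySum t a) (yN b E t a + selN b E a - 1)

/-- The answer of the black box. -/
def ans (g : ℕ → ℕ) : ℕ := (E.f (toCube n g)).val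

/-- The verdict after the first `t` trials. -/
def flagN : ℕ → ℕ
  | 0 => flagInit k b E
  -- Each `natXor` is a bit that vanishes iff the check holds; truncated subtraction keeps the flag
  -- at `1` only if all three vanish.
  | t + 1 => flagN t - natXor (ans E (uN b E t)) (natXor (ans E (vN b E t)) (ans E (uvN b E t)))
      - natXor (ans E (uN b E t)) (natXor (ans E (xN E t)) (ans E (uxN b E t)))
      - natXor (ans E (uN b E t)) (natXor (ans E (uyN b E t)) (ySum b E t (2 ^ (2 * b))))

/-- The strings queried in the first `t` trials. -/
def queriesT (t : ℕ) : List (Cube n) :=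
  (List.range t).flatMap fun t' => [toCube n (uN b E t'), toCube n (vN b E t'),
    toCube n (uvN b E t'), toCube n (xN E t'), toCube n (uxN b E t'), toCube n (uyN b E t')]

end values

/-! ### The tester -/

/-- The indicator string of a small bucket, into array `5`. -/
def bucketString : Prog :=
  -- Arrays: `0` the hash `φ`, `1` the hash of the round, `2` its answers, `3` vote counts, `4`
  -- selection, `5` indicator string, `6`, `7`, `8`, `9` the strings `u`, `v`, `y`, `x`, and `10`,
  -- `11`, `12` the strings `u + v`, `u + x`, `u + y ∘ φ`. Registers: `5`, `6`, `7`, `8` hold `2 ^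
  -- b`, `b`, `2 * b`, `2 ^ (2 * b)`; `9` the number of trials, `11` the verdict, `14` to `16` loop
  -- counters.
  forLoop 15 0 (setArr 5 (.reg 15) (.sub (.lit 1) (.xor (.idx 1 (.idx 0 (.reg 15))) (.reg 13))))

/-- The answers for all small buckets, into array `2`. -/
def bucketAnswers : Prog :=
  forLoop 13 5 (.seq bucketString
    (.seq (queryArr 17 5) (.seq (setArr 2 (.reg 13) (.reg 17)) (setReg 17 (.lit 0)))))

/-- One round of the decoding phase. -/
def decodeRound : Prog :=
  .seq (randArr 1 8 6) (.seq bucketAnswers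
    (forLoop 15 8 (setArr 3 (.reg 15) (.add (.idx 3 (.reg 15)) (.idx 2 (.idx 1 (.reg 15)))))))

/-- The decoding phase. -/
def decode : Prog := .seq (randArr 0 0 7) (forLoop 14 7 decodeRound)

/-- The selection of large buckets and the comparison of their number with `k`. -/
def select : Prog :=
  .seq (forLoop 15 8 (setArr 4 (.reg 15)
      (.sub (.lit 1) (.sub (.lit 1) (.sub (.add (.idx 3 (.reg 15)) (.idx 3 (.reg 15))) (.reg 7))))))
    (.seq (forLoop 15 8 (setReg 12 (.add (.reg 12) (.idx 4 (.reg 15)))))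
      (setReg 11 (.sub (.lit 1) (.xor (.reg 12) (.reg 1)))))

/-- The random strings of one trial. -/
def trialStrings : Prog :=
  .seq (randArr 6 0 19) (.seq (randArr 7 0 19) (.seq (randArr 8 8 19) (.seq (drawArr 9)
    (.seq (forLoop 15 0 (setArr 10 (.reg 15) (.add (.idx 6 (.reg 15)) (.idx 7 (.reg 15)))))
    (.seq (forLoop 15 0 (setArr 11 (.reg 15) (.add (.idx 6 (.reg 15)) (.idx 9 (.reg 15)))))
    (.seq (forLoop 15 0 (setArr 12 (.reg 15) (.add (.idx 6 (.reg 15)) (.idx 8 (.idx 0 (.reg 15))))))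
      (forLoop 15 8 (setReg 13 (.xor (.reg 13)
        (.sub (.add (.idx 8 (.reg 15)) (.idx 4 (.reg 15))) (.lit 1)))))))))))

/-- The queries of one trial. -/
def trialQueries : Prog :=
  .seq (queryArr 21 6) (.seq (queryArr 22 7) (.seq (queryArr 23 10) (.seq (queryArr 24 9)
    (.seq (queryArr 25 11) (queryArr 26 12)))))

/-- The verdict of one trial. -/
def trialVerdict : Prog :=
  .seq (setReg 11 (.sub (.reg 11) (.xor (.reg 21) (.xor (.reg 22) (.reg 23)))))
    (.seq (setReg 11 (.sub (.reg 11) (.xor (.reg 21) (.xor (.reg 24) (.reg 25)))))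
    (.seq (setReg 11 (.sub (.reg 11) (.xor (.reg 21) (.xor (.reg 26) (.reg 13)))))
    (.seq (setReg 13 (.lit 0)) (.seq (setReg 21 (.lit 0)) (.seq (setReg 22 (.lit 0))
    (.seq (setReg 23 (.lit 0)) (.seq (setReg 24 (.lit 0)) (.seq (setReg 25 (.lit 0))
      (setReg 26 (.lit 0))))))))))

/-- One trial. -/
def trial : Prog := .seq trialStrings (.seq trialQueries trialVerdict)

/-- The number of small buckets and the number of bits of their labels, into registers `5`, `6`. -/
def bitsParam : Prog :=
  .seq (setReg 4 (.lit 1)) (.seq (setReg 5 (.lit 64)) (.seq (setReg 6 (.lit 6))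
  (.loop (HExpr.sub (.add (.reg 1) (.lit 1)) (.reg 4)).toR
    (.seq (setReg 4 (.add (.reg 4) (.reg 4))) (.seq (setReg 5 (.add (.reg 5) (.reg 5)))
      (setReg 6 (.add (.reg 6) (.lit 1))))))))

/-- The number of trials, into register `9`. -/
def trialsParam : Prog :=
  .seq (setReg 10 (.add (.reg 3) (.reg 3))) (.seq (setReg 10 (.add (.reg 10) (.reg 10)))
  (.seq (setReg 10 (.add (.reg 10) (.reg 10))) (.seq (setReg 10 (.add (.reg 10) (.reg 10)))
  (.loop (HExpr.reg 10).toR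
    (.seq (setReg 10 (.sub (.reg 10) (.reg 2))) (setReg 9 (.add (.reg 9) (.lit 1))))))))

/-- The computation of the parameters. -/
def parameters : Prog :=
  .seq bitsParam (.seq (setReg 7 (.add (.reg 6) (.reg 6))) (.seq (setReg 8 (.lit 1))
  (.seq (forLoop 15 7 (setReg 8 (.add (.reg 8) (.reg 8)))) (.seq trialsParam
  (.seq (setReg 19 (.lit 1)) (setReg 20 (.add (.reg 0) (.add (.reg 8) (.reg 5)))))))))

/-- The tester. -/
def tester : Prog :=
  -- The guard is nonzero iff `q > 1`. Then `ε > 1`, nothing is `ε`-far from anything, and accepting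
  -- at once is right.
  .branch (HExpr.sub (.reg 2) (.reg 3)).toR (setReg 0 (.lit 1))
    (.seq parameters (.seq decode (.seq select
      (.seq (forLoop 14 9 trial) (setReg 0 (.reg 11))))))

theorem bitsVal_lt (ω : ℕ → ZMod 2) (τ l : ℕ) : bitsVal ω τ l < 2 ^ l := by
  induction l with
  | zero => simp [bitsVal]
  | succ l ih =>
    have := ZMod.val_lt (ω (τ + l))
    rw [bitsVal, pow_succ]; omega

/-! ### Correctness and cost of the phases. -/

section

variable {n k b : ℕ} {E : Env n} {L : ℕ} {s : HState n} {Q : HState n → Prop}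

theorem phiN_lt (i : ℕ) : phiN b E i < 2 ^ (2 * b) := bitsVal_lt _ _ _

theorem hashN_lt (t a : ℕ) : hashN b E t a < 2 ^ b := bitsVal_lt _ _ _

theorem Reach.bucketString {t j : ℕ} (h0 : s.R 0 = n) (h15 : s.R 15 = 0) (h20 : s.R 20 = L)
    (h13 : s.R 13 = j) (hn : n ≤ L) (hm : 2 ^ (2 * b) ≤ L) (hA0 : ∀ i < n, s.A 0 i = phiN b E i)
    (hA1 : ∀ a < 2 ^ (2 * b), s.A 1 a = hashN b E t a)
    (hQ : Q ⟨s.R, Function.update s.A 5 (fill (zN b E t j) n (s.A 5)), s.tossed, s.drawn,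
      s.queries⟩) :
    Reach E L bucketString s (n * 100 + 9) Q := by
  refine Reach.mono (Reach.fillLoop (zN b E t j) n (by norm_num) (by norm_num) (by norm_num)
    (by norm_num) h20 h15 h0 hn ?_ hQ) (by simp [HExpr.size, HExpr.xor]; omega)
  intro i hi
  have hp := phiN_lt (b := b) (E := E) i
  constructor
  · simp [HExpr.WF, HExpr.val, HExpr.xor, h20, hA0 i hi]; omega
  · simp [HExpr.val, HExpr.xor, zN, natXor, hA0 i hi, hA1 _ hp, h13]

/-- Array `5` is scratch space: the invariant leaves its contents `z` open. -/
theorem Reach.bucketAnswers {t : ℕ} (h0 : s.R 0 = n) (h5 : s.R 5 = 2 ^ b) (h13 : s.R 13 = 0)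
    (h15 : s.R 15 = 0) (h17 : s.R 17 = 0)
    (h20 : s.R 20 = L) (hn : n ≤ L) (hm : 2 ^ (2 * b) ≤ L) (hB : 2 ^ b ≤ L)
    (hA0 : ∀ i < n, s.A 0 i = phiN b E i)
    (hA1 : ∀ a < 2 ^ (2 * b), s.A 1 a = hashN b E t a)
    (hQ : ∀ z, Q ⟨s.R, Function.update (Function.update s.A 5 z) 2
      (fill (parN b E t) (2 ^ b) (s.A 2)), s.tossed, s.drawn,
      s.queries ++ (List.range (2 ^ b)).map fun j => toCube n (zN b E t j)⟩) :
    Reach E L bucketAnswers s (2 ^ b * (n * 101 + 80) + 9) Q := by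
  refine Reach.mono ((Reach.forLoop (fun j s' => ∃ z, s' = ⟨s.R,
    Function.update (Function.update s.A 5 z) 2 (fill (parN b E t) j (s.A 2)), s.tossed, s.drawn,
    s.queries ++ (List.range j).map fun j => toCube n (zN b E t j)⟩) (2 ^ b)
    (by norm_num) (by norm_num) (by norm_num) ?_ ?_ ?_ (T := n * 101 + 68)).imp ?_) ?_
  · rintro j _ ⟨z, rfl⟩; exact ⟨h13, h5⟩
  · rintro j hj _ ⟨z, rfl⟩
    refine Reach.mono (Reach.seq (Reach.bucketString (b := b) (t := t) (j := j) ?_ ?_ ?_ ?_ hn hm ?_ ?_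
      (Reach.seq (Reach.queryArr ?_ (by norm_num) hn (Reach.seq (Reach.setArr (i := .reg 13)
      ?_ ?_ ?_ ?_ (Reach.setReg (by norm_num) ?_ ⟨?_, ?_⟩))))))) ?_
    · simp [HState.setR, h0]
    · simp [HState.setR, h15]
    · simp [HState.setR, h20]
    · simp [HState.setR]
    · simpa [HState.setR] using hA0
    · simpa [HState.setR] using hA1
    · simp [HState.setR, h20]
    · simp [HState.setR, h20]
    · simp [HExpr.WF]
    · simp [HExpr.WF]
    · simp [HExpr.val, HState.setR]; omega
    · simp [HExpr.WF]
    · simp [HState.setR]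
    · refine ⟨fill (zN b E t j) n z, ?_⟩
      refine HState.ext ?_ ?_ rfl rfl ?_
      · funext i
        simp only [HState.setR, HExpr.val, Function.update_apply]
        split_ifs <;> simp_all
      · funext i
        have := update_fill (parN b E t) (s.A 2) j
        simp only [HState.setR, HExpr.val]
        by_cases h2 : i = 2
        · subst h2
          simp [← this, toCube_fill, parN]
        · by_cases h5 : i = 5
          · subst h5; simp
          · simp [h2, h5]
      · simp [HState.setR, toCube_fill, List.range_succ]
    · simp [HExpr.size]; omega
  · exact ⟨s.A 5, by simp [fill_zero]⟩
  · rintro _ ⟨z, rfl⟩; exact hQ z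
  · exact le_of_eq (by ring)

theorem Reach.decodeRound {t : ℕ} (h0 : s.R 0 = n) (h5 : s.R 5 = 2 ^ b) (h6 : s.R 6 = b)
    (h8 : s.R 8 = 2 ^ (2 * b)) (h13 : s.R 13 = 0)
    (h15 : s.R 15 = 0) (h16 : s.R 16 = 0) (h17 : s.R 17 = 0) (h18 : s.R 18 = 0)
    (h20 : s.R 20 = L) (hn : n ≤ L) (hm : 2 ^ (2 * b) ≤ L) (hB : 2 ^ b ≤ L)
    (hA0 : ∀ i < n, s.A 0 i = phiN b E i) (hA3 : ∀ a < 2 ^ (2 * b), s.A 3 a = cntN b E t a)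
    (hs : s.tossed = tossR (n := n) b t)
    (hQ : ∀ A, (∀ i < n, A 0 i = phiN b E i) → (∀ a < 2 ^ (2 * b), A 3 a = cntN b E (t + 1) a) →
      Q ⟨s.R, A, tossR (n := n) b (t + 1), s.drawn,
      s.queries ++ (List.range (2 ^ b)).map fun j => toCube n (zN b E t j)⟩) :
    Reach E L decodeRound s (2 ^ (2 * b) * (b * 28 + 36) + 9 + (2 ^ b * (n * 101 + 80) + 9) +
      (2 ^ (2 * b) * 100 + 9)) Q := by
  refine Reach.mono (Reach.seq (T' := (2 ^ b * (n * 101 + 80) + 9) + (2 ^ (2 * b) * 100 + 9))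
    (Reach.randArr (X := 2 ^ (2 * b)) (Y := b) h15 h16 h17 h18 h20 h8 h6
    (by norm_num) (by norm_num) hm (Reach.seq (Reach.bucketAnswers (b := b) (t := t) ?_ ?_ ?_ ?_ ?_ ?_
    hn hm hB ?_ ?_ ?_)))) ?_
  · exact h0
  · exact h5
  · exact h13
  · exact h15
  · exact h17
  · exact h20
  · simpa using hA0
  · intro a ha
    simp [fill_of_lt ha, hs, hashN]
  · intro z
    refine Reach.mono (Reach.fillLoop (cntN b E (t + 1)) (2 ^ (2 * b)) (by norm_num) (by norm_num)
      (by norm_num) (by norm_num) h20 h15 h8 hm ?_ ?_) (by simp [HExpr.size])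
    · intro a ha
      have hh := hashN_lt (b := b) (E := E) t a
      have h1 : bitsVal E.coins (s.tossed + a * b) b = hashN b E t a := by rw [hs, hashN]
      constructor
      · simp [HExpr.WF, HExpr.val, h20, fill_of_lt ha, h1]; omega
      · simp [HExpr.val, fill_of_lt ha, h1, fill_of_lt hh, fill_of_le le_rfl, hA3 a ha, cntN,
          Finset.sum_range_succ]
    · have h2 : s.tossed + 2 ^ (2 * b) * b = tossR (n := n) b (t + 1) := by
        rw [hs, tossR, tossR]; ring
      rw [h2]
      refine hQ _ ?_ ?_
      · simpa using hA0
      · intro a ha; simp [fill_of_lt ha]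
  · exact le_of_eq (by ring)

theorem Reach.decode (h0 : s.R 0 = n) (h5 : s.R 5 = 2 ^ b) (h6 : s.R 6 = b) (h7 : s.R 7 = 2 * b)
    (h8 : s.R 8 = 2 ^ (2 * b)) (h13 : s.R 13 = 0) (h14 : s.R 14 = 0)
    (h15 : s.R 15 = 0) (h16 : s.R 16 = 0) (h17 : s.R 17 = 0) (h18 : s.R 18 = 0)
    (h20 : s.R 20 = L) (hn : n ≤ L) (hm : 2 ^ (2 * b) ≤ L) (hB : 2 ^ b ≤ L)
    (hA3 : ∀ a < 2 ^ (2 * b), s.A 3 a = 0)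
    (hs : s.tossed = 0) (hq : s.queries = [])
    (hQ : ∀ A, (∀ i < n, A 0 i = phiN b E i) → (∀ a < 2 ^ (2 * b), A 3 a = cntN b E (2 * b) a) →
      Q ⟨s.R, A, tossR (n := n) b (2 * b), s.drawn, queriesR b E (2 * b)⟩) :
    Reach E L decode s (n * (2 * b * 28 + 31) + 9 + (2 * b * (2 ^ (2 * b) * (b * 28 + 36) + 9 +
      (2 ^ b * (n * 101 + 80) + 9) + (2 ^ (2 * b) * 100 + 9) + 12) + 9)) Q := by
  refine Reach.mono (Reach.seq (Reach.randArr (X := n) (Y := 2 * b) h15 h16 h17 h18 h20 h0 h7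
    (by norm_num) (by norm_num) hn ((Reach.forLoop (fun t s' => ∃ A, (∀ i < n, A 0 i = phiN b E i) ∧
      (∀ a < 2 ^ (2 * b), A 3 a = cntN b E t a) ∧
      s' = ⟨s.R, A, tossR (n := n) b t, s.drawn, queriesR b E t⟩) (2 * b) (by norm_num)
      (by norm_num) (by norm_num) ?_ ?_ ?_ (T := 2 ^ (2 * b) * (b * 28 + 36) + 9 +
      (2 ^ b * (n * 101 + 80) + 9) + (2 ^ (2 * b) * 100 + 9))).imp ?_))) ?_
  · rintro t _ ⟨A, _, _, rfl⟩; exact ⟨h14, h7⟩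
  · rintro t ht _ ⟨A, h1, h2, rfl⟩
    refine Reach.decodeRound (b := b) (t := t) ?_ ?_ ?_ ?_ ?_ ?_ ?_ ?_ ?_ ?_ hn hm hB h1 h2 rfl ?_
    any_goals simpa [HState.setR]
    intro A' h3 h4
    refine ⟨by simp [HState.setR], A', h3, h4, ?_⟩
    have : Function.update s.R 14 0 = s.R := by rw [← h14, Function.update_eq_self]
    simp [HState.setR, this, queriesR, List.range_succ]
  · refine ⟨Function.update s.A 0 (fill (fun i => bitsVal E.coins (s.tossed + i * (2 * b)) (2 * b))
      n (s.A 0)), ?_, ?_, ?_⟩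
    rotate_left 2
    · refine HState.ext rfl rfl ?_ rfl ?_
      · simp [hs, tossR]
      · simp [hq, queriesR]
    · intro i hi; simp [fill_of_lt hi, hs, phiN]
    · intro a ha; simp [hA3 a ha, cntN]
  · rintro _ ⟨A, h1, h2, rfl⟩; exact hQ A h1 h2
  · simp

theorem selN_le (a : ℕ) : selN b E a ≤ 1 := by unfold selN; omega

theorem Reach.select (h1 : s.R 1 = k) (h7 : s.R 7 = 2 * b)
    (h8 : s.R 8 = 2 ^ (2 * b)) (h12 : s.R 12 = 0) (h15 : s.R 15 = 0)
    (h20 : s.R 20 = L) (hm : 2 ^ (2 * b) ≤ L)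
    (hA3 : ∀ a < 2 ^ (2 * b), s.A 3 a = cntN b E (2 * b) a)
    (hQ : Q ⟨Function.update (Function.update s.R 12 (numSel b E (2 ^ (2 * b)))) 11 (flagInit k b E),
      Function.update s.A 4 (fill (selN b E) (2 ^ (2 * b)) (s.A 4)),
      s.tossed, s.drawn, s.queries⟩) :
    Reach E L select s (2 ^ (2 * b) * 150 + 50) Q := by
  refine Reach.mono (Reach.seq (Reach.fillLoop (selN b E) (2 ^ (2 * b)) (by norm_num) (by norm_num)
    (by norm_num) (by norm_num) h20 h15 h8 hm ?_ (Reach.seq (Reach.accLoop (numSel b E) (2 ^ (2 * b))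
    (by norm_num) (by norm_num) (by norm_num) (by norm_num) (by norm_num) (by norm_num) h15 h8 ?_ ?_
    (Reach.setReg (by norm_num) ?_ ?_))))) ?_
  · intro a ha
    constructor
    · simp [HExpr.WF, HExpr.val, h20]; omega
    · simp [HExpr.val, hA3 a ha, selN, h7]
  · simp [h12, numSel]
  · intro a ha
    constructor
    · simp [HExpr.WF, HExpr.val, h20]; omega
    · simp [HExpr.val, fill_of_lt ha, numSel, Finset.sum_range_succ]
  · simp [HExpr.WF, HExpr.xor]
  · convert hQ using 1
    refine HState.ext ?_ rfl rfl rfl rfl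
    funext i
    simp only [HState.setR, HExpr.val, HExpr.xor, flagInit, natXor, Function.update_apply]
    split_ifs <;> simp_all
  · simp [HExpr.size, HExpr.xor]; omega

theorem Reach.trialStrings {t : ℕ} (h0 : s.R 0 = n) (h8 : s.R 8 = 2 ^ (2 * b)) (h13 : s.R 13 = 0)
    (h15 : s.R 15 = 0) (h16 : s.R 16 = 0) (h17 : s.R 17 = 0) (h18 : s.R 18 = 0)
    (h19 : s.R 19 = 1)
    (h20 : s.R 20 = L) (hn : n ≤ L) (hm : 2 ^ (2 * b) ≤ L)
    (hA0 : ∀ i < n, s.A 0 i = phiN b E i) (hA4 : ∀ a < 2 ^ (2 * b), s.A 4 a = selN b E a)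
    (hs : s.tossed = tossT (n := n) b t) (hd : s.drawn = t)
    (hQ : ∀ A, (∀ i < n, A 0 i = phiN b E i) → (∀ a < 2 ^ (2 * b), A 4 a = selN b E a) →
      toCube n (A 6) = toCube n (uN b E t) → toCube n (A 7) = toCube n (vN b E t) →
      toCube n (A 10) = toCube n (uvN b E t) → toCube n (A 9) = toCube n (xN E t) →
      toCube n (A 11) = toCube n (uxN b E t) → toCube n (A 12) = toCube n (uyN b E t) →
      Q ⟨Function.update s.R 13 (ySum b E t (2 ^ (2 * b))), A, tossT (n := n) b (t + 1), t + 1,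
      s.queries⟩) :
    Reach E L trialStrings s (n * 1000 + 2 ^ (2 * b) * 300 + 200) Q := by
  refine Reach.mono (Reach.seq (Reach.randArr h15 h16 h17 h18 h20 h0 h19
    (by norm_num) (by norm_num) hn (Reach.seq (Reach.randArr h15 h16 h17 h18 h20 h0 h19
    (by norm_num) (by norm_num) hn (Reach.seq (Reach.randArr h15 h16 h17 h18 h20 h8 h19
    (by norm_num) (by norm_num) hm (Reach.seq (Reach.drawArr h20 hn
    (Reach.seq (Reach.fillLoop (uvN b E t) n (by norm_num) (by norm_num)
      (by norm_num) (by norm_num) h20 h15 h0 hn ?_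
    (Reach.seq (Reach.fillLoop (uxN b E t) n (by norm_num) (by norm_num)
      (by norm_num) (by norm_num) h20 h15 h0 hn ?_
    (Reach.seq (Reach.fillLoop (uyN b E t) n (by norm_num) (by norm_num)
      (by norm_num) (by norm_num) h20 h15 h0 hn ?_
    (Reach.accLoop (ySum b E t) (2 ^ (2 * b)) (by norm_num) (by norm_num) (by norm_num) (by norm_num)
      (by norm_num) (by norm_num) h15 h8 h13 ?_ ?_))))))))))))))) ?_
  · intro i hi
    constructor
    · simp [HExpr.WF, HExpr.val, h20]; omega
    · simp [HExpr.val, fill_of_lt hi, uvN, uN, vN, hs]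
  · intro i hi
    constructor
    · simp [HExpr.WF, HExpr.val, h20]; omega
    · simp [HExpr.val, fill_of_lt hi, uxN, uN, xN, hs, hd]
  · intro i hi
    have hp := phiN_lt (b := b) (E := E) i
    constructor
    · simp [HExpr.WF, HExpr.val, h20, hA0 i hi]; omega
    · simp [HExpr.val, fill_of_lt hi, hA0 i hi, fill_of_lt hp, uyN, uN, yN, hs]
  · intro a ha
    constructor
    · simp [HExpr.WF, HExpr.val, HExpr.xor, h20]; omega
    · simp [HExpr.val, HExpr.xor, fill_of_lt ha, hA4 a ha, ySum, natXor, yN, hs]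
  · have h2 : s.tossed + n * 1 + n * 1 + 2 ^ (2 * b) * 1 = tossT (n := n) b (t + 1) := by
      rw [hs, tossT, tossT]; ring
    simp only [HState.setR, h2, hd]
    refine hQ _ ?_ ?_ ?_ ?_ ?_ ?_ ?_ ?_
    · simpa using hA0
    · simpa using hA4
    · funext i; simp [toCube, fill, hs, uN]
    · funext i; simp [toCube, fill, hs, vN]
    · simp [toCube_fill]
    · simp [toCube_fill]; rfl
    · simp [toCube_fill]
    · simp [toCube_fill]
  · simp [HExpr.size, HExpr.xor]; omega

theorem Reach.trialQueries (h20 : s.R 20 = L) (hn : n ≤ L)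
    (hQ : ∀ R, R 21 = ans E (s.A 6) → R 22 = ans E (s.A 7) → R 23 = ans E (s.A 10) →
      R 24 = ans E (s.A 9) → R 25 = ans E (s.A 11) → R 26 = ans E (s.A 12) →
      (∀ i, ¬ (20 < i ∧ i < 27) → R i = s.R i) → Q ⟨R, s.A, s.tossed, s.drawn,
        s.queries ++ [toCube n (s.A 6), toCube n (s.A 7), toCube n (s.A 10),
        toCube n (s.A 9), toCube n (s.A 11), toCube n (s.A 12)]⟩) :
    Reach E L trialQueries s (n * 6 + 293) Q := by
  refine Reach.mono (Reach.seq (Reach.queryArr ?_ (by norm_num) hn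
    (Reach.seq (Reach.queryArr ?_ (by norm_num) hn (Reach.seq (Reach.queryArr ?_ (by norm_num) hn
    (Reach.seq (Reach.queryArr ?_ (by norm_num) hn (Reach.seq (Reach.queryArr ?_ (by norm_num) hn
    (Reach.queryArr ?_ (by norm_num) hn ?_))))))))))) ?_
  any_goals simpa using h20
  · simp only [List.append_assoc, List.cons_append, List.nil_append]
    refine hQ _ ?_ ?_ ?_ ?_ ?_ ?_ ?_
    any_goals (simp [ans]; done)
    intro i hi
    repeat rw [Function.update_of_ne (by omega)]
  · omega

theorem Reach.trialVerdict
    (hQ : ∀ R, R 11 = s.R 11 - natXor (s.R 21) (natXor (s.R 22) (s.R 23)) -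
        natXor (s.R 21) (natXor (s.R 24) (s.R 25)) - natXor (s.R 21) (natXor (s.R 26) (s.R 13)) →
      (∀ i, i = 13 ∨ (20 < i ∧ i < 27) → R i = 0) →
      (∀ i, i ≠ 11 → i ≠ 13 → ¬ (20 < i ∧ i < 27) → R i = s.R i) → Q ⟨R, s.A, s.tossed, s.drawn,
        s.queries⟩) :
    Reach E L trialVerdict s 200 Q := by
  refine Reach.mono (Reach.seq (Reach.setReg (by norm_num) ?_ (Reach.seq (Reach.setReg (by norm_num) ?_
    (Reach.seq (Reach.setReg (by norm_num) ?_ (Reach.seq (Reach.setReg (by norm_num) ?_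
    (Reach.seq (Reach.setReg (by norm_num) ?_ (Reach.seq (Reach.setReg (by norm_num) ?_
    (Reach.seq (Reach.setReg (by norm_num) ?_ (Reach.seq (Reach.setReg (by norm_num) ?_
    (Reach.seq (Reach.setReg (by norm_num) ?_
    (Reach.setReg (by norm_num) ?_ ?_))))))))))))))))))) ?_
  any_goals (simp [HExpr.WF, HExpr.xor]; done)
  · refine hQ _ ?_ ?_ ?_
    · simp [HState.setR, HExpr.val, HExpr.xor, natXor]
    · rintro i (rfl | hi)
      · simp [HState.setR, HExpr.val]
      · obtain ⟨h1, h2⟩ := hi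
        interval_cases i <;> simp [HState.setR, HExpr.val]
    · intro i h1 h2 h3
      simp only [HState.setR]
      repeat rw [Function.update_of_ne (by omega)]
  · simp [HExpr.size, HExpr.xor]

theorem Reach.trial {t : ℕ} (h0 : s.R 0 = n) (h8 : s.R 8 = 2 ^ (2 * b)) (h13 : s.R 13 = 0)
    (h15 : s.R 15 = 0) (h16 : s.R 16 = 0) (h17 : s.R 17 = 0) (h18 : s.R 18 = 0)
    (h19 : s.R 19 = 1)
    (h20 : s.R 20 = L) (h21 : ∀ i, 20 < i → i < 27 → s.R i = 0) (hn : n ≤ L) (hm : 2 ^ (2 * b) ≤ L)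
    (h11 : s.R 11 = flagN k b E t)
    (hA0 : ∀ i < n, s.A 0 i = phiN b E i) (hA4 : ∀ a < 2 ^ (2 * b), s.A 4 a = selN b E a)
    (hs : s.tossed = tossT (n := n) b t) (hd : s.drawn = t)
    (hQ : ∀ A, (∀ i < n, A 0 i = phiN b E i) → (∀ a < 2 ^ (2 * b), A 4 a = selN b E a) →
      Q ⟨Function.update s.R 11 (flagN k b E (t + 1)), A, tossT (n := n) b (t + 1), t + 1,
      s.queries ++ [toCube n (uN b E t), toCube n (vN b E t), toCube n (uvN b E t),
        toCube n (xN E t), toCube n (uxN b E t), toCube n (uyN b E t)]⟩) :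
    Reach E L trial s (n * 1006 + 2 ^ (2 * b) * 300 + 700) Q := by
  refine Reach.mono (Reach.seq (Reach.trialStrings h0 h8 h13 h15 h16 h17 h18 h19 h20 hn hm hA0 hA4 hs
    hd ?_) (T' := n * 6 + 500)) (by omega)
  intro A hA0' hA4' h6 h7 h10 h9 h11' h12
  refine Reach.mono (Reach.seq (Reach.trialQueries (by simpa using h20) hn ?_)) (T := n * 6 + 293 + 200)
    (by omega)
  intro R r21 r22 r23 r24 r25 r26 hR
  refine Reach.trialVerdict ?_
  intro R' r11 hz hR'
  dsimp only at r21 r22 r23 r24 r25 r26 hR r11 hR'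
  convert hQ A hA0' hA4' using 1
  simp only [h6, h7, h9, h10, h11', h12, HState.mk.injEq, and_true]
  funext i
  by_cases hi : i = 13 ∨ (20 < i ∧ i < 27)
  · rw [hz i hi, Function.update_of_ne (by omega)]
    rcases hi with rfl | hi
    · exact h13.symm
    · exact (h21 i hi.1 hi.2).symm
  · by_cases hi1 : i = 11
    · subst hi1
      rw [r11, Function.update_self, r21, r22, r23, r24, r25, r26, hR 11 (by norm_num),
        hR 13 (by norm_num), flagN]
      simp [h11, ans, h6, h7, h9, h10, h11', h12]
    · rw [hR' i hi1 (by tauto) (by tauto), hR i (by tauto), Function.update_of_ne (by tauto),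
        Function.update_of_ne (by tauto)]

end

/-- The number of bits of the labels of small buckets. -/
def numBits (k : ℕ) : ℕ := 6 + Nat.clog 2 (k + 1)

/-- The number of trials on input `q`: the ceiling of `16 / q`. -/
def numTrials (q : ℚ) : ℕ := (16 * q.den + q.num.toNat - 1) / q.num.toNat

/-- Serves twice: as the guard of the loop that subtracts `p` from `d` until nothing is left, and
for the bounds on `numTrials`. -/
theorem lt_ceilDiv_iff {p d j : ℕ} (hp : 0 < p) : j < (d + p - 1) / p ↔ j * p < d := by
  rw [Nat.lt_iff_add_one_le, Nat.le_div_iff_mul_le hp, Nat.succ_mul]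
  omega

/-! ### The parameters and the run of the whole program. -/

section

variable {n k b : ℕ} {E : Env n} {L : ℕ} {s : HState n} {Q : HState n → Prop}

theorem Reach.bitsParam (h1 : s.R 1 = k)
    (hQ : Q (((s.setR 4 (2 ^ Nat.clog 2 (k + 1))).setR 5 (2 ^ numBits k)).setR 6 (numBits k))) :
    Reach E L bitsParam s (Nat.clog 2 (k + 1) * 30 + 20) Q := by
  have hset : ∀ a b c a' b' c', ((((((s.setR 4 a).setR 5 b).setR 6 c).setR 4 a').setR 5 b').setR 6 c')
      = ((s.setR 4 a').setR 5 b').setR 6 c' := by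
    intro a b c a' b' c'
    refine HState.ext ?_ rfl rfl rfl rfl
    funext i
    simp only [HState.setR, Function.update_apply]
    split_ifs <;> rfl
  refine Reach.mono (Reach.seq (Reach.setReg (by norm_num) ?_ (Reach.seq (Reach.setReg (by norm_num)
    ?_ (Reach.seq (Reach.setReg (by norm_num) ?_ ((Reach.loop
    (fun j s' => s' = ((s.setR 4 (2 ^ j)).setR 5 (2 ^ (6 + j))).setR 6 (6 + j))
    (Nat.clog 2 (k + 1)) ?_ ?_ ?_ ?_ (T := 21)).imp ?_))))))) ?_
  any_goals (simp [HExpr.WF]; done)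
  · rintro s' rfl
    have := Nat.le_pow_clog (b := 2) (by norm_num) (k + 1)
    simp [HExpr.val, HState.setR, h1]; omega
  · rintro j hj s' rfl
    have := (Nat.lt_clog_iff_pow_lt (b := 2) (by norm_num)).1 hj
    constructor
    · simp [HExpr.val, HState.setR, h1]; omega
    · refine Reach.mono (Reach.seq (Reach.setReg (by norm_num) ?_ (Reach.seq
        (Reach.setReg (by norm_num) ?_ (Reach.setReg (by norm_num) ?_ ?_))))) ?_
      any_goals simp [HExpr.WF]
      · rw [hset]
        simp only [HExpr.val, HState.setR]
        congr 1
        simp [pow_succ, pow_add]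
        congr 1
        ring_nf
      · simp [HExpr.size]
  · rfl
  · rintro s' rfl; exact hQ
  · simp [HExpr.size]; omega

theorem Reach.trialsParam {q : ℚ} (hq : 0 < q) (h2 : s.R 2 = q.num.toNat) (h3 : s.R 3 = q.den)
    (h9 : s.R 9 = 0)
    (hQ : ∀ v, Q ((s.setR 10 v).setR 9 (numTrials q))) :
    Reach E L trialsParam s (numTrials q * 30 + 50) Q := by
  have hp : 0 < q.num.toNat := by
    have := Rat.num_pos.2 hq
    omega
  have hset : ∀ a b a' b', ((((s.setR 10 a).setR 9 b).setR 10 a').setR 9 b')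
      = (s.setR 10 a').setR 9 b' := by
    intro a b a' b'
    refine HState.ext ?_ rfl rfl rfl rfl
    funext i
    simp only [HState.setR, Function.update_apply]
    split_ifs <;> rfl
  refine Reach.mono (Reach.seq (Reach.setReg (by norm_num) ?_ (Reach.seq (Reach.setReg (by norm_num)
    ?_ (Reach.seq (Reach.setReg (by norm_num) ?_ (Reach.seq (Reach.setReg (by norm_num) ?_ ((Reach.loop
    (fun j s' => s' = (s.setR 10 (16 * q.den - j * q.num.toNat)).setR 9 j)
    (numTrials q) ?_ ?_ ?_ ?_ (T := 16)).imp ?_))))))))) ?_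
  any_goals (simp [HExpr.WF]; done)
  · rintro s' rfl
    have := (lt_ceilDiv_iff (d := 16 * q.den) (j := numTrials q) hp).not.1 (lt_irrefl _)
    simp [HExpr.val, HState.setR]; omega
  · rintro j hj s' rfl
    have := (lt_ceilDiv_iff hp).1 hj
    constructor
    · simp [HExpr.val, HState.setR]; omega
    · refine Reach.mono (Reach.seq (Reach.setReg (by norm_num) ?_
        (Reach.setReg (by norm_num) ?_ ?_))) ?_
      any_goals simp [HExpr.WF]
      · rw [hset]
        simp [HExpr.val, HState.setR, h2, Nat.succ_mul, Nat.sub_sub]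
      · simp [HExpr.size]
  · refine HState.ext ?_ rfl rfl rfl rfl
    funext i
    simp only [HState.setR, HExpr.val, Function.update_apply]
    split_ifs <;> simp_all
    omega
  · rintro s' rfl; exact hQ _
  · simp [HExpr.size]; omega

/-- The contents of the registers after the computation of the parameters. -/
structure ParamRegs (n k N : ℕ) (R : ℕ → ℕ) : Prop where
  r0 : R 0 = n
  r1 : R 1 = k
  r5 : R 5 = 2 ^ numBits k
  r6 : R 6 = numBits k
  r7 : R 7 = 2 * numBits k
  r8 : R 8 = 2 ^ (2 * numBits k)
  r9 : R 9 = N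
  r19 : R 19 = 1
  r20 : R 20 = n + (2 ^ (2 * numBits k) + 2 ^ numBits k)
  rz : ∀ i, 10 < i → i < 19 → R i = 0
  rz' : ∀ i, 20 < i → i < 27 → R i = 0

theorem Reach.parameters {q : ℚ} (hq : 0 < q) (h0 : s.R 0 = n) (h1 : s.R 1 = k)
    (h2 : s.R 2 = q.num.toNat) (h3 : s.R 3 = q.den) (hz : ∀ i, 3 < i → s.R i = 0)
    (hQ : ∀ R, ParamRegs n k (numTrials q) R → Q ⟨R, s.A, s.tossed, s.drawn, s.queries⟩) :
    Reach E L parameters s (numBits k * 100 + numTrials q * 30 + 200) Q := by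
  refine Reach.mono (Reach.seq (Reach.bitsParam h1 (Reach.seq (Reach.setReg (by norm_num) ?_
    (Reach.seq (Reach.setReg (by norm_num) ?_ (Reach.seq (Reach.accLoop (fun j => 2 ^ j)
    (2 * numBits k) (by norm_num) (by norm_num) (by norm_num) (by norm_num) (by norm_num) (by norm_num)
    ?_ ?_ ?_ ?_ (Reach.seq (Reach.trialsParam hq ?_ ?_ ?_ fun v => Reach.seq
    (Reach.setReg (by norm_num) ?_ (Reach.setReg (by norm_num) ?_ (hQ _ ?_))))))))))))) ?_
  any_goals (simp [HExpr.WF]; done)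
  · simp [HState.setR, hz]
  · simp [HState.setR, HExpr.val]; ring
  · simp [HState.setR, HExpr.val]
  · intro j _; simp [HExpr.WF, HExpr.val, pow_succ]; ring
  · simpa [HState.setR] using h2
  · simpa [HState.setR] using h3
  · simpa [HState.setR] using hz 9 (by norm_num)
  · constructor
    any_goals (simp [HState.setR, HExpr.val, *]; done)
    · simp [HState.setR, HExpr.val]; ring
    · intro i h1 h2
      have := hz i (by omega)
      simp only [HState.setR]
      repeat rw [Function.update_of_ne (by omega)]
      exact this
    · intro i h1 h2
      have := hz i (by omega)
      simp only [HState.setR]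
      repeat rw [Function.update_of_ne (by omega)]
      exact this
  · simp [HExpr.size, numBits]; omega

/-- A bound for the number of steps of the tester. -/
def stepBound (n k N : ℕ) : ℕ :=
  6 + (numBits k * 100 + N * 30 + 200 + (n * (2 * numBits k * 28 + 31) + 9 +
    (2 * numBits k * (2 ^ (2 * numBits k) * (numBits k * 28 + 36) + 9 +
      (2 ^ numBits k * (n * 101 + 80) + 9) + (2 ^ (2 * numBits k) * 100 + 9) + 12) + 9) +
    (2 ^ (2 * numBits k) * 150 + 50 +
      (N * (n * 1006 + 2 ^ (2 * numBits k) * 300 + 700 + 12) + 9 + 4))))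

theorem tester_spec (E : Env n) {q : ℚ} (hq : 0 < q) (hq1 : q ≤ 1) :
    ∃ t σ, Exec E tester (start n k q) t σ ∧ t ≤ stepBound n k (numTrials q) ∧
      σ.mem 0 = flagN k (numBits k) E (numTrials q) ∧ σ.drawn = numTrials q ∧
      σ.queries = queriesR (numBits k) E (2 * numBits k) ++
        queriesT (numBits k) E (numTrials q) := by
  set b := numBits k with hb
  set N := numTrials q with hN
  -- The final array length is used for the layout from the start. This is consistent because the
  -- parameter phase touches registers only, whose place does not depend on `L`, and because all
  -- cells outside the input are zero.
  set L := n + (2 ^ (2 * b) + 2 ^ b) with hL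
  have hnL : n ≤ L := Nat.le_add_right _ _
  have hmL : 2 ^ (2 * b) ≤ L := (Nat.le_add_right _ _).trans (Nat.le_add_left _ _)
  have hBL : 2 ^ b ≤ L := (Nat.le_add_left _ _).trans (Nat.le_add_left _ _)
  set s : HState n := ⟨(start n k q).mem, fun _ _ => 0, 0, 0, []⟩ with hs
  have hstart : start n k q = s.toState L := by
    simp only [HState.toState, hs, start, State.mk.injEq, and_true]
    funext j
    by_cases h : j < 64
    · rw [layout_reg h]
    · rw [layout, if_neg h]
      repeat rw [if_neg (by omega)]
  have hle : q.num.toNat - q.den = 0 := by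
    have h1 : q.num ≤ q.den := by
      have := Rat.num_le_denom_iff.2 hq1
      exact this
    omega
  have main : Reach E L tester s (stepBound n k N) fun s' => s'.R 0 = flagN k b E N ∧
      s'.drawn = N ∧ s'.queries = queriesR b E (2 * b) ++ queriesT b E N := by
    refine Reach.mono (Reach.branch (T := stepBound n k N - 6) ?_ ?_ ?_) ?_
    · simp [HExpr.WF]
    · intro h
      simp [HExpr.val, hs, start] at h
      omega
    · intro _
      refine Reach.mono (Reach.seq (T' := n * (2 * b * 28 + 31) + 9 + (2 * b * (2 ^ (2 * b) *
        (b * 28 + 36) + 9 + (2 ^ b * (n * 101 + 80) + 9) + (2 ^ (2 * b) * 100 + 9) + 12) + 9) +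
        (2 ^ (2 * b) * 150 + 50 + (N * (n * 1006 + 2 ^ (2 * b) * 300 + 700 + 12) + 9 + 4)))
        (Reach.parameters (n := n) (k := k) hq rfl rfl rfl rfl ?_ ?_)) ?_
      · intro i hi
        simp only [hs, start]
        repeat rw [if_neg (by omega)]
      · rintro R ⟨r0, r1, r5, r6, r7, r8, r9, r19, r20, rz, rz'⟩
        rw [← hb] at r5 r6 r7 r8 r20
        rw [← hN] at r9
        rw [← hL] at r20
        refine Reach.seq (Reach.decode r0 r5 r6 r7 r8 (rz 13 (by norm_num) (by norm_num))
          (rz 14 (by norm_num) (by norm_num)) (rz 15 (by norm_num) (by norm_num))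
          (rz 16 (by norm_num) (by norm_num)) (rz 17 (by norm_num) (by norm_num))
          (rz 18 (by norm_num) (by norm_num)) r20 hnL hmL hBL
          (fun _ _ => rfl) rfl rfl ?_)
        intro A hA0 hA3
        refine Reach.seq (Reach.select r1 r7 r8 (rz 12 (by norm_num) (by norm_num))
          (rz 15 (by norm_num) (by norm_num)) r20 hmL hA3 ?_)
        have hI : ∀ A, (∀ i < n, A 0 i = phiN b E i) → (∀ a < 2 ^ (2 * b), A 4 a = selN b E a) →
          Reach E L (.seq (KLinearTesting.forLoop 14 9 KLinearTesting.trial) (setReg 0 (.reg 11)))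
          ⟨Function.update (Function.update R 12 (numSel b E (2 ^ (2 * b)))) 11
            (flagN k b E 0), A, tossT (n := n) b 0, 0, queriesR b E (2 * b) ++ queriesT b E 0⟩
          (N * (n * 1006 + 2 ^ (2 * b) * 300 + 700 + 12) + 9 + 4) fun s' => s'.R 0 = flagN k b E N ∧
            s'.drawn = N ∧ s'.queries = queriesR b E (2 * b) ++ queriesT b E N := by
          intro A hA0 hA4
          refine Reach.seq ((Reach.forLoop (fun t s' => ∃ A, (∀ i < n, A 0 i = phiN b E i) ∧
            (∀ a < 2 ^ (2 * b), A 4 a = selN b E a) ∧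
            s' = ⟨Function.update (Function.update R 12 (numSel b E (2 ^ (2 * b)))) 11
              (flagN k b E t), A, tossT (n := n) b t, t,
              queriesR b E (2 * b) ++ queriesT b E t⟩) N (by norm_num) (by norm_num) (by norm_num)
              ?_ ?_ ?_ (T := n * 1006 + 2 ^ (2 * b) * 300 + 700)).imp ?_)
          · rintro t _ ⟨A, _, _, rfl⟩
            simp [rz, r9]
          · rintro t _ _ ⟨A, hA0, hA4, rfl⟩
            refine Reach.trial (k := k) (b := b) (t := t) ?_ ?_ ?_ ?_ ?_ ?_ ?_ ?_ ?_ ?_ hnL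
              hmL ?_ hA0 hA4 rfl rfl ?_
            any_goals (simp [HState.setR, *]; done)
            · intro i h1 h2
              simp only [HState.setR]
              repeat rw [Function.update_of_ne (by omega)]
              exact rz' i h1 h2
            · intro A' h3 h4
              refine ⟨by simp [HState.setR], A', h3, h4, ?_⟩
              refine HState.ext ?_ rfl rfl rfl ?_
              · funext i
                by_cases h14 : i = 14
                · simp [HState.setR, h14, rz 14]
                · simp only [HState.setR, Function.update_apply, h14, if_false]
                  split_ifs <;> rfl
              · simp [HState.setR, queriesT, List.range_succ]
          · exact ⟨A, hA0, hA4, rfl⟩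
          · rintro _ ⟨A, hA0, hA4, rfl⟩
            refine Reach.setReg (by norm_num) ?_ ?_
            · simp [HExpr.WF]
            · simp [HState.setR, HExpr.val]
        have := hI (Function.update A 4 (fill (selN b E) (2 ^ (2 * b)) (A 4))) (by simpa using hA0)
          (fun a ha => by simp [fill_of_lt ha])
        simpa [flagN, queriesT, tossT] using this
      · simp only [stepBound, ← hb]
        omega
    · simp only [stepBound, HExpr.size]; omega
  obtain ⟨t, s', h1, h2, h3, h4, h5⟩ := main
  rw [← hstart] at h1
  refine ⟨t, _, h1, h2, ?_, h4, h5⟩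
  rw [← h3]
  exact layout_reg (i := 0) (L := L) (R := s'.R) (A := s'.A) (by norm_num)

theorem tester_spec_of_one_lt (E : Env n) {q : ℚ} (hq1 : 1 < q) :
    ∃ t σ, Exec E tester (start n k q) t σ ∧ t ≤ 9 ∧
      σ.mem 0 = 1 ∧ σ.drawn = 0 ∧ σ.queries = [] := by
  have hlt : q.num.toNat - q.den ≠ 0 := by
    have h1 : (q.den : ℤ) < q.num := by
      by_contra h
      exact absurd (Rat.num_le_denom_iff.1 (not_lt.1 h)) (not_le.2 hq1)
    omega
  refine ⟨_, _, .branch_true ?_ (.assign _ _ _), ?_, ?_, rfl, rfl⟩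
  · simpa [HExpr.toR, RExpr.eval, start] using hlt
  · simp [HExpr.toR, RExpr.cost]
  · simp [HExpr.toR, RExpr.eval]

end

/-! ### Uniform probabilities on finite types -/

open Classical in
/-- The probability of `p` under the uniform distribution. -/
def pr {α : Type*} [Fintype α] (p : α → Prop) : ℝ :=
  (Finset.univ.filter p).card / Fintype.card α

section pr

variable {α β ι : Type*} [Fintype α] [Fintype β]

theorem pr_eq_card (p : α → Prop) [DecidablePred p] :
    pr p = ((Finset.univ.filter p).card : ℝ) / Fintype.card α := by
  rw [pr]; congr

theorem pr_eq_sum (p : α → Prop) [DecidablePred p] :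
    pr p = (∑ x, if p x then (1 : ℝ) else 0) / Fintype.card α := by
  rw [pr_eq_card, Finset.sum_boole]

theorem pr_nonneg (p : α → Prop) : 0 ≤ pr p := by unfold pr; positivity

theorem pr_mono {p q : α → Prop} (h : ∀ x, p x → q x) : pr p ≤ pr q := by
  classical
  rw [pr_eq_card, pr_eq_card]
  gcongr
  exact h _

theorem pr_or_le (p q : α → Prop) : pr (fun x => p x ∨ q x) ≤ pr p + pr q := by
  classical
  rw [pr_eq_card, pr_eq_card, pr_eq_card, ← add_div, Finset.filter_or]
  gcongr
  exact_mod_cast Finset.card_union_le _ _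

theorem pr_exists_le (s : Finset ι) (p : ι → α → Prop) :
    pr (fun x => ∃ i ∈ s, p i x) ≤ ∑ i ∈ s, pr (p i) := by
  classical
  induction s using Finset.induction_on with
  | empty => simp [pr]
  | insert i s hi ih =>
    rw [Finset.sum_insert hi]
    refine le_trans (pr_mono ?_) ((pr_or_le (p i) fun x => ∃ i ∈ s, p i x).trans (by gcongr))
    simp

theorem pr_not [Nonempty α] (p : α → Prop) : pr (fun x => ¬ p x) = 1 - pr p := by
  classical
  have h := Finset.card_filter_add_card_filter_not (s := (Finset.univ : Finset α)) p
  have hc : (Fintype.card α : ℝ) ≠ 0 := by exact_mod_cast Fintype.card_ne_zero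
  rw [pr_eq_card, pr_eq_card, eq_sub_iff_add_eq, ← add_div, div_eq_one_iff_eq hc]
  rw [Finset.card_univ] at h
  exact_mod_cast (add_comm _ _).trans h

theorem pr_comp_equiv (e : α ≃ β) (p : β → Prop) : pr (fun x => p (e x)) = pr p := by
  classical
  rw [pr_eq_sum, pr_eq_sum, Fintype.card_congr e]
  congr 1
  exact Equiv.sum_comp e fun y => if p y then (1 : ℝ) else 0

theorem pr_prod (p : α × β → Prop) :
    pr p = (∑ a, pr fun b => p (a, b)) / Fintype.card α := by
  classical
  simp_rw [pr_eq_sum, Fintype.sum_prod_type, Fintype.card_prod, ← Finset.sum_div]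
  push_cast
  rw [div_div, mul_comm]

theorem pr_prod_le [Nonempty α] {p : α × β → Prop} {c : ℝ} (h : ∀ a, (pr fun b => p (a, b)) ≤ c) :
    pr p ≤ c := by
  rw [pr_prod, div_le_iff₀ (by exact_mod_cast Fintype.card_pos)]
  refine (Finset.sum_le_sum fun a _ => h a).trans (le_of_eq ?_)
  simp [mul_comm]

theorem le_pr_prod [Nonempty α] {p : α × β → Prop} {c : ℝ} (h : ∀ a, c ≤ pr fun b => p (a, b)) :
    c ≤ pr p := by
  rw [pr_prod, le_div_iff₀ (by exact_mod_cast Fintype.card_pos)]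
  refine le_trans (le_of_eq ?_) (Finset.sum_le_sum fun a _ => h a)
  simp [mul_comm]

theorem pr_snd [Nonempty α] (p : β → Prop) : (pr fun x : α × β => p x.2) = pr p :=
  le_antisymm (pr_prod_le fun _ => le_rfl) (le_pr_prod fun _ => le_rfl)

theorem pr_fst [Nonempty β] (p : α → Prop) : (pr fun x : α × β => p x.1) = pr p := by
  rw [← pr_snd (α := β) p, ← pr_comp_equiv (Equiv.prodComm α β)]
  rfl

/-- Resampling one coordinate of a uniformly random function. -/
theorem pr_le_of_update [DecidableEq ι] [Fintype ι] [Nonempty α] (i : ι) {p : (ι → α) → Prop} {c : ℝ}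
    (h : ∀ x, (pr fun b => p (Function.update x i b)) ≤ c) : pr p ≤ c := by
  -- Exchanging `x i` with a fresh `b` is a bijection of the pairs, so the resampled function is
  -- again uniform.
  have e : Function.Involutive fun x : (ι → α) × α => (Function.update x.1 i x.2, x.1 i) := by
    rintro ⟨x, b⟩; simp
  rw [← pr_fst (β := α) p, ← pr_comp_equiv e.toPerm]
  exact pr_prod_le h

theorem pr_eq_const [DecidableEq α] (a : α) : (pr fun x => x = a) = 1 / Fintype.card α := by
  rw [pr_eq_card]; simp [Finset.filter_eq']

theorem pr_mem_finset [DecidableEq α] (s : Finset α) :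
    (pr fun x => x ∈ s) = s.card / Fintype.card α := by
  rw [pr_eq_card]; simp

/-- A Chernoff bound: at least half of `r` independent events of probability at most `1 / 64`
occur with probability at most `3⁻¹ ^ r`. -/
theorem pr_majority_le [Nonempty α] (p : α → Prop) (hp : pr p ≤ 1 / 64) (r : ℕ)
    (X : (Fin r → α) → ℕ)
    (hX : ∀ ω, ∃ s : Finset (Fin r), s.card = X ω ∧ ∀ t ∈ s, p (ω t)) :
    (pr fun ω => r ≤ 2 * X ω) ≤ (1 / 3) ^ r := by
  classical
  have hc : (0 : ℝ) < Fintype.card α := by exact_mod_cast Fintype.card_pos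
  -- Markov's inequality for the product of weights `16` per occurring event. The mean of one factor
  -- is at most `1 + 15 / 64 ≤ 4 / 3`, while `r ≤ 2 * X` makes the product at least `16 ^ X ≥ 4 ^
  -- r`; the quotient is `(1 / 3) ^ r`.
  have h1 : ∑ x, (if p x then (16 : ℝ) else 1) = Fintype.card α * (1 + 15 * pr p) := by
    have : ∀ x, (if p x then (16 : ℝ) else 1) = 1 + 15 * if p x then 1 else 0 := by
      intro x; split_ifs <;> norm_num
    rw [pr_eq_sum]
    simp_rw [this, Finset.sum_add_distrib, ← Finset.mul_sum]
    field_simp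
    simp
  have h2 : ∀ ω : Fin r → α, (if r ≤ 2 * X ω then (1 : ℝ) else 0) * 4 ^ r ≤
      ∏ t, if p (ω t) then (16 : ℝ) else 1 := by
    intro ω
    obtain ⟨s, hs, hps⟩ := hX ω
    split_ifs with h
    · calc (1 : ℝ) * 4 ^ r ≤ 4 ^ (2 * s.card) := by
            rw [one_mul]; exact pow_le_pow_right₀ (by norm_num) (by omega)
        _ = ∏ t ∈ s, (16 : ℝ) := by rw [Finset.prod_const, pow_mul]; norm_num
        _ = ∏ t ∈ s, if p (ω t) then (16 : ℝ) else 1 :=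
            Finset.prod_congr rfl fun t ht => (if_pos (hps t ht)).symm
        _ ≤ ∏ t, if p (ω t) then (16 : ℝ) else 1 := by
            refine Finset.prod_le_prod_of_subset_of_one_le (Finset.subset_univ s) ?_ ?_
            · intro t _; split_ifs <;> norm_num
            · intro t _ _; split_ifs <;> norm_num
    · rw [zero_mul]
      exact Finset.prod_nonneg fun t _ => by split_ifs <;> norm_num
  have h3 := Finset.sum_le_sum fun ω (_ : ω ∈ Finset.univ) => h2 ω
  have h0 := Fintype.sum_pow (fun x => if p x then (16 : ℝ) else 1) r
  rw [← h0, h1, ← Finset.sum_mul] at h3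
  rw [pr_eq_sum, div_le_iff₀ (by positivity), Fintype.card_fun, Fintype.card_fin]
  push_cast
  have h4 : ((Fintype.card α : ℝ) * (1 + 15 * pr p)) ^ r ≤ (Fintype.card α * (4 / 3)) ^ r := by
    have := pr_nonneg p
    gcongr
    linarith
  have h5 : ((Fintype.card α : ℝ) * (4 / 3)) ^ r = (1 / 3) ^ r * Fintype.card α ^ r * 4 ^ r := by
    rw [← mul_pow, ← mul_pow]; congr 1; ring
  exact le_of_mul_le_mul_right (h3.trans (h4.trans h5.le)) (by positivity)

end pr

/-! ### Linear functions -/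

/-- The sum of the coordinates in `S`. -/
def lin {α : Type*} (S : Finset α) (x : α → ZMod 2) : ZMod 2 := ∑ i ∈ S, x i

theorem lin_add {α : Type*} (S : Finset α) (x y : α → ZMod 2) :
    lin S (x + y) = lin S x + lin S y := Finset.sum_add_distrib

/-- Distinct linear functions agree on half of all points. -/
theorem pr_lin_eq_le {α : Type*} [Fintype α] [DecidableEq α] {S T : Finset α} (h : S ≠ T) :
    (pr fun x : α → ZMod 2 => lin S x = lin T x) ≤ 1 / 2 := by
  have hS : ∀ (S : Finset α) (i : α) (x : α → ZMod 2) b,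
      lin S (Function.update x i b) = lin (S.erase i) x + if i ∈ S then b else 0 := by
    intro S i x b
    by_cases hi : i ∈ S
    · rw [lin, ← Finset.sum_erase_add _ _ hi, Function.update_self, if_pos hi, lin]
      congr 1
      refine Finset.sum_congr rfl fun j hj => ?_
      rw [Function.update_of_ne (Finset.ne_of_mem_erase hj)]
    · rw [if_neg hi, add_zero, Finset.erase_eq_of_notMem hi, lin, lin]
      refine Finset.sum_congr rfl fun j hj => ?_
      rw [Function.update_of_ne]
      rintro rfl; exact hi hj
  -- With `i` in exactly one of the two sets and the other coordinates fixed, only one value of `x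
  -- i` gives equality.
  obtain ⟨i, hi⟩ : ∃ i, ¬ (i ∈ S ↔ i ∈ T) := by
    by_contra! h'
    exact h (Finset.ext h')
  refine pr_le_of_update i fun x => ?_
  have h2 : ∀ b : ZMod 2, lin S (Function.update x i b) = lin T (Function.update x i b) →
      b = lin (S.erase i) x + lin (T.erase i) x := by
    intro b hb
    rw [hS, hS] at hb
    by_cases h1 : i ∈ S
    · have h3 : i ∉ T := by tauto
      simp only [h1, h3, if_true, if_false] at hb
      generalize lin (S.erase i) x = a at *
      generalize lin (T.erase i) x = c at *
      revert hb; revert a b c; decide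
    · have h3 : i ∈ T := by tauto
      simp only [h1, h3, if_true, if_false] at hb
      generalize lin (S.erase i) x = a at *
      generalize lin (T.erase i) x = c at *
      revert hb; revert a b c; decide
  refine (pr_mono h2).trans (le_of_eq ?_)
  rw [pr_eq_const, ZMod.card]; norm_num

/-! ### The linearity test of Blum, Luby and Rubinfeld -/

/-- The character of `F_2` with values `1`, `-1`. -/
def sgn (a : ZMod 2) : ℝ := if a = 0 then 1 else -1

theorem zmod_two_cases : ∀ a : ZMod 2, a = 0 ∨ a = 1 := by decide

theorem sgn_add (a b : ZMod 2) : sgn (a + b) = sgn a * sgn b := by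
  have h : (1 : ZMod 2) + 1 = 0 := by decide
  rcases zmod_two_cases a with rfl | rfl <;> rcases zmod_two_cases b with rfl | rfl <;>
    simp [sgn, h]

theorem sgn_sum {α : Type*} (S : Finset α) (x : α → ZMod 2) :
    sgn (lin S x) = ∏ i ∈ S, sgn (x i) := by
  classical
  induction S using Finset.induction_on with
  | empty => simp [lin, sgn]
  | insert i S hi ih =>
    rw [Finset.prod_insert hi, ← ih, ← sgn_add, lin, Finset.sum_insert hi, lin]

theorem sgn_eq (a b : ZMod 2) : sgn (a + b) = 1 - 2 * if a ≠ b then 1 else 0 := by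
  have h : (1 : ZMod 2) + 1 = 0 := by decide
  rcases zmod_two_cases a with rfl | rfl <;> rcases zmod_two_cases b with rfl | rfl <;>
    simp [sgn, h] <;> norm_num

/-- Orthogonality of characters: the sum factors as the product of `1 + sgn (x i)`, and a coordinate
`1` makes a factor vanish. -/
theorem sum_sgn_lin {n : ℕ} (x : Cube n) :
    ∑ S : Finset (Fin n), sgn (lin S x) = if x = 0 then 2 ^ n else 0 := by
  have h : ∑ S : Finset (Fin n), sgn (lin S x) = ∏ i, (1 + sgn (x i)) := by
    rw [Finset.prod_one_add, Finset.powerset_univ]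
    exact Finset.sum_congr rfl fun S _ => sgn_sum S x
  rw [h]
  split_ifs with h0
  · subst h0; norm_num [sgn]
  · obtain ⟨i, hi⟩ := Function.ne_iff.1 h0
    refine Finset.prod_eq_zero (Finset.mem_univ i) ?_
    simp only [Pi.zero_apply] at hi
    simp [sgn, hi]

theorem cube_add_eq_zero_iff {n : ℕ} (x y : Cube n) : x + y = 0 ↔ y = x := by
  constructor
  · intro h
    funext i
    have := congrFun h i
    simp only [Pi.add_apply, Pi.zero_apply] at this
    revert this
    generalize x i = a; generalize y i = b
    revert a b; decide
  · rintro rfl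
    funext i
    exact CharTwo.add_self_eq_zero _

/-- The Fourier proof. `F S` is `2 ^ n` times the Fourier coefficient of `sgn ∘ f` at `S`, so the
distance hypothesis bounds it by `(1 - 2 * δ) * 2 ^ n`. The sum of the cubes expresses the
probability that the test passes; it is at most the largest `F S` times the sum of the squares,
which Parseval (`h2`) evaluates. -/
theorem blr {n : ℕ} (f : Cube n → ZMod 2) (δ : ℝ)
    (h : ∀ S : Finset (Fin n), δ ≤ pr fun x => f x ≠ lin S x) :
    δ ≤ pr fun p : Cube n × Cube n => f p.1 + f p.2 ≠ f (p.1 + p.2) := by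
  classical
  set F : Finset (Fin n) → ℝ := fun S => ∑ x, sgn (f x) * sgn (lin S x) with hF
  have hcard : (Fintype.card (Cube n) : ℝ) = 2 ^ n := by simp [ZMod.card]
  have hpos : (0 : ℝ) < 2 ^ n := by positivity
  have h1 : ∀ S, F S ≤ (1 - 2 * δ) * 2 ^ n := by
    intro S
    have h2 := h S
    rw [pr_eq_sum, hcard, le_div_iff₀ hpos] at h2
    have h3 : F S = 2 ^ n - 2 * ∑ x, if f x ≠ lin S x then (1 : ℝ) else 0 := by
      simp only [hF, ← sgn_add, sgn_eq, Finset.sum_sub_distrib, ← Finset.mul_sum]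
      simp [ZMod.card]
    rw [h3]; linarith
  have h2 : ∑ S, F S ^ 2 = 2 ^ n * 2 ^ n := by
    calc ∑ S, F S ^ 2 = ∑ S, ∑ x, ∑ y, sgn (f x) * sgn (f y) * sgn (lin S (x + y)) := by
          refine Finset.sum_congr rfl fun S _ => ?_
          rw [sq, hF]
          simp only [Finset.sum_mul_sum]
          refine Finset.sum_congr rfl fun x _ => Finset.sum_congr rfl fun y _ => ?_
          rw [lin_add, sgn_add]; ring
      _ = ∑ x, ∑ y, sgn (f x) * sgn (f y) * ∑ S : Finset (Fin n), sgn (lin S (x + y)) := by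
          rw [Finset.sum_comm]
          refine Finset.sum_congr rfl fun x _ => ?_
          rw [Finset.sum_comm]
          simp only [Finset.mul_sum]
      _ = ∑ x : Cube n, 2 ^ n := by
          refine Finset.sum_congr rfl fun x _ => ?_
          simp only [sum_sgn_lin, cube_add_eq_zero_iff, mul_ite, mul_zero, Finset.sum_ite_eq',
            Finset.mem_univ, if_true]
          have : sgn (f x) * sgn (f x) = 1 := by unfold sgn; split_ifs <;> norm_num
          rw [this, one_mul]
      _ = 2 ^ n * 2 ^ n := by simp [ZMod.card]
  have h3 : ∑ S, F S ^ 3 = 2 ^ n * ∑ x, ∑ y, sgn (f x) * sgn (f y) * sgn (f (x + y)) := by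
    calc ∑ S, F S ^ 3 = ∑ S, ∑ x, ∑ y, ∑ z, sgn (f x) * sgn (f y) * sgn (f z) *
            sgn (lin S (x + y + z)) := by
          refine Finset.sum_congr rfl fun S _ => ?_
          rw [show F S ^ 3 = F S * (F S * F S) by ring, hF]
          simp only [Finset.sum_mul_sum]
          refine Finset.sum_congr rfl fun x _ => ?_
          simp only [Finset.mul_sum]
          refine Finset.sum_congr rfl fun y _ => Finset.sum_congr rfl fun z _ => ?_
          rw [lin_add, lin_add, sgn_add, sgn_add]; ring
      _ = ∑ x, ∑ y, ∑ z, sgn (f x) * sgn (f y) * sgn (f z) *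
            ∑ S : Finset (Fin n), sgn (lin S (x + y + z)) := by
          rw [Finset.sum_comm]
          refine Finset.sum_congr rfl fun x _ => ?_
          rw [Finset.sum_comm]
          refine Finset.sum_congr rfl fun y _ => ?_
          rw [Finset.sum_comm]
          simp only [Finset.mul_sum]
      _ = 2 ^ n * ∑ x, ∑ y, sgn (f x) * sgn (f y) * sgn (f (x + y)) := by
          rw [Finset.mul_sum]
          refine Finset.sum_congr rfl fun x _ => ?_
          rw [Finset.mul_sum]
          refine Finset.sum_congr rfl fun y _ => ?_
          simp only [sum_sgn_lin, cube_add_eq_zero_iff, mul_ite, mul_zero, Finset.sum_ite_eq',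
            Finset.mem_univ, if_true]
          ring
  have h4 : ∑ x, ∑ y, sgn (f x) * sgn (f y) * sgn (f (x + y)) = 2 ^ n * 2 ^ n -
      2 * ∑ p : Cube n × Cube n, if f p.1 + f p.2 ≠ f (p.1 + p.2) then (1 : ℝ) else 0 := by
    have h : ∀ x y, sgn (f x) * sgn (f y) * sgn (f (x + y)) =
        1 - 2 * if f x + f y ≠ f (x + y) then (1 : ℝ) else 0 := fun x y => by
      rw [← sgn_add, ← sgn_add, sgn_eq]
    simp only [h, Finset.sum_sub_distrib, ← Finset.mul_sum, Fintype.sum_prod_type]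
    simp [ZMod.card]
  have h5 : ∑ S, F S ^ 3 ≤ (1 - 2 * δ) * 2 ^ n * (2 ^ n * 2 ^ n) := by
    rw [← h2, Finset.mul_sum]
    refine Finset.sum_le_sum fun S _ => ?_
    rw [pow_succ, mul_comm]
    exact mul_le_mul_of_nonneg_right (h1 S) (sq_nonneg _)
  rw [h3, h4] at h5
  rw [pr_eq_sum, Fintype.card_prod, Nat.cast_mul, hcard, le_div_iff₀ (by positivity)]
  have h6 : (2 : ℝ) ^ n * (2 ^ n * 2 ^ n - 2 * ∑ p : Cube n × Cube n,
      if f p.1 + f p.2 ≠ f (p.1 + p.2) then (1 : ℝ) else 0) ≤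
      2 ^ n * ((1 - 2 * δ) * (2 ^ n * 2 ^ n)) := by
    rw [← mul_assoc, mul_comm ((2 : ℝ) ^ n) (1 - 2 * δ)]
    exact h5
  have := le_of_mul_le_mul_left h6 hpos
  linarith

/-- Self-correction: for `f` close to a linear function `g`, the value `g x` is
`f (x + u) + f u` for most `u`. -/
theorem pr_selfCorrect_le {n : ℕ} (f : Cube n → ZMod 2) (S : Finset (Fin n)) (x : Cube n) :
    (pr fun u => f u + lin S x ≠ f (u + x)) ≤ 2 * pr fun u => f u ≠ lin S u := by
  calc (pr fun u => f u + lin S x ≠ f (u + x)) ≤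
        pr fun u => f u ≠ lin S u ∨ f (u + x) ≠ lin S (u + x) := by
        refine pr_mono fun u hu => ?_
        by_contra! hc
        rw [hc.1, hc.2, lin_add] at hu
        exact hu rfl
    _ ≤ (pr fun u => f u ≠ lin S u) + pr fun u => f (u + x) ≠ lin S (u + x) := pr_or_le _ _
    _ = 2 * pr fun u => f u ≠ lin S u := by
        have h := pr_comp_equiv (Equiv.addRight x) (fun u => f u ≠ lin S u)
        simp only [Equiv.coe_addRight] at h
        rw [h, two_mul]

/-! ### Random hashing of the coordinates -/

section hash

variable {ι β γ : Type*} [DecidableEq β]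

/-- The buckets that contain an odd number of elements of `S`. -/
def oddImage (φ : ι → β) (S : Finset ι) : Finset β :=
  (S.image φ).filter fun b => Odd (S.filter fun i => φ i = b).card

/-- Elements of `S` in a common bucket read the same bit of `y`, so they cancel in pairs over `F_2`.
-/
theorem lin_comp (φ : ι → β) (S : Finset ι) (y : β → ZMod 2) :
    lin S (y ∘ φ) = lin (oddImage φ S) y := by
  classical
  rw [lin, lin, oddImage, Finset.sum_filter,
    ← Finset.sum_fiberwise_of_maps_to (g := φ) (t := S.image φ)
      fun i hi => Finset.mem_image_of_mem φ hi]
  refine Finset.sum_congr rfl fun b _ => ?_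
  have h : ∑ i ∈ S with φ i = b, (y ∘ φ) i = ((S.filter fun i => φ i = b).card : ZMod 2) * y b := by
    rw [← nsmul_eq_mul, ← Finset.sum_const]
    refine Finset.sum_congr rfl fun i hi => ?_
    rw [Function.comp, (Finset.mem_filter.1 hi).2]
  rw [h]
  split_ifs with ho
  · rw [(ZMod.natCast_eq_one_iff_odd).2 ho, one_mul]
  · rw [(ZMod.natCast_eq_zero_iff_even).2 (Nat.not_odd_iff_even.1 ho), zero_mul]

theorem card_oddImage_le (φ : ι → β) (S : Finset ι) : (oddImage φ S).card ≤ S.card :=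
  (Finset.card_filter_le _ _).trans Finset.card_image_le

theorem oddImage_of_injOn {φ : ι → β} {S : Finset ι} (h : Set.InjOn φ S) :
    oddImage φ S = S.image φ := by
  classical
  refine Finset.filter_true_of_mem fun b hb => ?_
  obtain ⟨i, hi, rfl⟩ := Finset.mem_image.1 hb
  have : (S.filter fun j => φ j = φ i) = {i} := by
    ext j
    simp only [Finset.mem_filter, Finset.mem_singleton]
    exact ⟨fun hj => h hj.1 hi hj.2, by rintro rfl; exact ⟨hi, rfl⟩⟩
  rw [this, Finset.card_singleton]
  exact odd_one

theorem mem_oddImage {φ : ι → β} {S : Finset ι} {b : β} :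
    b ∈ oddImage φ S ↔ Odd (S.filter fun i => φ i = b).card := by
  classical
  refine ⟨fun h => (Finset.mem_filter.1 h).2, fun h => Finset.mem_filter.2 ⟨?_, h⟩⟩
  obtain ⟨i, hi⟩ := Finset.card_pos.1 h.pos
  obtain ⟨h1, rfl⟩ := Finset.mem_filter.1 hi
  exact Finset.mem_image_of_mem φ h1

theorem oddImage_union [DecidableEq ι] {φ : ι → β} {S T : Finset ι} (h : Disjoint S T) :
    oddImage φ (S ∪ T) = symmDiff (oddImage φ S) (oddImage φ T) := by
  ext b
  have hd : Disjoint (S.filter fun i => φ i = b) (T.filter fun i => φ i = b) :=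
    Finset.disjoint_filter_filter h
  rw [Finset.mem_symmDiff, mem_oddImage, mem_oddImage, mem_oddImage, Finset.filter_union,
    Finset.card_union_of_disjoint hd, Nat.odd_add]
  simp only [← Nat.not_odd_iff_even]
  tauto

theorem oddImage_update [DecidableEq ι] {φ : ι → β} {S : Finset ι} {i : ι} (hi : i ∉ S) (b : β) :
    oddImage (Function.update φ i b) S = oddImage φ S := by
  ext c
  rw [mem_oddImage, mem_oddImage]
  have : (S.filter fun j => Function.update φ i b j = c) = S.filter fun j => φ j = c := by
    refine Finset.filter_congr fun j hj => ?_
    rw [Function.update_of_ne]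
    rintro rfl; exact hi hj
  rw [this]

variable [Fintype ι] [DecidableEq ι] [Fintype β] [Nonempty β]

theorem pr_collision {i j : ι} (h : i ≠ j) :
    (pr fun φ : ι → β => φ i = φ j) ≤ 1 / Fintype.card β := by
  refine pr_le_of_update i fun φ => ?_
  rw [← pr_eq_const (φ j)]
  refine pr_mono fun b hb => ?_
  rwa [Function.update_self, Function.update_of_ne h.symm] at hb

theorem pr_not_injOn_le (S : Finset ι) :
    (pr fun φ : ι → β => ¬ Set.InjOn φ S) ≤ S.card * S.card / Fintype.card β := by
  have h1 : (pr fun φ : ι → β => ¬ Set.InjOn φ S) ≤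
      pr fun φ : ι → β => ∃ p ∈ S.offDiag, φ p.1 = φ p.2 := by
    refine pr_mono fun φ hφ => ?_
    simp only [Set.InjOn, not_forall] at hφ
    obtain ⟨i, hi, j, hj, h, hn⟩ := hφ
    exact ⟨(i, j), Finset.mem_offDiag.2 ⟨hi, hj, hn⟩, h⟩
  refine h1.trans ((pr_exists_le _ _).trans ?_)
  refine (Finset.sum_le_sum fun p hp =>
    pr_collision (β := β) (Finset.mem_offDiag.1 hp).2.2).trans ?_
  rw [Finset.sum_const, Finset.offDiag_card, nsmul_eq_mul, mul_one_div]
  gcongr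
  exact_mod_cast Nat.sub_le _ _

/-- More than `k` elements are unlikely to leave exactly `k` buckets with an odd number. -/
theorem pr_card_oddImage_eq_le {S : Finset ι} {k : ℕ} (hS : k < S.card) :
    (pr fun φ : ι → β => (oddImage φ S).card = k) ≤ 3 * (k + 1) ^ 2 / Fintype.card β := by
  -- Take `k + 1` elements `S₀` of `S`, and suppose `φ` is injective on them. If the remaining
  -- elements leave more than `2 * k + 1` odd buckets, then `S₀` can repair at most `k + 1`, and
  -- more than `k` stay. Otherwise the images of `S₀` are unlikely to hit these few buckets, which
  -- do not depend on `φ` on `S₀`, and then all `k + 1` images are odd. The failures add up to `(k +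
  -- 1) * (2 * k + 1) + (k + 1) ^ 2` over the number of buckets.
  obtain ⟨S₀, hS₀, hk⟩ := Finset.exists_subset_card_eq (Nat.succ_le_of_lt hS)
  have h1 : (pr fun φ : ι → β => (oddImage φ S).card = k) ≤ pr fun φ : ι → β =>
      (∃ i ∈ S₀, (oddImage φ (S \ S₀)).card ≤ 2 * k + 1 ∧ φ i ∈ oddImage φ (S \ S₀)) ∨
        ¬ Set.InjOn φ S₀ := by
    refine pr_mono fun φ hφ => ?_
    by_contra! hc
    obtain ⟨h2, h3⟩ := hc
    have h4 : oddImage φ S = symmDiff (oddImage φ S₀) (oddImage φ (S \ S₀)) := by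
      rw [← oddImage_union Finset.disjoint_sdiff, Finset.union_sdiff_of_subset hS₀]
    have h5 := card_oddImage_le φ S₀
    by_cases h6 : (oddImage φ (S \ S₀)).card ≤ 2 * k + 1
    · have h7 : Disjoint (oddImage φ S₀) (oddImage φ (S \ S₀)) := by
        rw [oddImage_of_injOn h3, Finset.disjoint_left]
        intro b hb
        obtain ⟨i, hi, rfl⟩ := Finset.mem_image.1 hb
        exact h2 i hi h6
      rw [h4, h7.symmDiff_eq_sup, Finset.sup_eq_union, Finset.card_union_of_disjoint h7,
        oddImage_of_injOn h3, Finset.card_image_of_injOn h3] at hφ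
      omega
    · have h7 : oddImage φ (S \ S₀) ⊆ oddImage φ S ∪ oddImage φ S₀ := by
        intro b hb
        rw [h4, Finset.mem_union, Finset.mem_symmDiff]
        tauto
      have h8 := (Finset.card_le_card h7).trans (Finset.card_union_le _ _)
      omega
  have h2 : ∀ i ∈ S₀, (pr fun φ : ι → β => (oddImage φ (S \ S₀)).card ≤ 2 * k + 1 ∧
      φ i ∈ oddImage φ (S \ S₀)) ≤ (2 * k + 1) / Fintype.card β := by
    intro i hi
    refine pr_le_of_update i fun φ => ?_
    have hi' : i ∉ S \ S₀ := fun h => (Finset.mem_sdiff.1 h).2 hi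
    simp only [oddImage_update hi', Function.update_self]
    by_cases h3 : (oddImage φ (S \ S₀)).card ≤ 2 * k + 1
    · refine (pr_mono (q := fun b => b ∈ oddImage φ (S \ S₀)) fun b hb => hb.2).trans ?_
      rw [pr_mem_finset]
      gcongr
      exact_mod_cast h3
    · simp only [h3, false_and]
      rw [pr_eq_card]
      simp only [Finset.filter_false, Finset.card_empty, Nat.cast_zero, zero_div]
      positivity
  refine h1.trans ((pr_or_le _ _).trans ((add_le_add ((pr_exists_le _ _).trans
    (Finset.sum_le_sum h2)) (pr_not_injOn_le S₀)).trans ?_))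
  rw [Finset.sum_const, hk, nsmul_eq_mul, ← mul_div_assoc, ← add_div]
  push_cast
  gcongr
  nlinarith [(Nat.cast_nonneg k : (0 : ℝ) ≤ k)]

end hash

/-! ### Decoding -/

section decode

variable {n r : ℕ} {β γ : Type*} [DecidableEq γ] [DecidableEq β]

/-- The answer to the indicator string of a small bucket. -/
def bucketAns (f : Cube n → ZMod 2) (φ : Fin n → β) (h : β → γ) (j : γ) : ZMod 2 :=
  f fun i => if h (φ i) = j then 1 else 0

/-- The number of rounds with a positive answer for a large bucket. -/
def votes (f : Cube n → ZMod 2) (φ : Fin n → β) (H : Fin r → β → γ) (a : β) : ℕ :=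
  ∑ t, (bucketAns f φ (H t) (H t a)).val

/-- `a` shares its small bucket with another element of `T`. -/
def Collides (T : Finset β) (a : β) (h : β → γ) : Prop := ∃ a' ∈ T.erase a, h a' = h a

/-- The answer is the parity of the number of elements of `φ(S)` in the small bucket of `a`, and
without a collision only `a` itself can contribute. -/
theorem bucketAns_of_not_collides {S : Finset (Fin n)} {φ : Fin n → β} (hφ : Set.InjOn φ S)
    {a : β} {h : β → γ} (hc : ¬ Collides (S.image φ) a h) :
    bucketAns (lin S) φ h (h a) = if a ∈ S.image φ then 1 else 0 := by
  have h1 : bucketAns (lin S) φ h (h a) = ∑ a' ∈ S.image φ, if h a' = h a then (1 : ZMod 2) else 0 := by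
    rw [Finset.sum_image hφ]; rfl
  rw [h1, ← Finset.sum_ite_eq' (S.image φ) a fun _ => (1 : ZMod 2)]
  refine Finset.sum_congr rfl fun a' ha' => ?_
  by_cases h2 : a' = a
  · simp [h2]
  · rw [if_neg h2, if_neg]
    exact fun h3 => hc ⟨a', Finset.mem_erase.2 ⟨h2, ha'⟩, h3⟩

variable [Fintype β]

/-- The large buckets with a majority of positive answers. -/
def selected (f : Cube n → ZMod 2) (φ : Fin n → β) (H : Fin r → β → γ) : Finset β :=
  Finset.univ.filter fun a => r < 2 * votes f φ H a

theorem pr_collides_le [Fintype γ] [Nonempty γ] (T : Finset β) (a : β) :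
    (pr fun h : β → γ => Collides T a h) ≤ T.card / Fintype.card γ := by
  refine (pr_exists_le _ _).trans ((Finset.sum_le_sum fun a' ha' =>
    pr_collision (β := γ) (Finset.ne_of_mem_erase ha')).trans ?_)
  rw [Finset.sum_const, nsmul_eq_mul, mul_one_div]
  gcongr
  exact Finset.erase_subset a T

/-- `B a` collects the rounds that may lie about `a`. All others answer correctly, and since they
are a strict majority, the vote is right for members and non-members alike. -/
theorem selected_eq_of_not_collides {S : Finset (Fin n)} {φ : Fin n → β} (hφ : Set.InjOn φ S)
    (H : Fin r → β → γ) (B : β → Finset (Fin r))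
    (hB : ∀ a t, t ∉ B a → ¬ Collides (S.image φ) a (H t)) (hr : ∀ a, 2 * (B a).card < r) :
    selected (lin S) φ H = S.image φ := by
  ext a
  have hle : ∀ x : ZMod 2, x.val ≤ 1 := by decide
  have h1 : ((B a)ᶜ).card = r - (B a).card := by rw [Finset.card_compl, Fintype.card_fin]
  have h2 := hr a
  rw [selected, Finset.mem_filter]
  simp only [Finset.mem_univ, true_and]
  rw [votes, ← Finset.sum_compl_add_sum (B a)]
  have h3 : ∑ t ∈ B a, (bucketAns (lin S) φ (H t) (H t a)).val ≤ (B a).card := by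
    rw [Finset.card_eq_sum_ones]
    exact Finset.sum_le_sum fun t _ => hle _
  have h4 : ∀ t ∈ (B a)ᶜ, (bucketAns (lin S) φ (H t) (H t a)).val =
      if a ∈ S.image φ then 1 else 0 := by
    intro t ht
    rw [bucketAns_of_not_collides hφ (hB a t (Finset.mem_compl.1 ht))]
    split_ifs <;> rfl
  rw [Finset.sum_congr rfl h4, Finset.sum_const, h1]
  by_cases ha : a ∈ S.image φ
  · simp only [ha, if_true, smul_eq_mul, iff_true]; omega
  · simp only [ha, if_false, smul_zero, iff_false]; omega

/-- For a linear function, the decoding is likely to find the image of its coordinates. -/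
theorem pr_selected_ne_le [Fintype γ] [Nonempty γ] {S : Finset (Fin n)} {φ : Fin n → β}
    (hφ : Set.InjOn φ S) (hS : (S.card : ℝ) / Fintype.card γ ≤ 1 / 64) :
    (pr fun H : Fin r → β → γ => selected (lin S) φ H ≠ S.image φ) ≤
      Fintype.card β * (1 / 3) ^ r := by
  classical
  let B : (Fin r → β → γ) → β → Finset (Fin r) := fun H a =>
    Finset.univ.filter fun t => Collides (S.image φ) a (H t)
  have h1 : (pr fun H : Fin r → β → γ => selected (lin S) φ H ≠ S.image φ) ≤
      pr fun H : Fin r → β → γ => ∃ a ∈ (Finset.univ : Finset β), r ≤ 2 * (B H a).card := by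
    refine pr_mono fun H hH => ?_
    by_contra! hc
    refine hH (selected_eq_of_not_collides hφ H (B H) ?_ fun a => hc a (Finset.mem_univ a))
    intro a t ht
    simpa [B] using ht
  refine h1.trans ((pr_exists_le _ _).trans ((Finset.sum_le_sum fun a _ =>
    pr_majority_le (fun h : β → γ => Collides (S.image φ) a h) ?_ r _ fun H =>
      ⟨B H a, rfl, fun t ht => ?_⟩).trans (le_of_eq ?_)))
  · refine (pr_collides_le _ _).trans (le_trans ?_ hS)
    gcongr
    exact_mod_cast Finset.card_image_le
  · simpa [B] using ht
  · simp

end decode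

/-! ### One trial -/

section trial

variable {n : ℕ} {β : Type*}

/-- The random strings of a trial: three strings from coin tosses and a sample. -/
abbrev TrialData (n : ℕ) (β : Type*) : Type _ := (Cube n × Cube n × (β → ZMod 2)) × Cube n

/-- A trial with the hash function `φ` and the selected buckets `T` does not refute. -/
def TrialOK (f : Cube n → ZMod 2) (φ : Fin n → β) (T : Finset β) (d : TrialData n β) : Prop :=
  f d.1.1 + f d.1.2.1 = f (d.1.1 + d.1.2.1) ∧ f d.1.1 + f d.2 = f (d.1.1 + d.2) ∧
    f d.1.1 + lin T d.1.2.2 = f (d.1.1 + d.1.2.2 ∘ φ)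

theorem trialOK_lin [DecidableEq β] {S : Finset (Fin n)} {φ : Fin n → β} (hφ : Set.InjOn φ S)
    (d : TrialData n β) : TrialOK (lin S) φ (S.image φ) d := by
  refine ⟨(lin_add _ _ _).symm, (lin_add _ _ _).symm, ?_⟩
  rw [lin_add, lin_comp, oddImage_of_injOn hφ]

variable [Fintype β] [DecidableEq β]

/-- Only the first check matters; the sample and `y` are irrelevant. -/
theorem pr_trialOK_le_of_far {f : Cube n → ZMod 2}
    (h : ∀ S : Finset (Fin n), 1 / 8 ≤ pr fun x => f x ≠ lin S x) (φ : Fin n → β) (T : Finset β)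
    (x : Cube n) : (pr fun c => TrialOK f φ T (c, x)) ≤ 1 - 1 / 8 := by
  have h1 := blr f (1 / 8) h
  have h2 : (pr fun c : Cube n × Cube n × (β → ZMod 2) => ¬ (f c.1 + f c.2.1 ≠ f (c.1 + c.2.1))) ≤
      1 - 1 / 8 := by
    rw [pr_not]
    have h3 : (pr fun c : Cube n × Cube n × (β → ZMod 2) => f c.1 + f c.2.1 ≠ f (c.1 + c.2.1)) =
        pr fun p : Cube n × Cube n => f p.1 + f p.2 ≠ f (p.1 + p.2) := by
      rw [← pr_fst (β := β → ZMod 2) (fun p : Cube n × Cube n => f p.1 + f p.2 ≠ f (p.1 + p.2)),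
        ← pr_comp_equiv (Equiv.prodAssoc (Cube n) (Cube n) (β → ZMod 2))]
      rfl
    rw [h3]; linarith
  exact (pr_mono fun c hc => not_not.2 hc.1).trans h2

/-- For all but a quarter of the `u`, `f (u + x) - f u` is the corrected value `lin S x`, so the
second check exposes the wrong value `f x`. -/
theorem pr_trialOK_le_of_ne {f : Cube n → ZMod 2} {S : Finset (Fin n)}
    (h : (pr fun x => f x ≠ lin S x) ≤ 1 / 8) {x : Cube n} (hx : f x ≠ lin S x) (φ : Fin n → β)
    (T : Finset β) : (pr fun c => TrialOK f φ T (c, x)) ≤ 1 - 3 / 4 := by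
  have h1 := (pr_selfCorrect_le f S x).trans (mul_le_mul_of_nonneg_left h zero_le_two)
  rw [← pr_fst (β := Cube n × (β → ZMod 2))] at h1
  refine (pr_mono fun c hc => ?_).trans (h1.trans (by norm_num))
  rw [← hc.2.1]
  exact fun h2 => hx (add_left_cancel h2).symm

/-- Passing needs either that two distinct linear functions agree at `y` (probability at most `1 /
2`) or that self-correction fails at `y ∘ φ` (at most `1 / 4`). For the latter `y` is fixed and `u`
random, so it does not matter that `y ∘ φ` is not uniform. -/
theorem pr_trialOK_le_of_oddImage_ne {f : Cube n → ZMod 2} {S : Finset (Fin n)}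
    (h : (pr fun x => f x ≠ lin S x) ≤ 1 / 8) {φ : Fin n → β} {T : Finset β}
    (hT : oddImage φ S ≠ T) (x : Cube n) :
    (pr fun c => TrialOK f φ T (c, x)) ≤ 1 - 1 / 4 := by
  have h1 : (pr fun c : Cube n × Cube n × (β → ZMod 2) =>
      lin (oddImage φ S) c.2.2 = lin T c.2.2) ≤ 1 / 2 :=
    pr_prod_le fun _ => pr_prod_le fun _ => pr_lin_eq_le hT
  have h2 : (pr fun c : Cube n × Cube n × (β → ZMod 2) =>
      f c.1 + lin S (c.2.2 ∘ φ) ≠ f (c.1 + c.2.2 ∘ φ)) ≤ 1 / 4 := by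
    rw [← pr_comp_equiv (Equiv.prodComm (Cube n × (β → ZMod 2)) (Cube n))]
    refine pr_prod_le fun y => (pr_selfCorrect_le f S (y.2 ∘ φ)).trans ?_
    linarith
  refine (pr_mono fun c hc => ?_).trans ((pr_or_le _ _).trans ((add_le_add h1 h2).trans (by norm_num)))
  by_contra! hcon
  obtain ⟨h3, h4⟩ := hcon
  have h5 := hc.2.2
  simp only at h5
  rw [← h4, lin_comp] at h5
  exact h3 (add_left_cancel h5).symm

end trial

/-! ### The verdict in terms of hash functions and trials -/

section verdict

variable {n : ℕ} (k b : ℕ) (E : Env n)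

/-- The hash function to large buckets. -/
def phiF (i : Fin n) : Fin (2 ^ (2 * b)) := ⟨phiN b E i, phiN_lt _⟩

/-- The hash functions from large to small buckets. -/
def hashF (t : Fin (2 * b)) (a : Fin (2 ^ (2 * b))) : Fin (2 ^ b) := ⟨hashN b E t a, hashN_lt _ _⟩

/-- The random strings of trial `t`. -/
def trialF (t : ℕ) : TrialData n (Fin (2 ^ (2 * b))) :=
  ((fun i => E.coins (tossT (n := n) b t + i), fun i => E.coins (tossT (n := n) b t + n + i),
    fun a => E.coins (tossT (n := n) b t + n + n + a)), E.samples t)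

theorem bitsVal_one (ω : ℕ → ZMod 2) (τ : ℕ) : bitsVal ω τ 1 = (ω τ).val := by simp [bitsVal]

theorem natXor_eq_zero_iff {a b : ℕ} : natXor a b = 0 ↔ a = b := by unfold natXor; omega

theorem natXor_val : ∀ a b : ZMod 2, natXor a.val b.val = (a + b).val := by unfold natXor; decide

theorem toCube_uN (t : ℕ) : toCube n (uN b E t) = (trialF b E t).1.1 := by
  funext i; simp [toCube, uN, trialF, bitsVal_one]

theorem toCube_vN (t : ℕ) : toCube n (vN b E t) = (trialF b E t).1.2.1 := by
  funext i; simp [toCube, vN, trialF, bitsVal_one]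

theorem toCube_xN (t : ℕ) : toCube n (xN E t) = (trialF b E t).2 := by
  funext i; simp [toCube, xN, trialF, entries]

theorem yN_eq (t : ℕ) (a : Fin (2 ^ (2 * b))) : yN b E t a = ((trialF b E t).1.2.2 a).val := by
  simp [yN, trialF, bitsVal_one]

theorem toCube_uvN (t : ℕ) :
    toCube n (uvN b E t) = (trialF b E t).1.1 + (trialF b E t).1.2.1 := by
  rw [← toCube_uN, ← toCube_vN]; funext i; simp [toCube, uvN]

theorem toCube_uxN (t : ℕ) :
    toCube n (uxN b E t) = (trialF b E t).1.1 + (trialF b E t).2 := by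
  rw [← toCube_uN, ← toCube_xN b]; funext i; simp [toCube, uxN]

theorem toCube_uyN (t : ℕ) :
    toCube n (uyN b E t) = (trialF b E t).1.1 + (trialF b E t).1.2.2 ∘ phiF b E := by
  rw [← toCube_uN]
  funext i
  have := yN_eq b E t (phiF b E i)
  simp only [phiF] at this
  simp [toCube, uyN, this, phiF]

theorem parN_eq (t : Fin (2 * b)) (j : Fin (2 ^ b)) :
    parN b E t j = (bucketAns E.f (phiF b E) (hashF b E t) j).val := by
  rw [parN, bucketAns]
  congr 2
  funext i
  simp only [toCube, zN, hashF, phiF, Fin.ext_iff]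
  split_ifs with h
  · rw [natXor_eq_zero_iff.2 h]; rfl
  · have := natXor_eq_zero_iff.not.2 h
    rw [Nat.sub_eq_zero_of_le (by omega)]; rfl

theorem cntN_eq (a : Fin (2 ^ (2 * b))) :
    cntN b E (2 * b) a = votes E.f (phiF b E) (hashF b E) a := by
  rw [cntN, votes, Finset.sum_range]
  exact Finset.sum_congr rfl fun t _ => parN_eq b E t (hashF b E t a)

/-- With truncated subtraction, `1 - (1 - x)` is the indicator of `x > 0`; here this says that the
votes form a strict majority. -/
theorem selN_eq (a : Fin (2 ^ (2 * b))) :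
    selN b E a = if a ∈ selected E.f (phiF b E) (hashF b E) then 1 else 0 := by
  rw [selN, cntN_eq]
  simp only [selected, Finset.mem_filter, Finset.mem_univ, true_and]
  split_ifs <;> omega

theorem numSel_eq : numSel b E (2 ^ (2 * b)) = (selected E.f (phiF b E) (hashF b E)).card := by
  rw [numSel, Finset.sum_range]
  simp [selN_eq]

theorem ySum_eq (t : ℕ) : ySum b E t (2 ^ (2 * b)) =
    (lin (selected E.f (phiF b E) (hashF b E)) (trialF b E t).1.2.2).val := by
  have h : ∀ a, a ≤ 2 ^ (2 * b) → ySum b E t a = (∑ i ∈ Finset.range a,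
      if selN b E i = 1 then (yN b E t i : ZMod 2) else 0).val := by
    intro a
    induction a with
    | zero => intro _; simp [ySum]
    | succ a ih =>
      intro ha
      have hy : yN b E t a = (yN b E t a : ZMod 2).val := by
        rw [yN_eq b E t ⟨a, ha⟩]; simp
      have hs := selN_le (b := b) (E := E) a
      rw [ySum, ih (by omega), Finset.sum_range_succ, ← natXor_val]
      congr 1
      split_ifs with h1
      · rw [h1, Nat.add_sub_cancel]; exact hy
      · have h2 : selN b E a = 0 := by omega
        have h3 := ZMod.val_lt (yN b E t a : ZMod 2)
        rw [ZMod.val_zero]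
        omega
  rw [h _ le_rfl, Finset.sum_range, lin, ← Finset.univ_inter (selected _ _ _), ← Finset.sum_ite_mem]
  congr 1
  refine Finset.sum_congr rfl fun a _ => ?_
  rw [selN_eq, yN_eq, ZMod.natCast_zmod_val]
  split_ifs <;> simp_all

theorem flagN_le_one (t : ℕ) : flagN k b E t ≤ 1 := by
  induction t with
  | zero => simp only [flagN, flagInit]; omega
  | succ t ih => simp only [flagN]; omega

theorem trialOK_iff (t : ℕ) : TrialOK E.f (phiF b E) (selected E.f (phiF b E) (hashF b E))
      (trialF b E t) ↔
    natXor (ans E (uN b E t)) (natXor (ans E (vN b E t)) (ans E (uvN b E t))) = 0 ∧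
    natXor (ans E (uN b E t)) (natXor (ans E (xN E t)) (ans E (uxN b E t))) = 0 ∧
    natXor (ans E (uN b E t)) (natXor (ans E (uyN b E t)) (ySum b E t (2 ^ (2 * b)))) = 0 := by
  have h1 : ∀ a b c : ZMod 2, (a + (b + c)).val = 0 ↔ a + b = c := by decide
  have h2 : ∀ a b c : ZMod 2, (a + (b + c)).val = 0 ↔ a + c = b := by decide
  rw [TrialOK, ySum_eq]
  simp only [ans, natXor_val, toCube_uN, toCube_vN, toCube_xN b, toCube_uvN, toCube_uxN, toCube_uyN]
  rw [h1, h1, h2]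

theorem flagN_eq_one_iff (N : ℕ) : flagN k b E N = 1 ↔
    (selected E.f (phiF b E) (hashF b E)).card = k ∧
      ∀ t < N, TrialOK E.f (phiF b E) (selected E.f (phiF b E) (hashF b E)) (trialF b E t) := by
  induction N with
  | zero =>
    have := natXor_eq_zero_iff (a := numSel b E (2 ^ (2 * b))) (b := k)
    simp only [flagN, flagInit, ← numSel_eq, Nat.not_lt_zero, false_imp_iff, implies_true, and_true]
    omega
  | succ t ih =>
    have h1 := flagN_le_one k b E t
    have h2 := trialOK_iff b E t
    rw [flagN]
    constructor
    · intro h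
      obtain ⟨h3, h4⟩ := ih.1 (by omega)
      refine ⟨h3, fun t' ht' => ?_⟩
      rcases Nat.lt_succ_iff_lt_or_eq.1 ht' with h5 | rfl
      · exact h4 t' h5
      · exact h2.2 ⟨by omega, by omega, by omega⟩
    · rintro ⟨h3, h4⟩
      have h5 := ih.2 ⟨h3, fun t' ht' => h4 t' (by omega)⟩
      obtain ⟨h6, h7, h8⟩ := h2.1 (h4 t (by omega))
      omega

end verdict

/-! ### The joint law of the hash functions and the trials -/

/-- The uniform distribution. -/
def unif (α : Type*) [Fintype α] [Nonempty α] [MeasurableSpace α] : Measure α :=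
  (PMF.uniformOfFintype α).toMeasure

instance (α : Type*) [Fintype α] [Nonempty α] [MeasurableSpace α] :
    IsProbabilityMeasure (unif α) := PMF.toMeasure.isProbabilityMeasure _

section unif

variable {α : Type*} [Fintype α] [Nonempty α] [MeasurableSpace α] [DiscreteMeasurableSpace α]

theorem unif_singleton (a : α) : unif α {a} = (Fintype.card α : ENNReal)⁻¹ := by
  rw [unif, PMF.toMeasure_apply_singleton _ _ (MeasurableSet.singleton a),
    PMF.uniformOfFintype_apply]

theorem unif_real (p : α → Prop) : (unif α).real {x | p x} = pr p := by
  classical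
  rw [Measure.real, unif, PMF.toMeasure_uniformOfFintype_apply _ (MeasurableSet.of_discrete),
    pr_eq_card, ENNReal.toReal_div, Fintype.card_subtype]
  simp

theorem unif_eq_ofReal (p : α → Prop) : unif α {x | p x} = ENNReal.ofReal (pr p) := by
  rw [← unif_real, ofReal_measureReal]

end unif

/-! ### Independent trials. -/

section trials

variable {α X : Type*} [Fintype α] [Nonempty α] [MeasurableSpace α] [DiscreteMeasurableSpace α]
  [MeasurableSpace X] [Finite X] [DiscreteMeasurableSpace X]

/-- Independent repetitions: if a trial passes with probability at most `1 - p`, except for bad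
values of `d`, then all `N` trials pass with probability at most `pr bad + (1 - p) ^ N`. -/
theorem real_forall_trials_le (ν : Measure X) [IsProbabilityMeasure ν] (N : ℕ) (bad : α → Prop)
    (ok : α → X → Prop) {p : ℝ} (hp : p ≤ 1)
    (h : ∀ d, ¬ bad d → ν.real {x | ok d x} ≤ 1 - p) :
    ((unif α).prod (Measure.pi fun _ : Fin N => ν)).real {z | ∀ t, ok z.1 (z.2 t)} ≤
      pr bad + (1 - p) ^ N := by
  have hsub : {z : α × (Fin N → X) | ∀ t, ok z.1 (z.2 t)} ⊆
      {d | bad d} ×ˢ Set.univ ∪ {z | ¬ bad z.1 ∧ ∀ t, ok z.1 (z.2 t)} := by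
    intro z hz
    by_cases hb : bad z.1
    · exact Or.inl ⟨hb, trivial⟩
    · exact Or.inr ⟨hb, hz⟩
  refine (measureReal_mono hsub).trans ((measureReal_union_le _ _).trans (add_le_add ?_ ?_))
  · rw [measureReal_prod_prod, unif_real, probReal_univ, mul_one]
  · have h1 : (unif α).prod (Measure.pi fun _ : Fin N => ν)
        {z | ¬ bad z.1 ∧ ∀ t, ok z.1 (z.2 t)} ≤ ENNReal.ofReal ((1 - p) ^ N) := by
      rw [Measure.prod_apply (Set.toFinite _).measurableSet]
      calc _ ≤ ∫⁻ _ : α, ENNReal.ofReal ((1 - p) ^ N) ∂unif α := by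
            refine lintegral_mono fun d => ?_
            by_cases hb : bad d
            · simp [hb]
            · have h2 : Prod.mk d ⁻¹' {z : α × (Fin N → X) | ¬ bad z.1 ∧ ∀ t, ok z.1 (z.2 t)} =
                  Set.univ.pi fun _ : Fin N => {x | ok d x} := by
                ext tr; simp [hb]
              rw [h2, Measure.pi_pi, Finset.prod_const, Finset.card_univ, Fintype.card_fin,
                ENNReal.ofReal_pow (by linarith)]
              gcongr
              rw [← ofReal_measureReal]
              exact ENNReal.ofReal_le_ofReal (h d hb)
        _ = _ := by simp
    exact ENNReal.toReal_le_of_le_ofReal (pow_nonneg (by linarith) _) h1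

/-- Condition on the sample: in `F` the trial fails with probability at least `c`, and elsewhere
nothing is claimed. `F` is the set where `f` is wrong in one application, and everything in the
others. -/
theorem real_trial_le (D : Measure X) [IsProbabilityMeasure D] (ok : α × X → Prop) (F : Set X)
    {c : ℝ} (hc : c ≤ 1) (h : ∀ x ∈ F, (pr fun u => ok (u, x)) ≤ 1 - c) :
    ((unif α).prod D).real {z | ok z} ≤ 1 - c * D.real F := by
  classical
  have hF : MeasurableSet F := MeasurableSet.of_discrete
  have h1 : (unif α).prod D {z | ok z} ≤ ENNReal.ofReal (1 - c) * D F + D Fᶜ := by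
    rw [Measure.prod_apply_symm (Set.toFinite _).measurableSet]
    calc _ ≤ ∫⁻ x, F.indicator (fun _ => ENNReal.ofReal (1 - c)) x + Fᶜ.indicator 1 x ∂D := by
          refine lintegral_mono fun x => ?_
          by_cases hx : x ∈ F
          · have h2 : (fun u => (u, x)) ⁻¹' {z : α × X | ok z} = {u | ok (u, x)} := rfl
            rw [h2, unif_eq_ofReal]
            simpa [hx] using ENNReal.ofReal_le_ofReal (h x hx)
          · simp [hx, prob_le_one]
      _ = _ := by
          rw [lintegral_add_left (measurable_const.indicator hF), lintegral_indicator hF,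
            lintegral_indicator_one hF.compl]
          simp
  have h2 : ENNReal.ofReal (1 - c) * D F + D Fᶜ = ENNReal.ofReal (1 - c * D.real F) := by
    have h3 : D.real Fᶜ = 1 - D.real F := probReal_compl_eq_one_sub hF
    rw [← ofReal_measureReal (μ := D) (s := F), ← ofReal_measureReal (μ := D) (s := Fᶜ), h3,
      ← ENNReal.ofReal_mul (by linarith), ← ENNReal.ofReal_add]
    · ring_nf
    · exact mul_nonneg (by linarith) measureReal_nonneg
    · linarith [measureReal_le_one (μ := D) (s := F)]
  rw [h2] at h1
  refine ENNReal.toReal_le_of_le_ofReal ?_ h1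
  nlinarith [measureReal_le_one (μ := D) (s := F), measureReal_nonneg (μ := D) (s := F)]

end trials

/-! ### From the infinite tape to finitely many uniform data. -/

section tape

theorem bitsVal_eq_iff {ω ω' : ℕ → ZMod 2} {τ l : ℕ} :
    bitsVal ω τ l = bitsVal ω' τ l ↔ ∀ j < l, ω (τ + j) = ω' (τ + j) := by
  induction l with
  | zero => simp [bitsVal]
  | succ l ih =>
    have h1 := ZMod.val_lt (ω (τ + l))
    have h2 := ZMod.val_lt (ω' (τ + l))
    have h3 : ω (τ + l) = ω' (τ + l) ↔ (ω (τ + l)).val = (ω' (τ + l)).val :=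
      ⟨fun h => by rw [h], fun h => ZMod.val_injective 2 h⟩
    rw [bitsVal, bitsVal]
    constructor
    · intro h j hj
      rcases Nat.lt_succ_iff_lt_or_eq.1 hj with h4 | rfl
      · exact ih.1 (by omega) j h4
      · exact h3.2 (by omega)
    · intro h
      have h4 := ih.2 fun j hj => h j (by omega)
      have h5 := h3.1 (h l (by omega))
      omega

theorem mul_add_lt_mul {i j n r : ℕ} (hi : i < n) (hj : j < r) : i * r + j < n * r :=
  calc i * r + j < i * r + r := by omega
    _ = (i + 1) * r := by ring
    _ ≤ n * r := Nat.mul_le_mul_right _ hi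

variable (n b N : ℕ)

/-- The hash functions. -/
abbrev HashData : Type :=
  (Fin n → Fin (2 ^ (2 * b))) × (Fin (2 * b) → Fin (2 ^ (2 * b)) → Fin (2 ^ b))

/-- The random strings from the coin tosses of a trial. -/
abbrev CoinData : Type := Cube n × Cube n × (Fin (2 ^ (2 * b)) → ZMod 2)

/-- What the tester reads off its coin tosses. -/
def coinData (ω : ℕ → ZMod 2) : HashData n b × (Fin N → CoinData n b) :=
  -- The data read from the coins depend neither on the function nor on the samples, so zeros stand
  -- in for them. This makes later identifications with the actual environment definitional.
  let E : Env n := ⟨0, ω, 0⟩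
  ((phiF b E, hashF b E), fun t => (trialF b E t).1)

/-- The first `tossT b N` tosses are cut without gaps into the digits of `φ`, the digits of the
round hashes and the bits of the trials. A position is located in its block by division with
remainder. -/
theorem coinData_eq_iff (ω ω' : ℕ → ZMod 2) :
    coinData n b N ω = coinData n b N ω' ↔ ∀ i < tossT (n := n) b N, ω i = ω' i := by
  constructor
  · intro h i hi
    obtain ⟨h1, h4⟩ := Prod.mk.inj h
    obtain ⟨h2, h3⟩ := Prod.mk.inj h1
    by_cases hi1 : i < n * (2 * b)
    · have hb : 0 < 2 * b := by
        rcases Nat.eq_zero_or_pos (2 * b) with h0 | h0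
        · rw [h0] at hi1; omega
        · exact h0
      have h5 := congrFun h2 ⟨i / (2 * b), (Nat.div_lt_iff_lt_mul hb).2 hi1⟩
      have h6 := bitsVal_eq_iff.1 (Fin.mk.inj h5) (i % (2 * b)) (Nat.mod_lt _ hb)
      rwa [Nat.div_add_mod'] at h6
    · obtain ⟨i, rfl⟩ := Nat.exists_eq_add_of_le (not_lt.1 hi1)
      by_cases hi2 : i < 2 * b * (2 ^ (2 * b) * b)
      · have hb : 0 < b := by
          rcases Nat.eq_zero_or_pos b with h0 | h0
          · subst h0; simp at hi2
          · exact h0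
        have hmb : 0 < 2 ^ (2 * b) * b := by positivity
        have h5 := congrFun (congrFun h3 ⟨i / (2 ^ (2 * b) * b), (Nat.div_lt_iff_lt_mul hmb).2 hi2⟩)
          ⟨i % (2 ^ (2 * b) * b) / b, (Nat.div_lt_iff_lt_mul hb).2 (Nat.mod_lt _ hmb)⟩
        have h6 := bitsVal_eq_iff.1 (Fin.mk.inj h5) (i % (2 ^ (2 * b) * b) % b) (Nat.mod_lt _ hb)
        rwa [add_assoc, Nat.div_add_mod', tossR, add_assoc, Nat.div_add_mod'] at h6
      · obtain ⟨i, rfl⟩ := Nat.exists_eq_add_of_le (not_lt.1 hi2)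
        rw [tossT, tossR] at hi
        have hi3 : i < N * (n + n + 2 ^ (2 * b)) := by omega
        have hp : 0 < n + n + 2 ^ (2 * b) := by positivity
        have h5 := congrFun h4 ⟨i / (n + n + 2 ^ (2 * b)), (Nat.div_lt_iff_lt_mul hp).2 hi3⟩
        obtain ⟨h6, h7⟩ := Prod.mk.inj h5
        obtain ⟨h8, h9⟩ := Prod.mk.inj h7
        have hdm := Nat.div_add_mod' i (n + n + 2 ^ (2 * b))
        have hlt := Nat.mod_lt i hp
        set e := i % (n + n + 2 ^ (2 * b))
        have key : ∀ x, x = e → tossT (n := n) b (i / (n + n + 2 ^ (2 * b))) + x =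
            n * (2 * b) + (2 * b * (2 ^ (2 * b) * b) + i) := by
          rintro x rfl
          rw [tossT, tossR]; omega
        by_cases he1 : e < n
        · have h10 := congrFun h6 ⟨e, he1⟩
          change ω (tossT (n := n) b (i / (n + n + 2 ^ (2 * b))) + e) =
            ω' (tossT (n := n) b (i / (n + n + 2 ^ (2 * b))) + e) at h10
          rwa [key e rfl] at h10
        · by_cases he2 : e < n + n
          · have h10 : ω (tossT (n := n) b (i / (n + n + 2 ^ (2 * b))) + n + (e - n)) =
                ω' (tossT (n := n) b (i / (n + n + 2 ^ (2 * b))) + n + (e - n)) :=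
              congrFun h8 ⟨e - n, by omega⟩
            rw [add_assoc _ n, key _ (by omega)] at h10
            exact h10
          · have h10 : ω (tossT (n := n) b (i / (n + n + 2 ^ (2 * b))) + n + n + (e - (n + n))) =
                ω' (tossT (n := n) b (i / (n + n + 2 ^ (2 * b))) + n + n + (e - (n + n))) :=
              congrFun h9 ⟨e - (n + n), by omega⟩
            rw [add_assoc _ n n, add_assoc _ (n + n), key _ (by omega)] at h10
            exact h10
  · intro h
    rw [tossT, tossR] at h
    refine Prod.ext (Prod.ext ?_ ?_) ?_
    · funext i
      refine Fin.ext (bitsVal_eq_iff.2 fun j hj => h _ ?_)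
      have := mul_add_lt_mul i.2 hj
      omega
    · funext t a
      refine Fin.ext (bitsVal_eq_iff.2 fun j hj => h _ ?_)
      have h1 := mul_add_lt_mul t.2 (mul_add_lt_mul a.2 hj)
      rw [tossR]
      omega
    · have hm := Nat.two_pow_pos (2 * b)
      funext t
      refine Prod.ext ?_ (Prod.ext ?_ ?_)
      · funext i
        refine h _ ?_
        have h0 := i.2
        have h1 := mul_add_lt_mul (r := n + n + 2 ^ (2 * b)) (j := i) t.2 (by omega)
        rw [tossT, tossR]; omega
      · funext i
        refine h _ ?_
        have h0 := i.2
        have h1 := mul_add_lt_mul (r := n + n + 2 ^ (2 * b)) (j := n + i) t.2 (by omega)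
        rw [tossT, tossR]; omega
      · funext a
        refine h _ ?_
        have h0 := a.2
        have h1 := mul_add_lt_mul (r := n + n + 2 ^ (2 * b)) (j := n + n + a) t.2 (by omega)
        rw [tossT, tossR]; omega

theorem card_hashData_mul :
    Fintype.card (HashData n b) * Fintype.card (CoinData n b) ^ N = 2 ^ tossT (n := n) b N := by
  simp only [Fintype.card_prod, Fintype.card_fun, Fintype.card_fin, ZMod.card, tossT, tossR]
  simp only [← pow_mul, ← pow_add]
  congr 1
  ring

/-- On the tosses that are used the map is injective, and both sides have the same cardinality. So
fair coins yield uniform data. -/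
theorem coinData_surjective (d : HashData n b × (Fin N → CoinData n b)) :
    ∃ ω, coinData n b N ω = d := by
  let K := tossT (n := n) b N
  let ext : (Fin K → ZMod 2) → ℕ → ZMod 2 := fun c i => if h : i < K then c ⟨i, h⟩ else 0
  have hinj : Function.Injective fun c => coinData n b N (ext c) := by
    intro c c' h
    funext i
    have := (coinData_eq_iff n b N _ _).1 h i i.2
    simpa [ext] using this
  have hbij := (Fintype.bijective_iff_injective_and_card _).2 ⟨hinj, by
    rw [Fintype.card_fun, ZMod.card, Fintype.card_fin, Fintype.card_prod, Fintype.card_fun,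
      Fintype.card_fin N, card_hashData_mul]⟩
  obtain ⟨c, hc⟩ := hbij.2 d
  exact ⟨_, hc⟩

/-- What the tester reads off its tape. -/
def tapeData (τ : (ℕ → ZMod 2) × (ℕ → Cube n)) :
    HashData n b × (Fin N → CoinData n b × Cube n) :=
  ((coinData n b N τ.1).1, fun t => ((coinData n b N τ.1).2 t, τ.2 t))

/-- The fibres are cylinders, which gives measurability and reduces their measure to finite
products. -/
theorem tapeData_preimage (ω₀ : ℕ → ZMod 2) (s₀ : ℕ → Cube n) :
    tapeData n b N ⁻¹' {tapeData n b N (ω₀, s₀)} =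
      ((Finset.range (tossT (n := n) b N) : Set ℕ).pi fun i => {ω₀ i}) ×ˢ
        ((Finset.range N : Set ℕ).pi fun t => {s₀ t}) := by
  ext ⟨ω, s⟩
  simp only [Set.mem_preimage, Set.mem_singleton_iff, Set.mem_prod, Set.mem_pi, Finset.coe_range,
    Set.mem_Iio]
  rw [← coinData_eq_iff]
  constructor
  · intro h
    obtain ⟨h1, h2⟩ := Prod.mk.inj h
    refine ⟨Prod.ext h1 ?_, fun t ht => ?_⟩
    · funext t
      exact (Prod.mk.inj (congrFun h2 t)).1
    · exact (Prod.mk.inj (congrFun h2 ⟨t, ht⟩)).2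
  · rintro ⟨h1, h2⟩
    simp only [tapeData, h1]
    congr 1
    funext t
    rw [h2 t t.2]

theorem exists_tapeData (d : HashData n b × (Fin N → CoinData n b × Cube n)) :
    ∃ ω s, tapeData n b N (ω, s) = d := by
  obtain ⟨ω, hω⟩ := coinData_surjective n b N (d.1, fun t => (d.2 t).1)
  refine ⟨ω, fun t => if h : t < N then (d.2 ⟨t, h⟩).2 else 0, ?_⟩
  simp [tapeData, hω]

theorem measurable_tapeData : Measurable (tapeData n b N) := by
  refine measurable_to_countable' fun d => ?_
  obtain ⟨ω, s, rfl⟩ := exists_tapeData n b N d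
  rw [tapeData_preimage]
  exact (MeasurableSet.pi (Finset.countable_toSet _) fun _ _ => MeasurableSet.singleton _).prod
    (MeasurableSet.pi (Finset.countable_toSet _) fun _ _ => MeasurableSet.singleton _)

/-- Compared on singletons: a cylinder has mass `2⁻¹` per toss used times the product of the
`D`-masses of the samples, and `card_hashData_mul` regroups the powers of two. Hash functions and
trials thus become independent, so the selected set is fixed before the trials are drawn. -/
theorem map_tapeLaw (D : Measure (Cube n)) [IsProbabilityMeasure D] :
    (tapeLaw D).map (tapeData n b N) =
      (unif (HashData n b)).prod (Measure.pi fun _ : Fin N => (unif (CoinData n b)).prod D) := by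
  refine Measure.ext_of_singleton fun d => ?_
  obtain ⟨ω, s, rfl⟩ := exists_tapeData n b N d
  rw [Measure.map_apply (measurable_tapeData n b N) (MeasurableSet.singleton _), tapeData_preimage,
    tapeLaw, Measure.prod_prod, Measure.infinitePi_pi _ fun _ _ => MeasurableSet.singleton _,
    Measure.infinitePi_pi _ fun _ _ => MeasurableSet.singleton _]
  have h1 : ∀ a : ZMod 2, (PMF.uniformOfFintype (ZMod 2)).toMeasure {a} = (2 : ENNReal)⁻¹ := by
    intro a
    have := unif_singleton a
    rw [ZMod.card] at this
    exact_mod_cast this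
  simp only [h1, Finset.prod_const, Finset.card_range]
  rw [← Set.singleton_prod_singleton (a := (tapeData n b N (ω, s)).1), Measure.prod_prod,
    Measure.pi_singleton, unif_singleton]
  have h2 : ∀ t : Fin N, (unif (CoinData n b)).prod D {(tapeData n b N (ω, s)).2 t} =
      (Fintype.card (CoinData n b) : ENNReal)⁻¹ * D {s t} := by
    intro t
    rw [← unif_singleton ((tapeData n b N (ω, s)).2 t).1, ← Measure.prod_prod,
      Set.singleton_prod_singleton]
    rfl
  have h3 : (Fintype.card (HashData n b) : ENNReal) * (Fintype.card (CoinData n b) : ENNReal) ^ N =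
      2 ^ tossT (n := n) b N := by exact_mod_cast card_hashData_mul n b N
  rw [Finset.prod_congr rfl fun t _ => h2 t, Finset.prod_mul_distrib, Finset.prod_const,
    Finset.card_univ, Fintype.card_fin, ← mul_assoc, Finset.prod_range, ← ENNReal.inv_pow,
    ← ENNReal.inv_pow, ← ENNReal.mul_inv (by simp) (by simp), h3]

end tape

/-! ### The acceptance probability -/

/-- The factor `64` yields the collision probability `1 / 64` that `pr_majority_le` asks for; its
square makes both `φ`-collisions and the wrong parity count rare. -/
theorem le_two_pow_numBits (k : ℕ) : 64 * (k + 1) ≤ 2 ^ numBits k := by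
  have := Nat.le_pow_clog one_lt_two (k + 1)
  rw [numBits, pow_add]
  omega

theorem two_pow_numBits_le (k : ℕ) : 2 ^ numBits k ≤ 128 * (k + 1) := by
  rw [numBits, pow_add]
  rcases Nat.eq_zero_or_pos k with rfl | hk
  · simp
  · have h1 := Nat.pow_pred_clog_lt_self one_lt_two (x := k + 1) (by omega)
    have h2 : 0 < Nat.clog 2 (k + 1) := Nat.clog_pos one_lt_two (by omega)
    obtain ⟨c, hc⟩ := Nat.exists_eq_succ_of_ne_zero h2.ne'
    rw [hc] at h1 ⊢
    rw [Nat.succ_eq_add_one, pow_succ]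
    simp only [Nat.pred_succ] at h1
    omega

theorem sq_le_two_pow_numBits (k : ℕ) : 4096 * ((k : ℝ) + 1) ^ 2 ≤ 2 ^ (2 * numBits k) := by
  have h : (64 * (k + 1) : ℝ) ≤ 2 ^ numBits k := by exact_mod_cast le_two_pow_numBits k
  calc 4096 * ((k : ℝ) + 1) ^ 2 = (64 * (k + 1)) ^ 2 := by ring
    _ ≤ (2 ^ numBits k) ^ 2 := by gcongr
    _ = _ := by rw [← pow_mul, mul_comm]

section acceptance

variable {n : ℕ} {k b N : ℕ}

/-- The verdict of the tester is "accept". -/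
def Verdict (f : Cube n → ZMod 2) (k : ℕ)
    (z : HashData n b × (Fin N → CoinData n b × Cube n)) : Prop :=
  (selected f z.1.1 z.1.2).card = k ∧ ∀ t, TrialOK f z.1.1 (selected f z.1.1 z.1.2) (z.2 t)

theorem flagN_eq_one_iff_verdict (f : Cube n → ZMod 2) (ω : ℕ → ZMod 2) (s : ℕ → Cube n) :
    flagN k b ⟨f, ω, s⟩ N = 1 ↔ Verdict f k (tapeData n b N (ω, s)) := by
  rw [flagN_eq_one_iff, Verdict]
  refine and_congr Iff.rfl ⟨fun h t => h t t.2, fun h t ht => h ⟨t, ht⟩⟩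

/-- Collisions of `φ` on `S` cost at most `1 / 4096`. Wrong decoding costs at most `4 ^ b * (1 / 9)
^ b`, and `b ≥ 6`. For a linear function in the class these are the only sources of error. -/
theorem pr_bad_hash_le (S : Finset (Fin n)) :
    (pr fun d : HashData n (numBits S.card) =>
      ¬ (Set.InjOn d.1 S ∧ selected (lin S) d.1 d.2 = S.image d.1)) ≤ 1 / 3 := by
  have hm := sq_le_two_pow_numBits S.card
  have hm0 : (0 : ℝ) < 2 ^ (2 * numBits S.card) := by positivity
  have h1 : (pr fun d : HashData n (numBits S.card) => ¬ Set.InjOn d.1 S) ≤ 1 / 4096 := by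
    rw [pr_fst (β := Fin (2 * numBits S.card) → Fin (2 ^ (2 * numBits S.card)) →
      Fin (2 ^ numBits S.card)) fun φ : Fin n → Fin (2 ^ (2 * numBits S.card)) => ¬ Set.InjOn φ S]
    refine (pr_not_injOn_le S).trans ?_
    rw [Fintype.card_fin]
    push_cast
    rw [div_le_div_iff₀ hm0 (by norm_num)]
    nlinarith
  have h2 : (pr fun d : HashData n (numBits S.card) =>
      Set.InjOn d.1 S ∧ selected (lin S) d.1 d.2 ≠ S.image d.1) ≤ (4 / 9) ^ 6 := by
    refine pr_prod_le fun φ => ?_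
    by_cases hφ : Set.InjOn φ S
    · refine (pr_mono fun H hH => hH.2).trans ((pr_selected_ne_le hφ ?_).trans ?_)
      · rw [Fintype.card_fin]
        have h : (64 * (S.card + 1) : ℝ) ≤ 2 ^ numBits S.card := by
          exact_mod_cast le_two_pow_numBits S.card
        push_cast
        rw [div_le_div_iff₀ (by positivity) (by norm_num)]
        linarith
      · rw [Fintype.card_fin]
        push_cast
        rw [← mul_pow, pow_mul]
        refine (pow_le_pow_of_le_one (by norm_num) (by norm_num)
          (show 6 ≤ numBits S.card by unfold numBits; omega)).trans (le_of_eq (by norm_num))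
    · simp only [hφ, false_and]
      simp [pr]
      norm_num
  refine (pr_mono fun d hd => ?_).trans ((pr_or_le _ _).trans ((add_le_add h1 h2).trans
    (by norm_num)))
  tauto

theorem two_thirds_le_real_verdict (D : Measure (Cube n)) [IsProbabilityMeasure D]
    {S : Finset (Fin n)} (hS : S.card = k) :
    2 / 3 ≤ ((unif (HashData n (numBits k))).prod (Measure.pi fun _ : Fin N =>
      (unif (CoinData n (numBits k))).prod D)).real {z | Verdict (lin S) k z} := by
  subst hS
  have h1 := pr_bad_hash_le S
  rw [pr_not, ← unif_real] at h1
  have h2 : {d : HashData n (numBits S.card) |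
      Set.InjOn d.1 S ∧ selected (lin S) d.1 d.2 = S.image d.1} ×ˢ
        (Set.univ : Set (Fin N → CoinData n (numBits S.card) × Cube n)) ⊆
      {z | Verdict (lin S) S.card z} := by
    rintro z ⟨⟨hφ, h⟩, -⟩
    refine ⟨by rw [h, Finset.card_image_of_injOn hφ], fun t => ?_⟩
    rw [h]
    exact trialOK_lin hφ _
  refine le_trans ?_ (measureReal_mono h2)
  rw [measureReal_prod_prod, probReal_univ, mul_one]
  linarith

theorem one_sub_pow_le {p : ℝ} (hp : p ≤ 1) (h : 2 ≤ p * N) : (1 - p) ^ N ≤ 1 / 7 := by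
  have h1 : (7 : ℝ) ≤ Real.exp 2 := by
    have h2 : Real.exp 2 = Real.exp 1 * Real.exp 1 := by rw [← Real.exp_add]; norm_num
    have := Real.exp_one_gt_d9
    nlinarith
  calc (1 - p) ^ N ≤ Real.exp (-p) ^ N :=
        pow_le_pow_left₀ (by linarith) (Real.one_sub_le_exp_neg p) N
    _ = Real.exp (-(p * N)) := by rw [← Real.exp_nat_mul]; ring_nf
    _ ≤ Real.exp (-2) := Real.exp_le_exp.2 (by linarith)
    _ ≤ 1 / 7 := by
        rw [Real.exp_neg, ← one_div]
        exact one_div_le_one_div_of_le (by norm_num) h1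

theorem real_verdict_le (D : Measure (Cube n)) [IsProbabilityMeasure D] {f : Cube n → ZMod 2}
    {ε : ℝ} (hf : ∀ g ∈ kLinear n k, IsFar D ε f g) (hN : 16 ≤ N) (hε : 16 ≤ ε * N) :
    ((unif (HashData n (numBits k))).prod (Measure.pi fun _ : Fin N =>
      (unif (CoinData n (numBits k))).prod D)).real {z | Verdict f k z} ≤ 1 / 3 := by
  have hN' : (16 : ℝ) ≤ N := by exact_mod_cast hN
  let ok : HashData n (numBits k) → CoinData n (numBits k) × Cube n → Prop := fun d x =>
    (selected f d.1 d.2).card = k ∧ TrialOK f d.1 (selected f d.1 d.2) x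
  -- The common scheme of the three cases: bad hashing costs at most `1 / 7`, and `N` trials with
  -- failure probability `p`, where `p * N ≥ 2`, all pass with probability at most `exp (-2) ≤ 1 /
  -- 7`; moreover `2 / 7 ≤ 1 / 3`.
  have main : ∀ (bad : HashData n (numBits k) → Prop) (p : ℝ), p ≤ 1 → 2 ≤ p * N →
      pr bad ≤ 1 / 7 →
      (∀ d, ¬ bad d → ((unif (CoinData n (numBits k))).prod D).real {x | ok d x} ≤ 1 - p) →
      ((unif (HashData n (numBits k))).prod (Measure.pi fun _ : Fin N =>
        (unif (CoinData n (numBits k))).prod D)).real {z | Verdict f k z} ≤ 1 / 3 := by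
    intro bad p hp1 hp2 hbad h
    have h1 := real_forall_trials_le ((unif (CoinData n (numBits k))).prod D) N bad ok hp1 h
    have h2 := one_sub_pow_le hp1 hp2
    refine (measureReal_mono ?_).trans (h1.trans (by linarith))
    exact fun z hz t => ⟨hz.1, hz.2 t⟩
  have pr_false : (pr fun _ : HashData n (numBits k) => False) = 0 := by simp [pr]
  by_cases hclose : ∀ S : Finset (Fin n), 1 / 8 ≤ pr fun x => f x ≠ lin S x
  · refine main (fun _ => False) (1 / 8) (by norm_num) (by linarith) (by rw [pr_false]; norm_num)
      fun d _ => ?_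
    have h1 := real_trial_le D (ok d) Set.univ (c := 1 / 8) (by norm_num) fun x _ =>
      (pr_mono fun u hu => hu.2).trans (pr_trialOK_le_of_far hclose _ _ x)
    rwa [probReal_univ, mul_one] at h1
  · push Not at hclose
    obtain ⟨S, hS⟩ := hclose
    by_cases hk : S.card = k
    · have hfar : ε ≤ D.real {x | f x ≠ lin S x} := hf (lin S) ⟨S, hk, fun _ => rfl⟩
      refine main (fun _ => False) (3 / 4 * D.real {x | f x ≠ lin S x}) ?_ ?_
        (by rw [pr_false]; norm_num) fun d _ => ?_
      · linarith [measureReal_le_one (μ := D) (s := {x | f x ≠ lin S x})]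
      · nlinarith
      · exact real_trial_le D (ok d) _ (by norm_num) fun x hx =>
          (pr_mono fun u hu => hu.2).trans (pr_trialOK_le_of_ne hS.le hx _ _)
    -- Outside the bad event the odd buckets are not `k` in number. Either the selected ones are not
    -- `k` either, and the verdict is negative, or the two sets differ and the third check applies.
    · refine main (fun d => (oddImage d.1 S).card = k) (1 / 4) (by norm_num) (by linarith) ?_
        fun d hd => ?_
      · rw [pr_fst (β := Fin (2 * numBits k) → Fin (2 ^ (2 * numBits k)) → Fin (2 ^ numBits k))
          fun φ : Fin n → Fin (2 ^ (2 * numBits k)) => (oddImage φ S).card = k]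
        rcases lt_or_gt_of_ne hk with h | h
        · have h0 : ∀ φ : Fin n → Fin (2 ^ (2 * numBits k)), (oddImage φ S).card ≠ k :=
            fun φ hφ => by have := card_oddImage_le φ S; omega
          simp only [h0]
          simp [pr]
        · refine (pr_card_oddImage_eq_le h).trans ?_
          rw [Fintype.card_fin]
          push_cast
          rw [div_le_div_iff₀ (by positivity) (by norm_num)]
          linarith [sq_le_two_pow_numBits k, sq_nonneg ((k : ℝ) + 1)]
      · by_cases hc : (selected f d.1 d.2).card = k
        · have h1 := real_trial_le D (ok d) Set.univ (c := 1 / 4) (by norm_num) fun x _ =>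
            (pr_mono fun u hu => hu.2).trans (pr_trialOK_le_of_oddImage_ne hS.le
              (fun h => hd (by rw [h, hc])) x)
          rwa [probReal_univ, mul_one] at h1
        · simp [ok, hc]
          norm_num

instance (D : Measure (Cube n)) [IsProbabilityMeasure D] : IsProbabilityMeasure (tapeLaw D) := by
  unfold tapeLaw
  have := fun _ : ℕ => PMF.toMeasure.isProbabilityMeasure (PMF.uniformOfFintype (ZMod 2))
  infer_instance

theorem tapeLaw_real_verdict (D : Measure (Cube n)) [IsProbabilityMeasure D]
    (f : Cube n → ZMod 2) :
    (tapeLaw D).real {τ | Verdict f k (tapeData n b N τ)} =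
      ((unif (HashData n b)).prod (Measure.pi fun _ : Fin N =>
        (unif (CoinData n b)).prod D)).real {z | Verdict f k z} := by
  rw [← map_tapeLaw, map_measureReal_apply (measurable_tapeData n b N)
    (Set.toFinite _).measurableSet]
  rfl

theorem tapeLaw_real_not_verdict (D : Measure (Cube n)) [IsProbabilityMeasure D]
    (f : Cube n → ZMod 2) :
    (tapeLaw D).real {τ | ¬ Verdict f k (tapeData n b N τ)} =
      1 - (tapeLaw D).real {τ | Verdict f k (tapeData n b N τ)} := by
  have : MeasurableSet {τ | Verdict f k (tapeData n b N τ)} :=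
    measurable_tapeData n b N (Set.toFinite {z | Verdict f k z}).measurableSet
  exact probReal_compl_eq_one_sub this

end acceptance

/-! ### Properties of the tester -/

section numTrials

variable {q : ℚ}

theorem cast_eq_toNat_div (hq : 0 < q) : (q : ℝ) = q.num.toNat / q.den := by
  have h : ((q.num.toNat : ℤ) : ℝ) = q.num := by
    rw [Int.toNat_of_nonneg (Rat.num_pos.2 hq).le]
  rw [Rat.cast_def, ← h, Int.cast_natCast]

theorem le_numTrials_mul (hq : 0 < q) : (16 : ℝ) ≤ numTrials q * q := by
  have hp : 0 < q.num.toNat := by have := Rat.num_pos.2 hq; omega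
  have h := (lt_ceilDiv_iff (d := 16 * q.den) (j := numTrials q) hp).not.1 (lt_irrefl _)
  have h1 : (16 * q.den : ℝ) ≤ numTrials q * q.num.toNat := by exact_mod_cast not_lt.1 h
  have hd : (0 : ℝ) < q.den := by exact_mod_cast q.den_pos
  rw [cast_eq_toNat_div hq, ← mul_div_assoc, le_div_iff₀ hd]
  exact h1

theorem numTrials_mul_le (hq : 0 < q) : (numTrials q : ℝ) * q ≤ 16 + q := by
  have hp : 0 < q.num.toNat := by have := Rat.num_pos.2 hq; omega
  have hd : (0 : ℝ) < q.den := by exact_mod_cast q.den_pos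
  have hq' : (0 : ℝ) < q := by exact_mod_cast hq
  rcases Nat.eq_zero_or_pos (numTrials q) with h0 | h0
  · rw [h0]; push_cast; linarith
  · obtain ⟨j, hj⟩ := Nat.exists_eq_succ_of_ne_zero h0.ne'
    have h := (lt_ceilDiv_iff (d := 16 * q.den) (j := j) hp).1 (by
      rw [numTrials] at hj; rw [hj]; exact Nat.lt_succ_self j)
    have h1 : (j * q.num.toNat : ℝ) ≤ 16 * q.den := by exact_mod_cast h.le
    have h2 : (j : ℝ) * q ≤ 16 := by
      rw [cast_eq_toNat_div hq, ← mul_div_assoc, div_le_iff₀ hd]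
      exact h1
    rw [hj]; push_cast; linarith

theorem numTrials_le (hq : 0 < q) {ε : ℝ} (hε : ε / 2 ≤ q) (hε0 : 0 < ε) :
    (numTrials q : ℝ) ≤ 32 * (1 / ε) + 1 := by
  have hq' : (0 : ℝ) < q := by exact_mod_cast hq
  have h1 : (numTrials q : ℝ) ≤ 16 / q + 1 := by
    rw [div_add_one hq'.ne', le_div_iff₀ hq']
    exact numTrials_mul_le hq
  have h2 : (16 : ℝ) / q ≤ 16 / (ε / 2) := by gcongr
  have h3 : (16 : ℝ) / (ε / 2) = 32 * (1 / ε) := by field_simp; norm_num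
  linarith

end numTrials

section tester

variable {n k : ℕ} {q : ℚ}

theorem accepts_iff (hq : 0 < q) (hq1 : q ≤ 1) (f : Cube n → ZMod 2) (ω : ℕ → ZMod 2)
    (s : ℕ → Cube n) : Accepts tester n k q f ω s ↔
      Verdict f k (tapeData n (numBits k) (numTrials q) (ω, s)) := by
  obtain ⟨t, σ, h, -, h1, -⟩ := tester_spec (k := k) ⟨f, ω, s⟩ hq hq1
  rw [← flagN_eq_one_iff_verdict, ← h1]
  constructor
  · rintro ⟨t', σ', h', h2⟩
    rwa [(Exec.det h h').2]
  · exact fun h2 => ⟨t, σ, h, h2⟩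

theorem rejects_iff (hq : 0 < q) (hq1 : q ≤ 1) (f : Cube n → ZMod 2) (ω : ℕ → ZMod 2)
    (s : ℕ → Cube n) : Rejects tester n k q f ω s ↔
      ¬ Verdict f k (tapeData n (numBits k) (numTrials q) (ω, s)) := by
  obtain ⟨t, σ, h, -, h1, -⟩ := tester_spec (k := k) ⟨f, ω, s⟩ hq hq1
  rw [← flagN_eq_one_iff_verdict, ← h1]
  constructor
  · rintro ⟨t', σ', h', h2⟩
    rwa [(Exec.det h h').2]
  · exact fun h2 => ⟨t, σ, h, h2⟩

theorem isDistributionFreeTester_tester {ε : ℝ} (hkn : k ≤ n) (hq : 0 < q) (hqε : (q : ℝ) ≤ ε) :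
    IsDistributionFreeTester tester n k q ε (kLinear n k) := by
  intro D _ f
  rcases le_or_gt q 1 with hq1 | hq1
  · simp only [accepts_iff hq hq1, rejects_iff hq hq1]
    constructor
    · rintro ⟨S, hS, hf⟩
      rw [tapeLaw_real_verdict, show f = lin S from funext hf]
      exact two_thirds_le_real_verdict D hS
    · intro hf
      have h1 := le_numTrials_mul hq
      have h2 : (q : ℝ) ≤ 1 := by exact_mod_cast hq1
      have h3 : (16 : ℝ) ≤ numTrials q :=
        h1.trans (mul_le_of_le_one_right (Nat.cast_nonneg _) h2)
      rw [tapeLaw_real_not_verdict, tapeLaw_real_verdict]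
      have := real_verdict_le (N := numTrials q) D hf (by exact_mod_cast h3)
        (h1.trans (by rw [mul_comm]; gcongr))
      linarith
  · have h2 : (1 : ℝ) < q := by exact_mod_cast hq1
    constructor
    · intro _
      have h : {τ : (ℕ → ZMod 2) × (ℕ → Cube n) | Accepts tester n k q f τ.1 τ.2} = Set.univ := by
        ext τ
        obtain ⟨t, σ, h, -, h1, -⟩ := tester_spec_of_one_lt (k := k) ⟨f, τ.1, τ.2⟩ hq1
        exact ⟨fun _ => trivial, fun _ => ⟨t, σ, h, h1⟩⟩
      rw [h, probReal_univ]
      norm_num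
    · intro hf
      -- As `k ≤ n`, the class is nonempty, and `ε > 1` makes farness from its member impossible.
      obtain ⟨S, -, hS⟩ := Finset.exists_subset_card_eq (s := (Finset.univ : Finset (Fin n)))
        (n := k) (by simpa using hkn)
      have h3 : ε ≤ D.real {x | f x ≠ lin S x} := hf (lin S) ⟨S, hS, fun _ => rfl⟩
      linarith [measureReal_le_one (μ := D) (s := {x | f x ≠ lin S x})]

theorem nonAdaptive_tester (hq : 0 < q) : NonAdaptive tester n k q := by
  intro ω s
  rcases le_or_gt q 1 with hq1 | hq1
  -- The list of queries computed with the zero function serves for every `f`, since no queried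
  -- string involves an answer.
  · refine ⟨queriesR (numBits k) ⟨0, ω, s⟩ (2 * numBits k) ++
      queriesT (n := n) (numBits k) ⟨0, ω, s⟩ (numTrials q), fun f t σ h => ?_⟩
    obtain ⟨t', σ', h', -, -, -, h1⟩ := tester_spec (k := k) ⟨f, ω, s⟩ hq hq1
    rw [(Exec.det h h').2, h1]
    rfl
  · refine ⟨[], fun f t σ h => ?_⟩
    obtain ⟨t', σ', h', -, -, -, h1⟩ := tester_spec_of_one_lt (k := k) ⟨f, ω, s⟩ hq1
    rw [(Exec.det h h').2, h1]

theorem length_queriesR (b : ℕ) (E : Env n) (t : ℕ) :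
    (queriesR b E t).length = t * 2 ^ b := by
  simp [queriesR]

theorem length_queriesT (b : ℕ) (E : Env n) (t : ℕ) : (queriesT b E t).length = t * 6 := by
  simp [queriesT]

/-- For `k ≤ 1` the term `k log k` vanishes, and the constant `2 * 8 * 256` is absorbed by `1 / ε ≥
1 / 2`; this is what `ε ≤ 2` is for. For `k ≥ 2`, `2 ^ b ≤ 192 * k`, and taking logarithms gives `b
≤ 18 * log k`. -/
theorem numBits_mul_two_pow_le {ε : ℝ} (hε : 0 < ε) (hε2 : ε ≤ 2) :
    2 * (numBits k : ℝ) * 2 ^ numBits k ≤ 8192 * (k * Real.log k + 1 / ε) := by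
  have h1 : (2 : ℝ) ^ numBits k ≤ 128 * (k + 1) := by exact_mod_cast two_pow_numBits_le k
  have h2 : (1 : ℝ) / 2 ≤ 1 / ε := one_div_le_one_div_of_le hε hε2
  rcases Nat.lt_or_ge k 2 with hk | hk
  · have hk1 : (k : ℝ) ≤ 1 := by exact_mod_cast (by omega : k ≤ 1)
    have h3 : numBits k ≤ 8 := by
      refine (Nat.pow_le_pow_iff_right one_lt_two).1 ((two_pow_numBits_le k).trans ?_)
      omega
    have h4 : (numBits k : ℝ) ≤ 8 := by exact_mod_cast h3
    have h5 : 0 ≤ (k : ℝ) * Real.log k := by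
      rcases Nat.eq_zero_or_pos k with rfl | h
      · simp
      · exact mul_nonneg (by positivity) (Real.log_nonneg (by exact_mod_cast h))
    calc 2 * (numBits k : ℝ) * 2 ^ numBits k ≤ 2 * 8 * 256 := by
          gcongr
          linarith
      _ ≤ _ := by linarith
  · have hk2 : (2 : ℝ) ≤ k := by exact_mod_cast hk
    have hlog2 : 1 / 2 ≤ Real.log 2 := by have := Real.log_two_gt_d9; linarith
    have hlogk : Real.log 2 ≤ Real.log k := Real.log_le_log (by norm_num) hk2
    have h3 : (2 : ℝ) ^ numBits k ≤ 2 ^ 8 * k := h1.trans (by linarith)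
    have h4 : (numBits k : ℝ) * Real.log 2 ≤ 8 * Real.log 2 + Real.log k := by
      have := Real.log_le_log (by positivity) h3
      rwa [Real.log_mul (by norm_num) (by positivity), Real.log_pow, Real.log_pow] at this
    have h5 : (numBits k : ℝ) ≤ 18 * Real.log k := by
      have h6 : (numBits k : ℝ) * (1 / 2) ≤ numBits k * Real.log 2 := by gcongr
      linarith
    calc 2 * (numBits k : ℝ) * 2 ^ numBits k ≤ 2 * (18 * Real.log k) * (192 * k) := by
          gcongr
          linarith
      _ = 6912 * (k * Real.log k) := by ring
      _ ≤ _ := by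
          have : 0 ≤ (k : ℝ) * Real.log k := mul_nonneg (by positivity) (by linarith)
          linarith

theorem queryBound_tester {ε : ℝ} (hε0 : 0 < ε) (hε : ε / 2 ≤ q) :
    QueryBound tester n k q (10000 * (k * Real.log k + 1 / ε)) := by
  intro f ω s t σ h
  have hq' : (0 : ℝ) < q := by linarith
  have hq : 0 < q := by exact_mod_cast hq'
  have hk : 0 ≤ (k : ℝ) * Real.log k := by
    rcases Nat.eq_zero_or_pos k with rfl | h
    · simp
    · exact mul_nonneg (by positivity) (Real.log_nonneg (by exact_mod_cast h))
  rcases le_or_gt q 1 with hq1 | hq1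
  · have hq1' : (q : ℝ) ≤ 1 := by exact_mod_cast hq1
    obtain ⟨t', σ', h', -, -, h1, h2⟩ := tester_spec (k := k) ⟨f, ω, s⟩ hq hq1
    rw [(Exec.det h h').2, h1, h2, List.length_append, length_queriesR, length_queriesT]
    push_cast
    have h3 := numBits_mul_two_pow_le (k := k) hε0 (by linarith)
    have h4 := numTrials_le hq hε hε0
    -- A trial makes six queries and one draw, so the trials cost `7 * N ≤ 224 / ε + 7`; the summand
    -- `7` is absorbed by `1 / ε ≥ 1 / 2`.
    have h5 : (1 : ℝ) / 2 ≤ 1 / ε := one_div_le_one_div_of_le hε0 (by linarith)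
    linarith
  · obtain ⟨t', σ', h', -, -, h1, h2⟩ := tester_spec_of_one_lt (k := k) ⟨f, ω, s⟩ hq1
    rw [(Exec.det h h').2, h1, h2]
    have : 0 < 1 / ε := by positivity
    simp only [List.length_nil, Nat.cast_zero, add_zero]
    positivity

/-- The cubic terms come from decoding: rounds times buckets times the length of a label or of a
string. -/
theorem stepBound_le {N : ℕ} {Y : ℝ} (hY : 1 ≤ Y) (hn : (n : ℝ) ≤ Y) (hb : (numBits k : ℝ) ≤ Y)
    (hB : (2 : ℝ) ^ numBits k ≤ Y) (hm : (2 : ℝ) ^ (2 * numBits k) ≤ Y) (hN : (N : ℝ) ≤ Y) :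
    (stepBound n k N : ℝ) ≤ 10000 * Y ^ 3 := by
  have h1 : Y ≤ Y ^ 3 := le_self_pow₀ hY (by norm_num)
  have h2 : Y ^ 2 ≤ Y ^ 3 := pow_le_pow_right₀ hY (by norm_num)
  rw [stepBound]
  push_cast
  calc _ ≤ 6 + (Y * 100 + Y * 30 + 200 + (Y * (2 * Y * 28 + 31) + 9 +
      (2 * Y * (Y * (Y * 28 + 36) + 9 + (Y * (Y * 101 + 80) + 9) + (Y * 100 + 9) + 12) + 9) +
      (Y * 150 + 50 + (Y * (Y * 1006 + Y * 300 + 700 + 12) + 9 + 4)))) := by gcongr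
    _ ≤ 10000 * Y ^ 3 := by nlinarith

theorem haltsWithin_tester {ε : ℝ} {c : ℕ} (hk : (k : ℝ) < Real.sqrt n) (hε0 : 0 < ε)
    (hε : ε / 2 ≤ q) (hc3 : 3 ≤ c) (hc : (10000 * 65536 ^ 3 : ℝ) ≤ c) :
    HaltsWithin tester n k q (c * ((n : ℝ) + 1 / ε) ^ c) := by
  intro f ω s
  have hq : 0 < q := by exact_mod_cast (by linarith : (0 : ℝ) < q)
  have hε' : 0 < 1 / ε := by positivity
  have hkn : k * k < n := by
    have := (Real.lt_sqrt (Nat.cast_nonneg k)).1 hk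
    rw [sq] at this
    exact_mod_cast this
  have hn : (1 : ℝ) ≤ n := by exact_mod_cast (by omega : 1 ≤ n)
  have hkn' : (k : ℝ) * k ≤ n := by exact_mod_cast hkn.le
  have hk1 : (k : ℝ) ≤ n := by exact_mod_cast (Nat.le_mul_self k).trans hkn.le
  set X := (n : ℝ) + 1 / ε with hX
  have hX1 : 1 ≤ X := by linarith
  have hXc : X ^ 3 ≤ X ^ c := pow_le_pow_right₀ hX1 hc3
  have hX3 : 1 ≤ X ^ 3 := one_le_pow₀ hX1
  rcases le_or_gt q 1 with hq1 | hq1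
  · obtain ⟨t, σ, h, ht, -⟩ := tester_spec (k := k) ⟨f, ω, s⟩ hq hq1
    refine ⟨t, σ, h, ?_⟩
    have hB : (2 : ℝ) ^ numBits k ≤ 128 * (k + 1) := by exact_mod_cast two_pow_numBits_le k
    have hb : (numBits k : ℝ) ≤ 2 ^ numBits k := by exact_mod_cast Nat.lt_two_pow_self.le
    -- Here `k * k < n` is essential: the `2 ^ (2 * b)` large buckets number at most `16384 * (k +
    -- 1) ^ 2`, and each of `k * k`, `k` and `1` is at most `n`, so `65536 = 4 * 16384` suffices.
    have hm : (2 : ℝ) ^ (2 * numBits k) ≤ 65536 * X := by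
      calc (2 : ℝ) ^ (2 * numBits k) = (2 ^ numBits k) ^ 2 := by rw [← pow_mul, mul_comm]
        _ ≤ (128 * (k + 1)) ^ 2 := by gcongr
        _ = 16384 * (k * k + 2 * k + 1) := by ring
        _ ≤ 65536 * X := by linarith
    have hN := numTrials_le hq hε hε0
    calc (t : ℝ) ≤ stepBound n k (numTrials q) := by exact_mod_cast ht
      _ ≤ 10000 * (65536 * X) ^ 3 := stepBound_le (by linarith) (by linarith) (by linarith)
          (by linarith) hm (by linarith)
      _ = 10000 * 65536 ^ 3 * X ^ 3 := by ring
      _ ≤ c * X ^ c := by gcongr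
  · obtain ⟨t, σ, h, ht, -⟩ := tester_spec_of_one_lt (k := k) ⟨f, ω, s⟩ hq1
    refine ⟨t, σ, h, ?_⟩
    calc (t : ℝ) ≤ 9 := by exact_mod_cast ht
      _ ≤ 10000 * 65536 ^ 3 * 1 := by norm_num
      _ ≤ c * X ^ c := by gcongr; linarith

end tester

end KLinearTesting

end

/-- One program `P` is, for all `n`, all `k < √n` and all `ε > 0`, a polynomial-time non-adaptive
distribution-free two-sided `ε`-tester for `k`-Linear with `O(k log k + 1/ε)` oracle calls. The
real number `ε` is given to the program through a rational number `q` with `ε / 2 ≤ q ≤ ε`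
(`q = ε` if `ε` is rational). -/
theorem mainTheorem1 :
    ∃ (P : KLinearTesting.Prog) (A : ℝ) (c : ℕ),
      ∀ (n k : ℕ) (ε : ℝ) (q : ℚ), (k : ℝ) < Real.sqrt n → 0 < ε → ε / 2 ≤ q → (q : ℝ) ≤ ε →
        KLinearTesting.HaltsWithin P n k q (c * ((n : ℝ) + 1 / ε) ^ c) ∧
        KLinearTesting.QueryBound P n k q (A * (k * Real.log k + 1 / ε)) ∧
        KLinearTesting.NonAdaptive P n k q ∧
        KLinearTesting.IsDistributionFreeTester P n k q ε (KLinearTesting.kLinear n k) := by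
  -- The same `c` serves as factor and exponent: a cubic bound with this constant suffices, since `n
  -- + 1 / ε ≥ 1`.
  obtain ⟨c, hc⟩ := exists_nat_ge (10000 * 65536 ^ 3 : ℝ)
  have hc3 : 3 ≤ c := by
    have : (3 : ℝ) ≤ c := le_trans (by norm_num) hc
    exact_mod_cast this
  refine ⟨KLinearTesting.tester, 10000, c, fun n k ε q hk hε0 hε hqε => ?_⟩
  have hq : 0 < q := by exact_mod_cast (by linarith : (0 : ℝ) < q)
  have hkn : k ≤ n := by
    have h := (Real.lt_sqrt (Nat.cast_nonneg k)).1 hk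
    rw [sq] at h
    exact (Nat.le_mul_self k).trans (by exact_mod_cast h.le)
  exact ⟨KLinearTesting.haltsWithin_tester hk hε0 hε hc3 hc,
    KLinearTesting.queryBound_tester hε0 hε, KLinearTesting.nonAdaptive_tester hq,
    KLinearTesting.isDistributionFreeTester_tester hkn hq hqε⟩
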